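/- Let $\mathbb{F}_q$ be a finite field with $q$ elements and let $\mathcal{M}_k\subset\mathbb{F}_q[T]$ be the set of monic polynomials of degree $k$. Put $\delta=1-\frac{1+\log\log 2}{\log 2}$. For $A,M,A_1,A_2,M_1,M_2\in\mathbb{F}_q[T]$ and integers $0\le b\le n$ let $$H(n,b;A,M)=\{F\in\mathcal{M}_n : F \text{ has a divisor of degree } b \text{ and } F\equiv A \bmod M\},$$ $$H'(n,b;A,M)=\{F\in\mathcal{M}_n : \text{there is } G\in\mathcal{M}_b \text{ with } G\mid F \text{ and } G\equiv A \bmod M\},$$ $$H(n,b;A_1,A_2,M_1,M_2)=\{G_1G_2 : G_1\in\mathcal{M}_b,\ G_2\in\mathcal{M}_{n-b},\ G_i\equiv A_i \bmod M_i \ (i=1,2)\},$$ and put $M(2n;A,M)=H(2n,n;A,M)$, $M'(2n;A,M)=H'(2n,n;A,M)$ and $M(2n;A_1,A_2,M_1,M_2)=H(2n,n;A_1,A_2,M_1,M_2)$. Fix $q$, nonzero $M_1,M_2\in\mathbb{F}_q[T]$, and $A_1,A_2\in\mathbb{F}_q[T]$ that are both coprime to $\mathrm{lcm}(M_1,M_2)$.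 Then there are constants $c,C>0$ and $n_0$, depending only on $q,M_1,M_2,A_1,A_2$, such that the following holds for all integers $n\ge n_0$. (1) For every integer $b$ with $1\le b\le n/2$ such that, for some $\epsilon>0$, $\deg M_i\le(\frac12-\epsilon)b$ for $i=1,2$, each of the three numbers $|H(n,b;A_1,M_1)|$, $|H'(n,b;A_1,M_1)|$ and $|H(n,b;A_1,A_2,M_1,M_2)|$ lies between $$c\,\frac{q^n}{b^{\delta}(1+\log b)^{3/2}}\quad\text{and}\quad C\,\frac{q^n}{b^{\delta}(1+\log b)^{3/2}}.$$ (2) Each of the three numbers $|M(2n;A_1,M_1)|$, $|M'(2n;A_1,M_1)|$ and $|M(2n;A_1,A_2,M_1,M_2)|$ lies between $$c\,\frac{q^{2n}}{n^{\delta}(1+\log n)^{3/2}}\quad\text{and}\quad C\,\frac{q^{2n}}{n^{\delta}(1+\log n)^{3/2}}.$$ -/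

import Mathlib

open Polynomial Filter

namespace PolyTable

/-- The exponent `δ = 1 - (1 + log log 2) / log 2 = 0.08607…`. -/
noncomputable def delta : ℝ := 1 - (1 + Real.log (Real.log 2)) / Real.log 2

/-- `q ^ n / (b ^ δ * (1 + log b) ^ (3/2))`, the claimed order of magnitude. -/
noncomputable def order (q n b : ℕ) : ℝ :=
  (q : ℝ) ^ n / ((b : ℝ) ^ delta * (1 + Real.log b) ^ (3 / 2 : ℝ))

/-- The set `S` is finite, with `c * x ≤ |S| ≤ C * x`. -/
def SizeBetween {α : Type*} (c C x : ℝ) (S : Set α) : Prop :=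
  S.Finite ∧ c * x ≤ (S.ncard : ℝ) ∧ (S.ncard : ℝ) ≤ C * x

section Sets

variable {F : Type*} [Field F]

/-- Monic polynomials of degree `n`. -/
def MonicOfDegree (F : Type*) [Field F] (n : ℕ) : Set F[X] :=
  {P | P.Monic ∧ P.natDegree = n}

/-- The congruence `G ≡ A mod M`. -/
def CongrMod (M G A : F[X]) : Prop := M ∣ G - A

/-- `H(n,b;A,M)`: monic polynomials of degree `n`, congruent to `A` mod `M`, having a divisor
of degree `b`. -/
def H (n b : ℕ) (A M : F[X]) : Set F[X] :=
  {P | P ∈ MonicOfDegree F n ∧ (∃ G : F[X], G.natDegree = b ∧ G ∣ P) ∧ CongrMod M P A}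

/-- `H'(n,b;A,M)`: monic polynomials of degree `n` having a monic divisor of degree `b`
congruent to `A` mod `M`. -/
def H' (n b : ℕ) (A M : F[X]) : Set F[X] :=
  {P | P ∈ MonicOfDegree F n ∧ ∃ G ∈ MonicOfDegree F b, G ∣ P ∧ CongrMod M G A}

/-- `H(n,b;A₁,A₂,M₁,M₂)`: products `G₁ * G₂` with `G₁` monic of degree `b`, `G₂` monic of degree
`n - b`, and `G_i ≡ A_i mod M_i` (only meaningful for `b ≤ n`). -/
def H₂ (n b : ℕ) (A₁ A₂ M₁ M₂ : F[X]) : Set F[X] :=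
  {P | ∃ G₁ ∈ MonicOfDegree F b, ∃ G₂ ∈ MonicOfDegree F (n - b),
    CongrMod M₁ G₁ A₁ ∧ CongrMod M₂ G₂ A₂ ∧ P = G₁ * G₂}

/-- `M(2n;A,M) = H(2n,n;A,M)`. -/
def Table (n : ℕ) (A M : F[X]) : Set F[X] := H (2 * n) n A M

/-- `M'(2n;A,M) = H'(2n,n;A,M)`. -/
def Table' (n : ℕ) (A M : F[X]) : Set F[X] := H' (2 * n) n A M

/-- `M(2n;A₁,A₂,M₁,M₂) = H(2n,n;A₁,A₂,M₁,M₂)`. -/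
def Table₂ (n : ℕ) (A₁ A₂ M₁ M₂ : F[X]) : Set F[X] := H₂ (2 * n) n A₁ A₂ M₁ M₂

/-- The degree condition `deg M ≤ (1/2 - ε) b` (used for `M ≠ 0`). -/
def DegreeCondition (ε : ℝ) (b : ℕ) (M : F[X]) : Prop :=
  (M.natDegree : ℝ) ≤ (1 / 2 - ε) * b

end Sets

end PolyTable

/-! Every `f` counted by any of the three sets is monic of degree `n` with a divisor of degree `b`,
and each set contains an `H₂` for one common modulus, the monic associate `M` of `M₁ * M₂` (for `H`
with the classes `1` and `A₁`). So it suffices to bound from above the number of `f` with a divisor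
of degree `b`, forgetting congruences (`exists_card_divisor_le`), and to bound `H₂` with modulus `M`
from below (`exists_le_ncard_H₂`). For bounded `b` it is enough to fix one factor and let the other
vary.

Both bounds reduce to the sum of `L(a) / q ^ deg a` over sets `a` of primes of degree up to about `b
≈ 2 ^ J`, where `L(a)` is the number of distinct degrees of subproducts (`subsums`). There are about
`q ^ m / m` primes of degree `m`, so a dyadic block of degrees has total weight about `log 2`, and
the choices of `k` primes in it weigh about `(log 2) ^ k / k!`. The first `j` blocks typically
produce only `O(2 ^ j)` degrees, so `L(a)` is governed by the minimum over `j` of `2 ^ (j + number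
of primes beyond block j)`. Let the height after `j` blocks be `j` minus the number of primes used.
The sum is dominated by sets whose height stays positive and ends bounded: they have `J - O(1)`
primes and nearly `2 ^ J` different subset sums on average. Their weight is `(log 2) ^ J` times a
`walk`, which the ballot formula `walk_zero_eq` evaluates as about `e ^ J * J ^ (-3/2)`. Hence the
sum has order `(2 e log 2) ^ J * J ^ (-3/2)`, and since `e log 2 = 2 ^ (1 - δ)`, division by `b ^ 2`
leaves `b ^ (-δ) * (log b) ^ (-3/2)`.

For the upper bound a set is cut at the last minimum of its walk; the part before is bounded through
its degree, the part after by `2 ^ #` (`exists_sum_card_subsums_le_of_blocks`). For the lower bound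
Cauchy-Schwarz is applied to sets with positive walk, counting pairs of subsets with equal degree
(`exists_le_sum_card_subsums`).

The factor `1 / b ^ 2` comes from a large prime and a polynomial without small prime factors, both
controlled by the logarithmic derivative identity `mul_sum_monics`. Primes in progressions are never
needed: a prime times a cofactor of degree at most `deg M` suffices, and for these the identity
gives a lower bound directly (`exists_le_sum_irreds_dvd`). -/

namespace PolyTable
open Finset

/-! ### Weighted lattice walks -/

/-- Total weight of the walks of `N` steps from height `r` to height `y` which stay positive after
the start, a step `h ↦ h + 1 - b` having weight `1 / b!`. -/
noncomputable def walk : ℕ → ℕ → ℕ → ℝ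
  | 0, r, y => if r = y then 1 else 0
  | N + 1, r, y => if y = 0 then 0 else
      ∑ z ∈ range (r + N + 1), if y ≤ z + 1 then walk N r z / ((z + 1 - y).factorial : ℝ) else 0

lemma walk_nonneg (N r y : ℕ) : 0 ≤ walk N r y := by
  induction N generalizing y with
  | zero => simp only [walk]; split_ifs <;> norm_num
  | succ N ih =>
    simp only [walk]
    split_ifs
    · exact le_rfl
    · refine sum_nonneg fun z _ => ?_
      split_ifs
      · exact div_nonneg (ih z) (by positivity)
      · exact le_rfl

lemma walk_eq_zero {N r y : ℕ} (h : r + N < y) : walk N r y = 0 := by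
  cases N with
  | zero => simp only [walk]; rw [if_neg (by omega)]
  | succ N =>
    simp only [walk]
    rw [if_neg (by omega)]
    refine sum_eq_zero fun z hz => if_neg ?_
    have := mem_range.1 hz
    omega

lemma walk_succ {N r y K : ℕ} (hy : y ≠ 0) (hK : r + N + 1 ≤ K) :
    walk (N + 1) r y =
      ∑ z ∈ range K, if y ≤ z + 1 then walk N r z / ((z + 1 - y).factorial : ℝ) else 0 := by
  simp only [walk, if_neg hy]
  refine sum_subset (range_subset_range.2 hK) fun z _ hz => ?_
  rw [walk_eq_zero (by simp at hz; omega)]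
  simp

lemma walk_succ_zero (N r : ℕ) : walk (N + 1) r 0 = 0 := by simp [walk]

lemma walk_add (m N r y : ℕ) :
    walk (m + N) r y = ∑ z ∈ range (r + m + 1), walk m r z * walk N z y := by
  induction N generalizing y with
  | zero =>
    simp only [walk, add_zero, mul_ite, mul_one, mul_zero, sum_ite_eq', mem_range]
    split_ifs with h
    · rfl
    · exact walk_eq_zero (by omega)
  | succ N ih =>
    by_cases hy : y = 0
    · subst hy
      rw [← add_assoc, walk_succ_zero]
      simp [walk_succ_zero]
    · rw [← add_assoc, walk_succ hy le_rfl]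
      have : ∀ z ∈ range (r + m + 1), walk m r z * walk (N + 1) z y =
          ∑ u ∈ range (r + (m + N) + 1), walk m r z *
            (if y ≤ u + 1 then walk N z u / ((u + 1 - y).factorial : ℝ) else 0) := by
        intro z hz
        have := mem_range.1 hz
        rw [walk_succ hy (K := r + (m + N) + 1) (by omega), mul_sum]
      rw [sum_congr rfl this, sum_comm]
      refine sum_congr rfl fun u _ => ?_
      split_ifs with h
      · rw [ih, sum_div]
        exact sum_congr rfl fun z _ => by ring
      · simp

/-- The binomial theorem; with the next lemma, its first moment, it drives the induction for the
ballot formula. -/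
lemma sum_pow_div_factorial (N : ℝ) (s : ℕ) :
    ∑ b ∈ range (s + 1), N ^ (s - b) / (((s - b).factorial : ℝ) * (b.factorial : ℝ)) =
      (N + 1) ^ s / (s.factorial : ℝ) := by
  rw [add_comm N 1, add_pow, sum_div]
  refine sum_congr rfl fun b hb => ?_
  have hb' : b ≤ s := by simp at hb; omega
  rw [Nat.cast_choose ℝ hb']
  field_simp
  ring

lemma sum_mul_pow_div_factorial (N : ℝ) (s : ℕ) :
    ∑ b ∈ range (s + 2), (b : ℝ) * (N ^ (s + 1 - b) /
      (((s + 1 - b).factorial : ℝ) * (b.factorial : ℝ))) = (N + 1) ^ s / (s.factorial : ℝ) := by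
  rw [sum_range_succ', ← sum_pow_div_factorial]
  simp only [CharP.cast_eq_zero, zero_mul, add_zero]
  refine sum_congr rfl fun b _ => ?_
  rw [Nat.factorial_succ, show s + 1 - (b + 1) = s - b by omega]
  push_cast
  field_simp

/-- Ballot formula. Without the positivity condition the weight would be `N ^ (N - x) / (N - x)!`,
because the jumps `b` add up to `N - x`; positivity keeps the proportion `x / N`. In the induction
the last step brings in the factor `x - 1 + b`, which splits into a zeroth and a first moment of the
binomial sum. -/
lemma walk_zero_eq {N x : ℕ} (hN : 1 ≤ N) (hx : x ≤ N) :
    walk N 0 x = x * N ^ (N - x) / (N * ((N - x).factorial : ℝ)) := by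
  induction N, hN using Nat.le_induction generalizing x with
  | base =>
    interval_cases x <;> simp [walk]
  | succ N hN ih =>
    by_cases hx0 : x = 0
    · subst hx0; simp [walk]
    obtain ⟨s, hs⟩ : ∃ s, N + 1 = x + s := ⟨N + 1 - x, by omega⟩
    rw [walk_succ hx0 (K := N + 1) (by omega)]
    have h1 : ∑ z ∈ range (N + 1), (if x ≤ z + 1 then walk N 0 z / ((z + 1 - x).factorial : ℝ)
        else 0) = ∑ b ∈ range (s + 1), ((x : ℝ) - 1 + b) / N *
          ((N : ℝ) ^ (s - b) / (((s - b).factorial : ℝ) * (b.factorial : ℝ))) := by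
      rw [← sum_filter]
      symm
      refine sum_bij (fun b _ => x - 1 + b) ?_ ?_ ?_ ?_
      · intro b hb; simp at hb ⊢; omega
      · intro a _ b _ h; simpa using h
      · intro z hz; simp at hz; exact ⟨z + 1 - x, by simp; omega, by omega⟩
      · intro b hb
        simp at hb
        rw [ih (by omega), show N - (x - 1 + b) = s - b by omega,
          show x - 1 + b + 1 - x = b by omega, Nat.cast_add, Nat.cast_sub (by omega)]
        push_cast
        field_simp
    rw [h1, show N + 1 - x = s by omega]
    have hN0 : (N : ℝ) ≠ 0 := by positivity
    have h2 : ∀ b ∈ range (s + 1), ((x : ℝ) - 1 + b) / N *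
          ((N : ℝ) ^ (s - b) / (((s - b).factorial : ℝ) * (b.factorial : ℝ))) =
        ((x : ℝ) - 1) / N * ((N : ℝ) ^ (s - b) / (((s - b).factorial : ℝ) * (b.factorial : ℝ))) +
        1 / N * (b * ((N : ℝ) ^ (s - b) / (((s - b).factorial : ℝ) * (b.factorial : ℝ)))) := by
      intro b _; ring
    rw [sum_congr rfl h2, sum_add_distrib, ← mul_sum, ← mul_sum, sum_pow_div_factorial]
    cases s with
    | zero =>
      have : (x : ℝ) = N + 1 := by exact_mod_cast hs.symm
      simp [this]
      field_simp
    | succ s =>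
      rw [sum_mul_pow_div_factorial, Nat.factorial_succ]
      have : (x : ℝ) = N - s := by
        have : (N : ℝ) + 1 = x + (s + 1) := by exact_mod_cast hs
        linarith
      rw [this]
      push_cast
      field_simp
      ring

/-! ### Bounds for walks -/

lemma pow_self_div_factorial_le {N : ℕ} (hN : 1 ≤ N) :
    (N : ℝ) ^ N / (N.factorial : ℝ) ≤ Real.exp N / √N := by
  have h := Stirling.le_factorial_stirling N
  have hN' : (0 : ℝ) < N := by positivity
  have h1 : √N ≤ √(2 * Real.pi * N) := by
    apply Real.sqrt_le_sqrt
    nlinarith [Real.pi_gt_three]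
  have h2 : √N * (N / Real.exp 1) ^ N ≤ (N.factorial : ℝ) :=
    (mul_le_mul_of_nonneg_right h1 (by positivity)).trans h
  rw [div_pow, ← Real.exp_nat_mul, mul_one] at h2
  rw [div_le_div_iff₀ (by positivity) (by positivity)]
  have h3 : √N * (N ^ N / Real.exp N) * Real.exp N ≤ (N.factorial : ℝ) * Real.exp N :=
    mul_le_mul_of_nonneg_right h2 (by positivity)
  have h4 : √N * ((N : ℝ) ^ N / Real.exp N) * Real.exp N = N ^ N * √N := by
    field_simp
  linarith

lemma le_pow_self_div_factorial {N : ℕ} (hN : 1 ≤ N) :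
    Real.exp N / (Real.exp 1 * √N) ≤ (N : ℝ) ^ N / (N.factorial : ℝ) := by
  obtain ⟨n, rfl⟩ : ∃ n, N = n + 1 := ⟨N - 1, by omega⟩
  -- The Stirling sequence decreases from its first value `e / √2`, which turns the asymptotic into
  -- an inequality for every `N ≥ 1`.
  have h := Stirling.stirlingSeq'_antitone (Nat.zero_le n)
  simp only [Function.comp_apply, Nat.succ_eq_add_one, zero_add, Stirling.stirlingSeq_one] at h
  rw [Stirling.stirlingSeq, Real.sqrt_mul (by norm_num), div_pow, ← Real.exp_nat_mul, mul_one] at h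
  have hs : 0 < √((n + 1 : ℕ) : ℝ) := by positivity
  have hf : (0 : ℝ) < ((n + 1).factorial : ℝ) := by positivity
  rw [div_le_div_iff₀ (by positivity) (by positivity)] at h ⊢
  have h2 : (0 : ℝ) < √2 := by positivity
  have h3 : ((n + 1).factorial : ℝ) * √2 ≤
      (Real.exp 1 * (√((n + 1 : ℕ) : ℝ) * (((n + 1 : ℕ) : ℝ) ^ (n + 1) / Real.exp ((n + 1 : ℕ) : ℝ)))) * √2 := by
    linarith
  have h4 := le_of_mul_le_mul_right h3 h2
  have h5 := mul_le_mul_of_nonneg_right h4 (Real.exp_pos ((n + 1 : ℕ) : ℝ)).le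
  have h6 : Real.exp 1 * (√((n + 1 : ℕ) : ℝ) * (((n + 1 : ℕ) : ℝ) ^ (n + 1) /
      Real.exp ((n + 1 : ℕ) : ℝ))) * Real.exp ((n + 1 : ℕ) : ℝ) =
      ((n + 1 : ℕ) : ℝ) ^ (n + 1) * (Real.exp 1 * √((n + 1 : ℕ) : ℝ)) := by
    field_simp
  linarith

/-- The terms `N ^ t / t!` of the exponential series increase as long as `t ≤ N`. -/
lemma pow_div_factorial_le_of_le {N s : ℕ} (h : s ≤ N) :
    (N : ℝ) ^ s / (s.factorial : ℝ) ≤ (N : ℝ) ^ N / (N.factorial : ℝ) := by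
  have key : ∀ t, s ≤ t → t ≤ N →
      (N : ℝ) ^ s / (s.factorial : ℝ) ≤ (N : ℝ) ^ t / (t.factorial : ℝ) := by
    intro t ht
    induction t, ht using Nat.le_induction with
    | base => intro _; exact le_rfl
    | succ t ht ih =>
      intro htN
      refine (ih (by omega)).trans ?_
      rw [Nat.factorial_succ, pow_succ, div_le_div_iff₀ (by positivity) (by positivity)]
      have : ((t + 1 : ℕ) : ℝ) ≤ N := by exact_mod_cast htN
      push_cast at this ⊢
      have h0 : (0 : ℝ) ≤ (N : ℝ) ^ t * (t.factorial : ℝ) := by positivity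
      nlinarith
  exact key N h le_rfl

/-- `n ^ (-3/2)`. -/
noncomputable def decay (n : ℕ) : ℝ := 1 / ((n : ℝ) * √n)

lemma decay_nonneg (n : ℕ) : 0 ≤ decay n := by unfold decay; positivity

lemma decay_pos {n : ℕ} (hn : 1 ≤ n) : 0 < decay n := by unfold decay; positivity

lemma decay_anti {m n : ℕ} (hm : 1 ≤ m) (h : m ≤ n) : decay n ≤ decay m := by
  unfold decay
  have : (m : ℝ) ≤ n := by exact_mod_cast h
  have h2 : (0 : ℝ) < m := by positivity
  gcongr

/-- Doubling the argument costs `2 ^ (3/2) ≤ 4`. -/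
lemma decay_le_of_le_mul {m n : ℕ} (hn : 1 ≤ n) (h : n ≤ 2 * m) : decay m ≤ 4 * decay n := by
  unfold decay
  have hm : (0 : ℝ) < m := by
    have : 0 < m := by omega
    exact_mod_cast this
  have hn' : (0 : ℝ) < n := by exact_mod_cast hn
  have h' : (n : ℝ) ≤ 2 * m := by exact_mod_cast h
  have hs : √(n : ℝ) ≤ 2 * √(m : ℝ) := by
    rw [show (2 : ℝ) * √(m : ℝ) = √(4 * m) by
      rw [Real.sqrt_mul (by norm_num), show (4 : ℝ) = 2 ^ 2 by norm_num,
        Real.sqrt_sq (by norm_num)]]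
    exact Real.sqrt_le_sqrt (by linarith)
  rw [mul_one_div, div_le_div_iff₀ (by positivity) (by positivity)]
  calc 1 * ((n : ℝ) * √n) ≤ 1 * (2 * m * (2 * √m)) := by gcongr
    _ = 4 * (m * √m) := by ring

lemma walk_zero_le {N x : ℕ} (hN : 1 ≤ N) : walk N 0 x ≤ x * Real.exp N * decay N := by
  have hd := decay_nonneg N
  rcases lt_or_ge N x with hx | hx
  · rw [walk_eq_zero (by omega)]; positivity
  · rw [walk_zero_eq hN hx]
    have h1 := (pow_div_factorial_le_of_le (Nat.sub_le N x)).trans (pow_self_div_factorial_le hN)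
    have hN' : (0 : ℝ) < N := by positivity
    calc (x : ℝ) * N ^ (N - x) / (N * ((N - x).factorial : ℝ))
        = x / N * (N ^ (N - x) / ((N - x).factorial : ℝ)) := by field_simp
      _ ≤ x / N * (Real.exp N / √N) := by gcongr
      _ = x * Real.exp N * decay N := by unfold decay; field_simp

lemma le_walk_one {N : ℕ} (hN : 1 ≤ N) : Real.exp N * decay N / Real.exp 1 ≤ walk N 0 1 := by
  rw [walk_zero_eq hN hN]
  have h := le_pow_self_div_factorial hN
  obtain ⟨n, rfl⟩ : ∃ n, N = n + 1 := ⟨N - 1, by omega⟩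
  have hN' : (0 : ℝ) < ((n + 1 : ℕ) : ℝ) := by positivity
  calc Real.exp ((n + 1 : ℕ) : ℝ) * decay (n + 1) / Real.exp 1
      = 1 / ((n + 1 : ℕ) : ℝ) *
        (Real.exp ((n + 1 : ℕ) : ℝ) / (Real.exp 1 * √((n + 1 : ℕ) : ℝ))) := by
        unfold decay; field_simp
    _ ≤ 1 / ((n + 1 : ℕ) : ℝ) * (((n + 1 : ℕ) : ℝ) ^ (n + 1) / ((n + 1).factorial : ℝ)) := by
        gcongr
    _ = _ := by
        rw [Nat.factorial_succ, pow_succ]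
        simp only [add_tsub_cancel_right]
        push_cast
        field_simp
        try simp

/-- Height `r` is a typical position after `r ^ 2` steps, so at this diffusive scale the ballot
formula loses only a constant from the factor `m ^ (m - r) / (m - r)!`. -/
lemma le_walk_sq {r : ℕ} (hr : 1 ≤ r) :
    Real.exp ((r ^ 2 : ℕ) : ℝ) / (2 * Real.exp 1 * (r : ℝ) ^ 2) ≤ walk (r ^ 2) 0 r := by
  have hm : 1 ≤ r ^ 2 := Nat.one_le_pow _ _ hr
  have hrm : r ≤ r ^ 2 := Nat.le_self_pow (by norm_num) r
  rw [walk_zero_eq hm hrm]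
  set m := r ^ 2 with hmdef
  have hm' : (0 : ℝ) < m := by positivity
  -- Lowering the exponent from `m - i` to `m - i - 1` multiplies by `1 - i / m`; the accumulated
  -- loss is at most `i ^ 2 / (2 m)`, which is `1 / 2` at `i = r`, `m = r ^ 2`.
  have hdesc : ∀ i, i ≤ r → (1 - (i : ℝ) ^ 2 / (2 * m)) * ((m : ℝ) ^ m / (m.factorial : ℝ)) ≤
      (m : ℝ) ^ (m - i) / ((m - i).factorial : ℝ) := by
    intro i
    induction i with
    | zero => intro _; simp
    | succ i ih =>
      intro hi
      have hX : (0 : ℝ) ≤ (m : ℝ) ^ m / (m.factorial : ℝ) := by positivity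
      obtain ⟨t, ht⟩ : ∃ t, m - i = t + 1 := ⟨m - i - 1, by omega⟩
      have ih' := ih (by omega)
      have htm : (m : ℝ) = t + 1 + i := by
        have : m = t + 1 + i := by omega
        exact_mod_cast this
      rw [show m - (i + 1) = t by omega]
      rw [ht] at ih'
      have e1 : (m : ℝ) ^ t / (t.factorial : ℝ) =
          (1 - i / m) * ((m : ℝ) ^ (t + 1) / ((t + 1).factorial : ℝ)) := by
        have : (1 : ℝ) - i / m = (t + 1) / m := by
          rw [htm]; field_simp; ring
        rw [this, Nat.factorial_succ, pow_succ]
        push_cast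
        field_simp
      rw [e1]
      have h01 : (0 : ℝ) ≤ 1 - i / m := by
        rw [sub_nonneg, div_le_one hm', htm]
        have : (0 : ℝ) ≤ t := by positivity
        linarith
      refine le_trans ?_ (mul_le_mul_of_nonneg_left ih' h01)
      rw [← mul_assoc]
      refine mul_le_mul_of_nonneg_right ?_ hX
      have e2 : (1 - (i : ℝ) / m) * (1 - (i : ℝ) ^ 2 / (2 * m)) -
          (1 - ((i + 1 : ℕ) : ℝ) ^ 2 / (2 * m)) = 1 / (2 * m) + (i : ℝ) ^ 3 / (2 * m ^ 2) := by
        push_cast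
        field_simp
        ring
      have e3 : (0 : ℝ) ≤ 1 / (2 * m) + (i : ℝ) ^ 3 / (2 * m ^ 2) := by positivity
      linarith
  have h1 := hdesc r le_rfl
  have h2 : 1 - (r : ℝ) ^ 2 / (2 * m) = 1 / 2 := by
    rw [hmdef]; push_cast
    have : (r : ℝ) ≠ 0 := by positivity
    field_simp
    norm_num
  rw [h2] at h1
  have h3 := le_pow_self_div_factorial hm
  have hs : √(m : ℝ) = r := by
    rw [hmdef]; push_cast; exact Real.sqrt_sq (by positivity)
  rw [hs] at h3
  have hr' : (0 : ℝ) < r := by positivity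
  have hmr : (m : ℝ) = (r : ℝ) ^ 2 := by rw [hmdef]; push_cast; rfl
  calc Real.exp m / (2 * Real.exp 1 * (r : ℝ) ^ 2)
      = r / m * (1 / 2 * (Real.exp m / (Real.exp 1 * r))) := by rw [hmr]; field_simp
    _ ≤ r / m * (1 / 2 * ((m : ℝ) ^ m / (m.factorial : ℝ))) := by gcongr
    _ ≤ r / m * ((m : ℝ) ^ (m - r) / ((m - r).factorial : ℝ)) := by gcongr
    _ = _ := by field_simp

/-- A walk from `r` is extended backwards by `r ^ 2` steps from `0` to `r`. The longer walk starts
at `0`, where the exact formula applies, and by `le_walk_sq` the extension costs only the factor `2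
e r ^ 2`. The argument `N + 1` keeps `N = 0` meaningful, since `decay 0 = 0`. -/
lemma walk_le {N r y : ℕ} (hr : 1 ≤ r) :
    walk N r y ≤ 2 * Real.exp 1 * y * (r : ℝ) ^ 2 * Real.exp N * decay (N + 1) := by
  have hm : 1 ≤ r ^ 2 := Nat.one_le_pow _ _ hr
  have h1 : walk (r ^ 2) 0 r * walk N r y ≤ walk (r ^ 2 + N) 0 y := by
    rw [walk_add]
    exact single_le_sum (f := fun z => walk (r ^ 2) 0 z * walk N z y)
      (fun z _ => mul_nonneg (walk_nonneg _ _ _) (walk_nonneg _ _ _))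
      (mem_range.2 (by have := Nat.le_self_pow (two_ne_zero) r; omega))
  have h2 := walk_zero_le (N := r ^ 2 + N) (x := y) (by omega)
  have h3 := mul_le_mul_of_nonneg_right (le_walk_sq hr) (walk_nonneg N r y)
  have h4 : decay (r ^ 2 + N) ≤ decay (N + 1) := decay_anti (by omega) (by omega)
  have h5 : Real.exp ((r ^ 2 : ℕ) : ℝ) / (2 * Real.exp 1 * (r : ℝ) ^ 2) * walk N r y ≤
      y * Real.exp ((r ^ 2 + N : ℕ) : ℝ) * decay (N + 1) :=
    h3.trans (h1.trans (h2.trans (mul_le_mul_of_nonneg_left h4 (by positivity))))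
  rw [Nat.cast_add, Real.exp_add] at h5
  have hr' : (0 : ℝ) < r := by positivity
  have he := Real.exp_pos ((r ^ 2 : ℕ) : ℝ)
  rw [div_mul_eq_mul_div, div_le_iff₀ (by positivity)] at h5
  have h6 : Real.exp ((r ^ 2 : ℕ) : ℝ) * walk N r y ≤ Real.exp ((r ^ 2 : ℕ) : ℝ) *
      (2 * Real.exp 1 * y * (r : ℝ) ^ 2 * Real.exp N * decay (N + 1)) := by
    refine h5.trans (le_of_eq ?_)
    ring
  exact le_of_mul_le_mul_left h6 he

lemma walk_zero_le' (N x : ℕ) :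
    walk N 0 x ≤ 4 * (x + 1) * Real.exp N * decay (N + 1) := by
  rcases Nat.eq_zero_or_pos N with rfl | hN
  · simp only [walk, decay]
    split_ifs with h
    · subst h; norm_num
    · norm_num; positivity
  · refine (walk_zero_le hN).trans ?_
    have h1 := decay_le_of_le_mul (m := N) (n := N + 1) (by omega) (by omega)
    have h2 := decay_nonneg (N + 1)
    calc (x : ℝ) * Real.exp N * decay N ≤ x * Real.exp N * (4 * decay (N + 1)) := by gcongr
      _ ≤ (x + 1) * Real.exp N * (4 * decay (N + 1)) := by gcongr; linarith
      _ = _ := by ring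

lemma sum_decay_le (n : ℕ) : ∑ j ∈ range n, decay (j + 1) ≤ 3 := by
  -- Telescoping against `2 / √n`; the bound is an equality for the single term `decay 1 = 1`.
  have key : ∀ n : ℕ, ∑ j ∈ range (n + 1), decay (j + 1) ≤ 3 - 2 / √((n + 1 : ℕ) : ℝ) := by
    intro n
    induction n with
    | zero => norm_num [decay]
    | succ n ih =>
      rw [sum_range_succ]
      have hstep : decay (n + 1 + 1) ≤
          2 / √((n + 1 : ℕ) : ℝ) - 2 / √((n + 1 + 1 : ℕ) : ℝ) := by
        unfold decay
        have ha : 0 < √((n + 1 : ℕ) : ℝ) := by positivity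
        have hab : √((n + 1 : ℕ) : ℝ) ≤ √((n + 1 + 1 : ℕ) : ℝ) :=
          Real.sqrt_le_sqrt (by push_cast; linarith)
        have ha2 : √((n + 1 : ℕ) : ℝ) ^ 2 = ((n + 1 : ℕ) : ℝ) := Real.sq_sqrt (by positivity)
        have hb2 : √((n + 1 + 1 : ℕ) : ℝ) ^ 2 = ((n + 1 + 1 : ℕ) : ℝ) :=
          Real.sq_sqrt (by positivity)
        have hd : √((n + 1 + 1 : ℕ) : ℝ) ^ 2 - √((n + 1 : ℕ) : ℝ) ^ 2 = 1 := by
          rw [ha2, hb2]; push_cast; ring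
        set a := √((n + 1 : ℕ) : ℝ)
        set b := √((n + 1 + 1 : ℕ) : ℝ)
        have hb : 0 < b := ha.trans_le hab
        rw [← hb2]
        rw [div_sub_div _ _ ha.ne' hb.ne', div_le_div_iff₀ (by positivity) (by positivity)]
        have h1 : 1 ≤ 2 * b * (b - a) := by nlinarith
        have h2 : a * b * 1 ≤ a * b * (2 * b * (b - a)) := by gcongr
        have h3 : a * b * (2 * b * (b - a)) ≤ b * b * (2 * b * (b - a)) := by
          have : 0 ≤ 2 * b * (b - a) := by linarith
          gcongr
        nlinarith
      linarith
  cases n with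
  | zero => simp
  | succ n =>
    have : 0 ≤ 2 / √((n + 1 : ℕ) : ℝ) := by positivity
    linarith [key n]

/-- One of the two indices is at least half of `J + 1`, so its factor is at most `4 * decay (J +
1)`; the other factor sums to at most `3`. This gives `2 * 4 * 3 = 24`. -/
lemma sum_decay_mul_decay_le (J : ℕ) :
    ∑ j ∈ range (J + 1), decay (j + 1) * decay (J - j + 1) ≤ 24 * decay (J + 1) := by
  have h : ∀ j ∈ range (J + 1), decay (j + 1) * decay (J - j + 1) ≤
      4 * decay (J + 1) * (decay (j + 1) + decay (J - j + 1)) := by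
    intro j hj
    have hj' : j ≤ J := by simp at hj; omega
    have h1 := decay_nonneg (j + 1)
    have h2 := decay_nonneg (J - j + 1)
    have h3 := decay_nonneg (J + 1)
    rcases le_total (J + 1) (2 * (j + 1)) with h | h
    · have := decay_le_of_le_mul (by omega) h
      nlinarith [mul_nonneg h3 h1]
    · have := decay_le_of_le_mul (m := J - j + 1) (by omega) (show J + 1 ≤ 2 * (J - j + 1) by omega)
      nlinarith [mul_nonneg h3 h2]
  refine (sum_le_sum h).trans ?_
  rw [← mul_sum, sum_add_distrib]
  have h1 := sum_decay_le (J + 1)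
  have h2 : ∑ j ∈ range (J + 1), decay (J - j + 1) = ∑ j ∈ range (J + 1), decay (j + 1) := by
    have := sum_range_reflect (fun j => decay (j + 1)) (J + 1)
    simpa using this
  rw [h2]
  nlinarith [decay_nonneg (J + 1)]

lemma exists_sum_pow_mul_geometric_le (k : ℕ) {t : ℝ} (h0 : 0 ≤ t) (h1 : t < 1) :
    ∃ C : ℝ, 0 < C ∧ ∀ s : Finset ℕ, ∑ x ∈ s, ((x : ℝ) + 1) ^ k * t ^ x ≤ C := by
  -- Enlarging `t` makes the ratio positive, so that the shifted series may be divided by `u`.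
  set u := max t (1 / 2) with hu
  have hu0 : 0 < u := lt_of_lt_of_le (by norm_num) (le_max_right _ _)
  have hu1 : u < 1 := max_lt h1 (by norm_num)
  have hs : Summable fun x : ℕ => ((x : ℝ) + 1) ^ k * u ^ x := by
    have h := summable_pow_mul_geometric_of_norm_lt_one (R := ℝ) k (r := u)
      (by rw [Real.norm_of_nonneg hu0.le]; exact hu1)
    have h' := ((summable_nat_add_iff 1).2 h).mul_left u⁻¹
    refine h'.congr fun x => ?_
    push_cast
    rw [pow_succ]
    field_simp
  refine ⟨∑' x : ℕ, ((x : ℝ) + 1) ^ k * u ^ x, ?_, fun s => ?_⟩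
  · exact hs.tsum_pos (fun x => by positivity) 0 (by simp)
  · refine le_trans (sum_le_sum fun x _ => ?_)
      (hs.sum_le_tsum s fun x _ => by positivity)
    have : t ≤ u := le_max_left _ _
    gcongr

end PolyTable

namespace PolyTable
open Finset

section Blocks

set_option linter.unusedSectionVars false

variable {α : Type*} [DecidableEq α]

/-! ### Elementary symmetric sums over a finite set -/

/-- Both sides sum over sets of size `b + 1` with a marked element, which on the right has been
removed. -/
lemma succ_mul_sum_powersetCard (w : α → ℝ) (S : Finset α) (b : ℕ) :
    ((b : ℝ) + 1) * ∑ a ∈ S.powersetCard (b + 1), ∏ p ∈ a, w p =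
      ∑ a ∈ S.powersetCard b, (∏ p ∈ a, w p) * ∑ p ∈ S \ a, w p := by
  have h1 : ((b : ℝ) + 1) * ∑ a ∈ S.powersetCard (b + 1), ∏ p ∈ a, w p =
      ∑ a ∈ S.powersetCard (b + 1), ∑ p ∈ a, (∏ x ∈ a.erase p, w x) * w p := by
    rw [mul_sum]
    refine sum_congr rfl fun a ha => ?_
    have : ∀ p ∈ a, (∏ x ∈ a.erase p, w x) * w p = ∏ x ∈ a, w x :=
      fun p hp => prod_erase_mul a w hp
    rw [sum_congr rfl this, sum_const, (mem_powersetCard.1 ha).2, nsmul_eq_mul]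
    push_cast
    ring
  simp_rw [h1, mul_sum]
  rw [sum_sigma', sum_sigma']
  refine sum_bij' (fun x _ => ⟨x.1.erase x.2, x.2⟩) (fun x _ => ⟨insert x.2 x.1, x.2⟩)
    ?_ ?_ ?_ ?_ ?_
  · rintro ⟨a, p⟩ h
    simp only [mem_sigma, mem_powersetCard, Finset.mem_sdiff] at h ⊢
    obtain ⟨⟨h1, h2⟩, h3⟩ := h
    refine ⟨⟨(erase_subset _ _).trans h1, ?_⟩, h1 h3, by simp⟩
    rw [card_erase_of_mem h3, h2]; rfl
  · rintro ⟨a, p⟩ h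
    simp only [mem_sigma, mem_powersetCard, Finset.mem_sdiff] at h ⊢
    obtain ⟨⟨h1, h2⟩, h3, h4⟩ := h
    exact ⟨⟨insert_subset h3 h1, by rw [card_insert_of_notMem h4, h2]⟩, mem_insert_self _ _⟩
  · rintro ⟨a, p⟩ h
    simp only [mem_sigma] at h
    simp [insert_erase h.2]
  · rintro ⟨a, p⟩ h
    simp only [mem_sigma, Finset.mem_sdiff] at h
    simp [erase_insert h.2.2]
  · rintro ⟨a, p⟩ h
    rfl

lemma sum_powersetCard_le {w : α → ℝ} (hw : ∀ p, 0 ≤ w p) {S : Finset α} {l : ℝ}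
    (hl : ∑ p ∈ S, w p ≤ l) (b : ℕ) :
    ∑ a ∈ S.powersetCard b, ∏ p ∈ a, w p ≤ l ^ b / (b.factorial : ℝ) := by
  have hl0 : 0 ≤ l := (sum_nonneg fun p _ => hw p).trans hl
  induction b with
  | zero => simp
  | succ b ih =>
    have h := succ_mul_sum_powersetCard w S b
    have h2 : ∑ a ∈ S.powersetCard b, (∏ p ∈ a, w p) * ∑ p ∈ S \ a, w p ≤
        (l ^ b / (b.factorial : ℝ)) * l := by
      refine le_trans ?_ (mul_le_mul_of_nonneg_right ih hl0)
      rw [sum_mul]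
      refine sum_le_sum fun a _ => mul_le_mul_of_nonneg_left ?_ (prod_nonneg fun p _ => hw p)
      exact (sum_le_sum_of_subset_of_nonneg sdiff_subset fun p _ _ => hw p).trans hl
    rw [← h] at h2
    rw [Nat.factorial_succ, le_div_iff₀ (by positivity)]
    have h3 : (b.factorial : ℝ) * (((b : ℝ) + 1) *
        ∑ a ∈ S.powersetCard (b + 1), ∏ p ∈ a, w p) ≤
        (b.factorial : ℝ) * (l ^ b / (b.factorial : ℝ) * l) :=
      mul_le_mul_of_nonneg_left h2 (by positivity)
    have h4 : (b.factorial : ℝ) * (l ^ b / (b.factorial : ℝ) * l) = l ^ (b + 1) := by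
      field_simp
      ring
    push_cast
    linarith

/-- A set of `b` elements removes at most `b * e` of the available mass `l`, so each step of the
recursion loses a factor `1 - b e / l`. These losses are absorbed by `1 - b ^ 2 e / l`. -/
lemma le_sum_powersetCard {w : α → ℝ} (hw : ∀ p, 0 ≤ w p) {S : Finset α} {l e : ℝ}
    (hl0 : 0 < l) (hl : l ≤ ∑ p ∈ S, w p) (he : ∀ p ∈ S, w p ≤ e) (b : ℕ)
    (hb : (b : ℝ) ^ 2 * e ≤ l) (he0 : 0 ≤ e) :
    (1 - (b : ℝ) ^ 2 * e / l) * (l ^ b / (b.factorial : ℝ)) ≤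
      ∑ a ∈ S.powersetCard b, ∏ p ∈ a, w p := by
  induction b with
  | zero => simp
  | succ b ih =>
    have hbe : (b : ℝ) ^ 2 * e ≤ l := by
      refine le_trans ?_ hb
      gcongr
      simp
    have ih' := ih hbe
    have hbl : (b : ℝ) * e ≤ l := by
      refine le_trans ?_ hb
      have : (b : ℝ) ≤ ((b + 1 : ℕ) : ℝ) ^ 2 := by
        push_cast; nlinarith [(Nat.cast_nonneg b : (0 : ℝ) ≤ b)]
      gcongr
    have h := succ_mul_sum_powersetCard w S b
    have h2 : (l - b * e) * ((1 - (b : ℝ) ^ 2 * e / l) * (l ^ b / (b.factorial : ℝ))) ≤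
        ∑ a ∈ S.powersetCard b, (∏ p ∈ a, w p) * ∑ p ∈ S \ a, w p := by
      refine (mul_le_mul_of_nonneg_left ih' (sub_nonneg.2 hbl)).trans ?_
      rw [mul_sum]
      refine sum_le_sum fun a ha => ?_
      rw [mul_comm]
      refine mul_le_mul_of_nonneg_left ?_ (prod_nonneg fun p _ => hw p)
      obtain ⟨ha1, ha2⟩ := mem_powersetCard.1 ha
      have h5 := sum_sdiff ha1 (f := w)
      have h6 : ∑ p ∈ a, w p ≤ b * e := by
        rw [← ha2, ← nsmul_eq_mul]
        exact sum_le_card_nsmul _ _ _ fun p hp => he p (ha1 hp)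
      linarith
    rw [← h] at h2
    have hb1 : (0 : ℝ) < (b : ℝ) + 1 := by positivity
    have h7 : (l - b * e) * ((1 - (b : ℝ) ^ 2 * e / l) * (l ^ b / (b.factorial : ℝ))) =
        ((b : ℝ) + 1) * ((1 - b * e / l) * (1 - (b : ℝ) ^ 2 * e / l) *
          (l ^ (b + 1) / ((b + 1).factorial : ℝ))) := by
      rw [Nat.factorial_succ, pow_succ]
      push_cast
      field_simp
      ring
    rw [h7] at h2
    refine le_trans ?_ (le_of_mul_le_mul_left h2 hb1)
    refine mul_le_mul_of_nonneg_right ?_ (by positivity)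
    have h8 : (1 - b * e / l) * (1 - (b : ℝ) ^ 2 * e / l) -
        (1 - ((b + 1 : ℕ) : ℝ) ^ 2 * e / l) = (b + 1) * e / l + (b * e / l) * (b ^ 2 * e / l) := by
      push_cast; field_simp; ring
    have h9 : 0 ≤ (b + 1) * e / l + (b * e / l) * (b ^ 2 * e / l) := by positivity
    linarith

/-! ### Sets whose block counts follow a positive walk -/

/-- The elements of `P` whose block index lies in `[i, j)`. -/
def blocks (P : Finset α) (β : α → ℕ) (i j : ℕ) : Finset α :=
  P.filter fun p => i ≤ β p ∧ β p < j

open Classical in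
/-- The subsets of the blocks `i, …, i + N - 1` whose associated walk, started at height `r`,
stays positive after the start and ends at height `y`. -/
noncomputable def pathSets (P : Finset α) (β : α → ℕ) (i N r y : ℕ) : Finset (Finset α) :=
  (blocks P β i (i + N)).powerset.filter fun a =>
    (∀ k, 1 ≤ k → k ≤ N → #(a.filter fun p => β p < i + k) + 1 ≤ r + k) ∧ #a + y = r + N

lemma mem_blocks {P : Finset α} {β : α → ℕ} {i j : ℕ} {p : α} :
    p ∈ blocks P β i j ↔ p ∈ P ∧ i ≤ β p ∧ β p < j := by simp [blocks]

lemma mem_pathSets {P : Finset α} {β : α → ℕ} {i N r y : ℕ} {a : Finset α} :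
    a ∈ pathSets P β i N r y ↔ a ⊆ blocks P β i (i + N) ∧
      (∀ k, 1 ≤ k → k ≤ N → #(a.filter fun p => β p < i + k) + 1 ≤ r + k) ∧
      #a + y = r + N := by
  simp [pathSets]

lemma filter_lt_add_filter {β : α → ℕ} {a : Finset α} {m n : ℕ} (h : m ≤ n) :
    #(a.filter fun p => β p < m) + #((a.filter fun p => ¬ β p < m).filter fun p => β p < n) =
      #(a.filter fun p => β p < n) := by
  rw [← card_union_of_disjoint]
  · congr 1
    ext p
    simp only [mem_union, mem_filter]
    constructor
    · rintro (h1 | h1)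
      · exact ⟨h1.1, by omega⟩
      · exact ⟨h1.1.1, h1.2⟩
    · rintro ⟨h1, h2⟩
      by_cases h3 : β p < m
      · exact Or.inl ⟨h1, h3⟩
      · exact Or.inr ⟨⟨h1, h3⟩, h2⟩
  · rw [disjoint_left]
    intro p hp hq
    simp only [mem_filter] at hp hq
    exact hq.1.2 hp.2

/-- Cutting at block `i + M` is a bijection onto pairs of path sets that meet at the height `z` of
the cut. The function `φ` of that height is carried along because the second moment needs it
weighted by `2 ^ (-z)`. -/
lemma sum_pathSets_add (w : α → ℝ) (φ : ℕ → ℝ) (P : Finset α) (β : α → ℕ) (i M N r y : ℕ) :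
    ∑ a ∈ pathSets P β i (M + N) r y,
        (∏ p ∈ a, w p) * φ (r + M - #(a.filter fun p => β p < i + M)) =
      ∑ z ∈ range (r + M + 1), φ z * (∑ a ∈ pathSets P β i M r z, ∏ p ∈ a, w p) *
        ∑ a ∈ pathSets P β (i + M) N z y, ∏ p ∈ a, w p := by
  rw [← sum_fiberwise_of_maps_to
    (t := range (r + M + 1)) (g := fun a : Finset α => r + M - #(a.filter fun p => β p < i + M))
    (fun a _ => by simp only [mem_range]; omega)]
  refine sum_congr rfl fun z _ => ?_
  rw [mul_assoc, sum_mul_sum, ← sum_product', mul_sum]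
  refine sum_bij' (fun a _ => (a.filter (fun p => β p < i + M), a.filter fun p => ¬ β p < i + M))
    (fun x _ => x.1 ∪ x.2) ?_ ?_ ?_ ?_ ?_
  · intro a ha
    simp only [mem_filter, mem_pathSets] at ha
    obtain ⟨⟨h1, h2, h3⟩, h4⟩ := ha
    have hle : #(a.filter fun p => β p < i + M) ≤ r + M := by
      rcases Nat.eq_zero_or_pos M with rfl | hM
      · have : a.filter (fun p => β p < i + 0) = ∅ := by
          apply filter_eq_empty_iff.2
          intro p hp
          have := mem_blocks.1 (h1 hp)
          omega
        rw [this]; simp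
      · have := h2 M hM (by omega)
        omega
    simp only [mem_product, mem_pathSets]
    refine ⟨⟨?_, ?_, by omega⟩, ?_, ?_, ?_⟩
    · intro p hp
      simp only [mem_filter] at hp
      have := mem_blocks.1 (h1 hp.1)
      exact mem_blocks.2 ⟨this.1, this.2.1, hp.2⟩
    · intro k hk1 hk2
      have : (a.filter fun p => β p < i + M).filter (fun p => β p < i + k) =
          a.filter fun p => β p < i + k := by
        ext p; simp only [mem_filter]
        constructor
        · rintro ⟨⟨h, _⟩, h'⟩; exact ⟨h, h'⟩
        · rintro ⟨h, h'⟩; exact ⟨⟨h, by omega⟩, h'⟩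
      rw [this]
      exact h2 k hk1 (by omega)
    · intro p hp
      simp only [mem_filter] at hp
      have := mem_blocks.1 (h1 hp.1)
      exact mem_blocks.2 ⟨this.1, by omega, by omega⟩
    · intro k hk1 hk2
      have e := filter_lt_add_filter (β := β) (a := a) (m := i + M) (n := i + M + k) (by omega)
      have := h2 (M + k) (by omega) (by omega)
      rw [← add_assoc] at this
      omega
    · have := card_filter_add_card_filter_not (s := a) (fun p => β p < i + M)
      omega
  · rintro ⟨a, b⟩ hab
    simp only [mem_product, mem_pathSets] at hab
    obtain ⟨⟨h1, h2, h3⟩, h4, h5, h6⟩ := hab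
    have ha : ∀ p ∈ a, β p < i + M := fun p hp => (mem_blocks.1 (h1 hp)).2.2
    have hb : ∀ p ∈ b, i + M ≤ β p := fun p hp => (mem_blocks.1 (h4 hp)).2.1
    have hd : Disjoint a b := by
      rw [disjoint_left]
      intro p hp hq
      have := ha p hp
      have := hb p hq
      omega
    have hfa : (a ∪ b).filter (fun p => β p < i + M) = a := by
      rw [filter_union, filter_true_of_mem ha, filter_false_of_mem (fun p hp => by
        have := hb p hp; omega), union_empty]
    simp only [mem_filter, mem_pathSets]
    refine ⟨⟨?_, ?_, ?_⟩, ?_⟩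
    · intro p hp
      rw [mem_union] at hp
      rcases hp with hp | hp
      · have := mem_blocks.1 (h1 hp)
        exact mem_blocks.2 ⟨this.1, this.2.1, by omega⟩
      · have := mem_blocks.1 (h4 hp)
        exact mem_blocks.2 ⟨this.1, by omega, by omega⟩
    · intro k hk1 hk2
      rcases le_or_gt k M with hk | hk
      · have : (a ∪ b).filter (fun p => β p < i + k) = a.filter (fun p => β p < i + k) := by
          rw [filter_union, filter_false_of_mem (s := b) (fun p hp => by
            have := hb p hp; omega), union_empty]
        rw [this]
        exact h2 k hk1 hk
      · have e : (a ∪ b).filter (fun p => β p < i + k) =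
            a ∪ b.filter (fun p => β p < i + k) := by
          rw [filter_union, filter_true_of_mem (s := a) (fun p hp => by
            have := ha p hp; omega)]
        have hd' : Disjoint a (b.filter fun p => β p < i + k) :=
          hd.mono_right (filter_subset _ _)
        rw [e, card_union_of_disjoint hd']
        have := h5 (k - M) (by omega) (by omega)
        rw [show i + M + (k - M) = i + k by omega] at this
        omega
    · rw [card_union_of_disjoint hd]; omega
    · rw [hfa]; omega
  · intro a _
    exact filter_union_filter_not_eq _ a
  · rintro ⟨a, b⟩ hab
    simp only [mem_product, mem_pathSets] at hab
    obtain ⟨⟨h1, h2, h3⟩, h4, h5, h6⟩ := hab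
    have ha : ∀ p ∈ a, β p < i + M := fun p hp => (mem_blocks.1 (h1 hp)).2.2
    have hb : ∀ p ∈ b, ¬ β p < i + M := fun p hp => by
      have := (mem_blocks.1 (h4 hp)).2.1
      omega
    simp only [Prod.mk.injEq]
    constructor
    · rw [filter_union, filter_true_of_mem ha, filter_false_of_mem hb, union_empty]
    · rw [filter_union, filter_true_of_mem hb, filter_false_of_mem (fun p hp => by
        have := ha p hp; omega), empty_union]
  · intro a ha
    simp only [mem_filter] at ha
    rw [ha.2, ← prod_filter_mul_prod_filter_not a (fun p => β p < i + M) w]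
    ring

lemma pathSets_one {P : Finset α} {β : α → ℕ} {i z y : ℕ} (hy : y ≠ 0) (hz : y ≤ z + 1) :
    pathSets P β i 1 z y = (blocks P β i (i + 1)).powersetCard (z + 1 - y) := by
  ext a
  rw [mem_pathSets, mem_powersetCard]
  constructor
  · rintro ⟨h1, _, h3⟩
    exact ⟨h1, by omega⟩
  · rintro ⟨h1, h2⟩
    refine ⟨h1, fun k hk1 hk2 => ?_, by omega⟩
    have := card_filter_le a fun p => β p < i + k
    omega

lemma pathSets_one_eq_empty {P : Finset α} {β : α → ℕ} {i z y : ℕ} (h : z + 1 < y) :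
    pathSets P β i 1 z y = ∅ := by
  rw [eq_empty_iff_forall_notMem]
  intro a ha
  have := (mem_pathSets.1 ha).2.2
  omega

lemma pathSets_succ_zero {P : Finset α} {β : α → ℕ} {i N r : ℕ} :
    pathSets P β i (N + 1) r 0 = ∅ := by
  rw [eq_empty_iff_forall_notMem]
  intro a ha
  obtain ⟨h1, h2, h3⟩ := mem_pathSets.1 ha
  have h4 := h2 (N + 1) (by omega) le_rfl
  rw [filter_true_of_mem (fun p hp => (mem_blocks.1 (h1 hp)).2.2)] at h4
  omega

lemma pathSets_zero {P : Finset α} {β : α → ℕ} {i r y : ℕ} :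
    pathSets P β i 0 r y = if r = y then {∅} else ∅ := by
  ext a
  rw [mem_pathSets]
  have hb : blocks P β i (i + 0) = ∅ := by
    rw [eq_empty_iff_forall_notMem]
    intro p hp
    have := mem_blocks.1 hp
    omega
  rw [hb, subset_empty]
  split_ifs with h
  · rw [mem_singleton]
    constructor
    · exact fun h => h.1
    · rintro rfl
      exact ⟨rfl, fun k _ _ => by omega, by simp; omega⟩
  · simp only [notMem_empty, iff_false]
    rintro ⟨rfl, _, h3⟩
    simp at h3
    omega

lemma sum_pathSets_succ (w : α → ℝ) (P : Finset α) (β : α → ℕ) {i N r y : ℕ} (hy : y ≠ 0) :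
    ∑ a ∈ pathSets P β i (N + 1) r y, ∏ p ∈ a, w p =
      ∑ z ∈ range (r + N + 1), if y ≤ z + 1 then
        (∑ a ∈ pathSets P β i N r z, ∏ p ∈ a, w p) *
          ∑ a ∈ (blocks P β (i + N) (i + N + 1)).powersetCard (z + 1 - y), ∏ p ∈ a, w p
        else 0 := by
  have h := sum_pathSets_add w (fun _ => 1) P β i N 1 r y
  simp only [mul_one, one_mul] at h
  rw [h]
  refine sum_congr rfl fun z _ => ?_
  split_ifs with hz
  · rw [pathSets_one hy hz]
  · rw [pathSets_one_eq_empty (by omega)]; simp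

/-- A choice of `k` elements in one block weighs at most `l ^ k / k!`. The factorials are the step
weights of `walk`, and the exponents of `l` add up to the size `r + N - y` of the set. -/
lemma sum_pathSets_le {w : α → ℝ} (hw : ∀ p, 0 ≤ w p) {P : Finset α} {β : α → ℕ} {l : ℝ}
    {i N : ℕ} (hl : ∀ j, i ≤ j → j < i + N → ∑ p ∈ blocks P β j (j + 1), w p ≤ l)
    (hl0 : 0 ≤ l) (r y : ℕ) :
    ∑ a ∈ pathSets P β i N r y, ∏ p ∈ a, w p ≤ l ^ (r + N - y) * walk N r y := by
  induction N generalizing y with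
  | zero =>
    rw [pathSets_zero, walk]
    split_ifs with h
    · subst h; simp
    · simp
  | succ N ih =>
    by_cases hy : y = 0
    · subst hy; rw [pathSets_succ_zero, walk_succ_zero]; simp
    rw [sum_pathSets_succ w P β hy, walk_succ hy le_rfl, mul_sum]
    refine sum_le_sum fun z hz => ?_
    have hz' := mem_range.1 hz
    split_ifs with h
    · have h1 := ih (fun j h1 h2 => hl j h1 (by omega)) z
      have h2 := sum_powersetCard_le hw (hl (i + N) (by omega) (by omega)) (z + 1 - y)
      refine (mul_le_mul h1 h2 (sum_nonneg fun a _ => prod_nonneg fun p _ => hw p)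
        (mul_nonneg (by positivity) (walk_nonneg _ _ _))).trans (le_of_eq ?_)
      rw [show r + (N + 1) - y = (r + N - z) + (z + 1 - y) by omega, pow_add]
      ring
    · simp

/-- Here `c j` is the loss in block `j` for choosing distinct elements. Only `b ≤ j + 1` is
required, since a walk from `0` cannot jump further down in that block. -/
lemma le_sum_pathSets {w : α → ℝ} (hw : ∀ p, 0 ≤ w p) {P : Finset α} {β : α → ℕ} {l : ℝ}
    {c : ℕ → ℝ} {N : ℕ} (hc : ∀ j < N, 0 ≤ c j)
    (hl : ∀ j < N, ∀ b ≤ j + 1, c j * (l ^ b / (b.factorial : ℝ)) ≤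
      ∑ a ∈ (blocks P β j (j + 1)).powersetCard b, ∏ p ∈ a, w p)
    (hl0 : 0 ≤ l) (y : ℕ) :
    (∏ j ∈ range N, c j) * (l ^ (N - y) * walk N 0 y) ≤
      ∑ a ∈ pathSets P β 0 N 0 y, ∏ p ∈ a, w p := by
  induction N generalizing y with
  | zero =>
    rw [pathSets_zero, walk]
    split_ifs with h
    · subst h; simp
    · simp
  | succ N ih =>
    by_cases hy : y = 0
    · subst hy; rw [pathSets_succ_zero, walk_succ_zero]; simp
    rw [sum_pathSets_succ w P β hy, walk_succ hy le_rfl, mul_sum, mul_sum]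
    refine sum_le_sum fun z hz => ?_
    have hz' := mem_range.1 hz
    split_ifs with h
    · have h1 := ih (fun j h => hc j (by omega)) (fun j h => hl j (by omega)) z
      have h2 := hl N (by omega) (z + 1 - y) (by omega)
      rw [zero_add]
      refine le_trans (le_of_eq ?_) (mul_le_mul h1 h2 (mul_nonneg (hc N (by omega))
        (by positivity)) (sum_nonneg fun a _ => prod_nonneg fun p _ => hw p))
      rw [prod_range_succ, show N + 1 - y = (N - z) + (z + 1 - y) by omega, pow_add]
      ring
    · simp

end Blocks

end PolyTable

namespace PolyTable
open Finset

/-! ### Upper bound for the weighted number of subset sums -/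

section UpperSum

set_option linter.unusedSectionVars false

variable {α : Type*} [DecidableEq α]

/-- The set of the sums of `deg` over the subsets of `a`. -/
def subsums (deg : α → ℕ) (a : Finset α) : Finset ℕ := a.powerset.image fun d => ∑ p ∈ d, deg p

lemma mem_subsums {deg : α → ℕ} {a : Finset α} {n : ℕ} :
    n ∈ subsums deg a ↔ ∃ d ⊆ a, ∑ p ∈ d, deg p = n := by simp [subsums]

lemma card_subsums_le_two_pow (deg : α → ℕ) (a : Finset α) : #(subsums deg a) ≤ 2 ^ #a :=
  card_image_le.trans (card_powerset a).le

lemma card_subsums_le_sum (deg : α → ℕ) (a : Finset α) :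
    #(subsums deg a) ≤ ∑ p ∈ a, deg p + 1 := by
  rw [← card_range (∑ p ∈ a, deg p + 1)]
  refine card_le_card fun n hn => ?_
  obtain ⟨d, hd, rfl⟩ := mem_subsums.1 hn
  exact mem_range.2 (Nat.lt_succ_of_le (sum_le_sum_of_subset hd))

lemma card_subsums_union_le (deg : α → ℕ) (a b : Finset α) :
    #(subsums deg (a ∪ b)) ≤ #(subsums deg a) * #(subsums deg b) := by
  refine le_trans (card_le_card fun n hn => ?_) (card_image₂_le (· + ·) _ _)
  obtain ⟨d, hd, rfl⟩ := mem_subsums.1 hn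
  refine mem_image₂.2 ⟨_, mem_subsums.2 ⟨d.filter (· ∈ a), ?_, rfl⟩, _,
    mem_subsums.2 ⟨d.filter (· ∉ a), ?_, rfl⟩, sum_filter_add_sum_filter_not _ _ _⟩
  · intro p hp; exact (mem_filter.1 hp).2
  · intro p hp
    rw [mem_filter] at hp
    exact (mem_union.1 (hd hp.1)).resolve_left hp.2

lemma card_subsums_le_erase (deg : α → ℕ) (a : Finset α) (p : α) :
    #(subsums deg a) ≤ 2 * #(subsums deg (a.erase p)) := by
  by_cases hp : p ∈ a
  · have h := card_subsums_union_le deg {p} (a.erase p)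
    rw [← insert_eq, insert_erase hp] at h
    refine h.trans (Nat.mul_le_mul_right _ ?_)
    simpa using card_subsums_le_two_pow deg {p}
  · rw [erase_eq_of_notMem hp]; omega

/-- Summing over pairs of a set and one of its elements, by removing that element. -/
lemma sum_sum_erase_le {w : α → ℝ} (hw : ∀ p, 0 ≤ w p) {X : α → Finset α → ℝ}
    (hX : ∀ p a, 0 ≤ X p a) {P : Finset α} {𝒞 𝒟 : Finset (Finset α)}
    (h𝒞 : ∀ a ∈ 𝒞, a ⊆ P) (h : ∀ a ∈ 𝒞, ∀ p ∈ a, a.erase p ∈ 𝒟) :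
    ∑ a ∈ 𝒞, (∏ p ∈ a, w p) * ∑ p ∈ a, X p (a.erase p) ≤
      ∑ a ∈ 𝒟, (∏ p ∈ a, w p) * ∑ p ∈ P, w p * X p a := by
  have hw' : ∀ a : Finset α, 0 ≤ ∏ p ∈ a, w p := fun a => prod_nonneg fun p _ => hw p
  simp_rw [mul_sum]
  rw [← sum_product', sum_sigma']
  refine le_trans (le_of_eq ?_) (sum_le_sum_of_subset_of_nonneg
    (s := (𝒞.sigma fun a => a).image fun x => (x.1.erase x.2, x.2)) ?_ ?_)
  · rw [sum_image]
    · refine sum_congr rfl ?_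
      rintro ⟨a, p⟩ hx
      simp only [mem_sigma] at hx
      rw [← mul_prod_erase a w hx.2]
      ring
    · rintro ⟨a, p⟩ hx ⟨b, q⟩ hy hxy
      simp only [coe_sigma, Set.mem_sigma_iff, SetLike.mem_coe] at hx hy
      simp only [Prod.mk.injEq] at hxy
      obtain ⟨h2, rfl⟩ := hxy
      have : a = b := by rw [← insert_erase hx.2, h2, insert_erase hy.2]
      subst this
      rfl
  · intro x hx
    obtain ⟨⟨a, p⟩, hap, rfl⟩ := mem_image.1 hx
    simp only [mem_sigma] at hap
    exact mem_product.2 ⟨h a hap.1 p hap.2, h𝒞 a hap.1 hap.2⟩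
  · intro x _ _
    exact mul_nonneg (hw' _) (mul_nonneg (hw _) (hX _ _))

/-- The case where the removed element and the remaining set separate. It bounds first moments such
as the average degree of a set. -/
lemma sum_sum_mem_le {w g : α → ℝ} (hw : ∀ p, 0 ≤ w p) (hg : ∀ p, 0 ≤ g p)
    {X : Finset α → ℝ} (hX : ∀ a, 0 ≤ X a) {P : Finset α} {𝒞 𝒟 : Finset (Finset α)}
    (h𝒞 : ∀ a ∈ 𝒞, a ⊆ P) (h : ∀ a ∈ 𝒞, ∀ p ∈ a, a.erase p ∈ 𝒟) :
    ∑ a ∈ 𝒞, (∏ p ∈ a, w p) * ∑ p ∈ a, g p * X (a.erase p) ≤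
      (∑ p ∈ P, g p * w p) * ∑ a ∈ 𝒟, (∏ p ∈ a, w p) * X a := by
  refine (sum_sum_erase_le hw (X := fun p a => g p * X a) (fun p a => mul_nonneg (hg p) (hX a))
    h𝒞 h).trans (le_of_eq ?_)
  rw [mul_sum]
  refine sum_congr rfl fun a _ => ?_
  rw [mul_sum, sum_mul]
  exact sum_congr rfl fun p _ => by ring

lemma exists_last_argmin (h : ℕ → ℤ) (J : ℕ) :
    ∃ j ≤ J, (∀ i < j, h j ≤ h i) ∧ ∀ i, j < i → i ≤ J → h j < h i := by
  induction J with
  | zero => exact ⟨0, le_rfl, fun i hi => by omega, fun i h1 h2 => by omega⟩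
  | succ J ih =>
    obtain ⟨j, hj, h1, h2⟩ := ih
    by_cases hlt : h j < h (J + 1)
    · refine ⟨j, by omega, h1, fun i hi hiJ => ?_⟩
      rcases Nat.lt_or_ge i (J + 1) with hi' | hi'
      · exact h2 i hi (by omega)
      · have : i = J + 1 := by omega
        subst this; exact hlt
    · refine ⟨J + 1, le_rfl, fun i hi => ?_, fun i h3 h4 => by omega⟩
      rcases lt_trichotomy i j with h3 | h3 | h3
      · have := h1 i h3; omega
      · subst h3; omega
      · have := h2 i h3 (by omega); omega

lemma card_filter_blocks {β : α → ℕ} {a : Finset α} {j k : ℕ} (hk : k ≤ j) :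
    (a.filter fun p => β p < j).filter (fun p => β p < k) = a.filter fun p => β p < k := by
  ext p
  simp only [mem_filter]
  constructor
  · rintro ⟨⟨h, _⟩, h'⟩; exact ⟨h, h'⟩
  · rintro ⟨h, h'⟩; exact ⟨⟨h, by omega⟩, h'⟩

lemma erase_mem_pathSets {P : Finset α} {β : α → ℕ} {i N r y : ℕ} {a : Finset α} {p : α}
    (ha : a ∈ pathSets P β i N r y) (hp : p ∈ a) : a.erase p ∈ pathSets P β i N r (y + 1) := by
  obtain ⟨h1, h2, h3⟩ := mem_pathSets.1 ha
  refine mem_pathSets.2 ⟨(erase_subset _ _).trans h1, fun k hk1 hk2 => ?_, ?_⟩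
  · have := h2 k hk1 hk2
    have := card_le_card (filter_subset_filter (fun p => β p < i + k) (erase_subset p a))
    omega
  · have := card_erase_add_one hp
    omega

/-- Cutting a set at the last minimum of its walk. -/
lemma exists_split {P : Finset α} {β : α → ℕ} {J : ℕ} {a : Finset α}
    (ha : a ⊆ blocks P β 0 J) :
    ∃ j ≤ J, ∃ ρ ≤ #P, ∃ x ≤ J,
      (a.filter fun p => β p < j) ∈ pathSets P β 0 j (ρ + 1) 1 ∧
      (a.filter fun p => ¬ β p < j) ∈ pathSets P β j (J - j) 0 x := by
  -- Since the height at `0` is `0`, the minimum is at most `0`, so the first `j` blocks contain at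
  -- least `j` elements.
  obtain ⟨j, hj, h1, h2⟩ := exists_last_argmin
    (fun j => (j : ℤ) - #(a.filter fun p => β p < j)) J
  have hA : j ≤ #(a.filter fun p => β p < j) := by
    rcases Nat.eq_zero_or_pos j with rfl | h0
    · omega
    · have := h1 0 h0
      simp at this
      omega
  have hP : #(a.filter fun p => β p < j) ≤ #P :=
    card_le_card ((filter_subset _ _).trans (ha.trans (filter_subset _ _)))
  have hc : ∀ k, j < k → k ≤ J → #((a.filter fun p => ¬ β p < j).filter fun p => β p < k) + 1 ≤
      k - j := by
    intro k hk hkJ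
    have := filter_lt_add_filter (β := β) (a := a) hk.le
    have := h2 k hk hkJ
    omega
  have hJ : #(a.filter fun p => ¬ β p < j) ≤ J - j := by
    have e : (a.filter fun p => ¬ β p < j).filter (fun p => β p < J) =
        a.filter fun p => ¬ β p < j := by
      refine filter_true_of_mem fun p hp => ?_
      exact (mem_blocks.1 (ha (mem_filter.1 hp).1)).2.2
    rcases Nat.lt_or_ge j J with h | h
    · have := hc J h le_rfl
      rw [e] at this
      omega
    · have : a.filter (fun p => ¬ β p < j) = ∅ := by
        refine filter_false_of_mem fun p hp => ?_
        have := (mem_blocks.1 (ha hp)).2.2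
        omega
      rw [this]; simp
  -- The prefix starts at `ρ + 1`, where `ρ` is the depth of the minimum; it then ends at `1` and is
  -- positive throughout. After the last minimum the walk, restarted at `0`, is strictly positive.
  refine ⟨j, hj, #(a.filter fun p => β p < j) - j, by omega,
    J - j - #(a.filter fun p => ¬ β p < j), by omega, ?_, ?_⟩
  · refine mem_pathSets.2 ⟨fun p hp => ?_, fun k hk1 hk2 => ?_, by omega⟩
    · rw [mem_filter] at hp
      have := mem_blocks.1 (ha hp.1)
      exact mem_blocks.2 ⟨this.1, by omega, by omega⟩
    · rw [zero_add, card_filter_blocks hk2]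
      rcases Nat.lt_or_ge k j with h | h
      · have := h1 k h
        omega
      · have : k = j := by omega
        subst this
        omega
  · refine mem_pathSets.2 ⟨fun p hp => ?_, fun k hk1 hk2 => ?_, by omega⟩
    · rw [mem_filter] at hp
      have := mem_blocks.1 (ha hp.1)
      exact mem_blocks.2 ⟨this.1, by omega, by omega⟩
    · have := hc (j + k) (by omega) (by omega)
      omega

/-- Subset sums of the prefix are integers in `[0, deg]`, while the suffix has at most `2 ^ #` of
them. The set is recovered from prefix and suffix, so summing over all cuts, depths and final
heights only enlarges the sum. -/
lemma sum_card_subsums_le_sum_split {w : α → ℝ} (hw : ∀ p, 0 ≤ w p) (deg : α → ℕ)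
    {P : Finset α} {β : α → ℕ} {J : ℕ} (hP : ∀ p ∈ P, β p < J) :
    ∑ a ∈ P.powerset, (∏ p ∈ a, w p) * (#(subsums deg a) : ℝ) ≤
      ∑ j ∈ range (J + 1),
        (∑ ρ ∈ range (#P + 1), ∑ a ∈ pathSets P β 0 j (ρ + 1) 1,
          (∏ p ∈ a, w p) * (1 + ∑ p ∈ a, (deg p : ℝ))) *
        ∑ x ∈ range (J + 1), ∑ a ∈ pathSets P β j (J - j) 0 x, (∏ p ∈ a, w p) * 2 ^ #a := by
  have hw' : ∀ a : Finset α, 0 ≤ ∏ p ∈ a, w p := fun a => prod_nonneg fun p _ => hw p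
  have hPb : P = blocks P β 0 J := by
    ext p; rw [mem_blocks]
    exact ⟨fun h => ⟨h, by omega, hP p h⟩, fun h => h.1⟩
  choose! j hj ρ hρ x hx h1 h2 using
    fun (a : Finset α) (ha : a ∈ P.powerset) =>
      exists_split (β := β) (J := J) (a := a) (hPb ▸ mem_powerset.1 ha)
  rw [← sum_fiberwise_of_maps_to (t := range (J + 1)) (g := j)
    (fun a ha => mem_range.2 (Nat.lt_succ_of_le (hj a ha)))]
  refine sum_le_sum fun i _ => ?_
  rw [sum_sigma', sum_sigma', sum_mul_sum, ← sum_product']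
  refine le_trans (b := ∑ a ∈ P.powerset.filter (fun a => j a = i),
    ((∏ p ∈ a.filter (fun p => β p < i), w p) *
        (1 + ∑ p ∈ a.filter (fun p => β p < i), (deg p : ℝ))) *
      ((∏ p ∈ a.filter (fun p => ¬ β p < i), w p) * 2 ^ #(a.filter fun p => ¬ β p < i)))
    (sum_le_sum fun a _ => ?_) ?_
  · rw [← prod_filter_mul_prod_filter_not a (fun p => β p < i) w]
    have e1 := card_subsums_union_le deg (a.filter fun p => β p < i)
      (a.filter fun p => ¬ β p < i)
    rw [filter_union_filter_not_eq] at e1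
    have e2 := e1.trans (Nat.mul_le_mul
      (card_subsums_le_sum deg (a.filter fun p => β p < i))
      (card_subsums_le_two_pow deg (a.filter fun p => ¬ β p < i)))
    have e3 : (#(subsums deg a) : ℝ) ≤
        (1 + ∑ p ∈ a.filter (fun p => β p < i), (deg p : ℝ)) *
          2 ^ #(a.filter fun p => ¬ β p < i) := by
      rw [add_comm (1 : ℝ)]
      exact_mod_cast e2
    refine (mul_le_mul_of_nonneg_left e3 (mul_nonneg (hw' _) (hw' _))).trans (le_of_eq ?_)
    ring
  · refine le_trans (le_of_eq ?_) (sum_le_sum_of_subset_of_nonneg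
      (s := (P.powerset.filter (fun a => j a = i)).image fun a =>
        ((⟨ρ a, a.filter fun p => β p < i⟩, ⟨x a, a.filter fun p => ¬ β p < i⟩) :
          ((_ : ℕ) × Finset α) × ((_ : ℕ) × Finset α))) ?_ ?_)
    · rw [sum_image]
      intro a _ b _ hab
      simp only [Prod.mk.injEq, Sigma.mk.injEq, heq_eq_eq] at hab
      rw [← filter_union_filter_not_eq (fun p => β p < i) a, hab.1.2, hab.2.2,
        filter_union_filter_not_eq]
    · intro y hy
      obtain ⟨a, ha, rfl⟩ := mem_image.1 hy
      rw [mem_filter] at ha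
      obtain ⟨ha, rfl⟩ := ha
      simp only [mem_product, mem_sigma, mem_range]
      exact ⟨⟨Nat.lt_succ_of_le (hρ a ha), h1 a ha⟩, Nat.lt_succ_of_le (hx a ha), h2 a ha⟩
    · intro y _ _
      refine mul_nonneg (mul_nonneg (hw' _) ?_) (mul_nonneg (hw' _) (by positivity))
      positivity

lemma log_two_pos : 0 < Real.log 2 := Real.log_pos (by norm_num)

lemma log_two_lt_one : Real.log 2 < 1 := by linarith [Real.log_two_lt_d9]

lemma one_lt_two_log_two : 1 < 2 * Real.log 2 := by linarith [Real.log_two_gt_d9]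

/-- The growth rate `2 e log 2 = 2 ^ (2 - δ)`. -/
noncomputable def rate : ℝ := 2 * Real.exp 1 * Real.log 2

/-- The expected degree of the prefix has order `2 ^ j`, and its weight has order `(log 2) ^ (ρ + j)
* e ^ j * decay (j + 1)` up to the factor `(ρ + 1) ^ 2`. The sum over the depth `ρ` converges
because `log 2 < 1`. -/
lemma exists_prefix_le : ∃ C : ℝ, 0 < C ∧ ∀ (α : Type*) [DecidableEq α] (w : α → ℝ)
    (deg β : α → ℕ) (P : Finset α) (j R : ℕ), (∀ p, 0 ≤ w p) →
    (∀ p ∈ P, deg p ≤ 2 ^ (β p + 1)) →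
    (∀ i < j, ∑ p ∈ blocks P β i (i + 1), w p ≤ Real.log 2) →
    ∑ ρ ∈ range R, ∑ a ∈ pathSets P β 0 j (ρ + 1) 1,
      (∏ p ∈ a, w p) * (1 + ∑ p ∈ a, (deg p : ℝ)) ≤ C * rate ^ j * decay (j + 1) := by
  obtain ⟨C, hC, hC'⟩ := exists_sum_pow_mul_geometric_le 2 log_two_pos.le log_two_lt_one
  refine ⟨10 * Real.exp 1 * C, by positivity, ?_⟩
  intro α _ w deg β P j R hw hdeg hl
  set l := Real.log 2 with hldef
  have hl0 : 0 < l := log_two_pos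
  have hd := decay_nonneg (j + 1)
  have hw' : ∀ a : Finset α, 0 ≤ ∏ p ∈ a, w p := fun a => prod_nonneg fun p _ => hw p
  have hdegsum : ∑ p ∈ blocks P β 0 j, (deg p : ℝ) * w p ≤ 2 * 2 ^ j * l := by
    have : ∀ k ≤ j, ∑ p ∈ blocks P β 0 k, (deg p : ℝ) * w p ≤ 2 * (2 ^ k - 1) * l := by
      intro k
      induction k with
      | zero =>
        intro _
        have : blocks P β 0 0 = ∅ := by
          rw [eq_empty_iff_forall_notMem]
          intro p hp
          have := mem_blocks.1 hp
          omega
        rw [this]; simp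
      | succ k ih =>
        intro hk
        have e : blocks P β 0 (k + 1) = blocks P β 0 k ∪ blocks P β k (k + 1) := by
          ext p; simp only [mem_union, mem_blocks]
          constructor
          · rintro ⟨h1, h2, h3⟩
            rcases Nat.lt_or_ge (β p) k with h | h
            · exact Or.inl ⟨h1, h2, h⟩
            · exact Or.inr ⟨h1, h, h3⟩
          · rintro (h | h)
            · exact ⟨h.1, h.2.1, by omega⟩
            · exact ⟨h.1, by omega, h.2.2⟩
        have hdis : Disjoint (blocks P β 0 k) (blocks P β k (k + 1)) := by
          rw [disjoint_left]
          intro p hp hq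
          have := mem_blocks.1 hp
          have := mem_blocks.1 hq
          omega
        rw [e, sum_union hdis]
        have h1 := ih (by omega)
        have h2 : ∑ p ∈ blocks P β k (k + 1), (deg p : ℝ) * w p ≤ 2 ^ (k + 1) * l := by
          refine le_trans ?_ (mul_le_mul_of_nonneg_left (hl k (by omega)) (by positivity))
          rw [mul_sum]
          refine sum_le_sum fun p hp => mul_le_mul_of_nonneg_right ?_ (hw p)
          have hp' := mem_blocks.1 hp
          have h3 := hdeg p hp'.1
          rw [show β p = k by omega] at h3
          exact_mod_cast h3
        rw [pow_succ] at h2 ⊢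
        linarith
    refine (this j le_rfl).trans ?_
    have : 0 ≤ l := hl0.le
    nlinarith
  have hterm : ∀ ρ ∈ range R, ∑ a ∈ pathSets P β 0 j (ρ + 1) 1,
      (∏ p ∈ a, w p) * (1 + ∑ p ∈ a, (deg p : ℝ)) ≤
      (10 * Real.exp 1 * (2 ^ j * l ^ j * Real.exp j * decay (j + 1))) *
        (((ρ : ℝ) + 1) ^ 2 * l ^ ρ) := by
    intro ρ _
    have hl' : ∀ i, 0 ≤ i → i < 0 + j → ∑ p ∈ blocks P β i (i + 1), w p ≤ l :=
      fun i _ h => hl i (by omega)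
    have h1 : ∑ a ∈ pathSets P β 0 j (ρ + 1) 1, ∏ p ∈ a, w p ≤
        l ^ (ρ + j) * (2 * Real.exp 1 * 1 * ((ρ : ℝ) + 1) ^ 2 * Real.exp j * decay (j + 1)) := by
      refine (sum_pathSets_le hw hl' hl0.le (ρ + 1) 1).trans ?_
      rw [show ρ + 1 + j - 1 = ρ + j by omega]
      refine mul_le_mul_of_nonneg_left ?_ (by positivity)
      have := walk_le (N := j) (r := ρ + 1) (y := 1) (by omega)
      push_cast at this
      exact this
    have h2 : ∑ a ∈ pathSets P β 0 j (ρ + 1) 1, (∏ p ∈ a, w p) * ∑ p ∈ a, (deg p : ℝ) ≤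
        2 * 2 ^ j * (l ^ (ρ + j) *
          (2 * Real.exp 1 * 2 * ((ρ : ℝ) + 1) ^ 2 * Real.exp j * decay (j + 1))) := by
      have h3 := sum_sum_mem_le hw (g := fun p => (deg p : ℝ)) (fun p => by positivity)
        (X := fun _ => 1) (fun _ => zero_le_one) (P := blocks P β 0 j)
        (𝒞 := pathSets P β 0 j (ρ + 1) 1) (𝒟 := pathSets P β 0 j (ρ + 1) 2)
        (fun a ha => by simpa using (mem_pathSets.1 ha).1)
        (fun a ha p hp => erase_mem_pathSets ha hp)
      simp only [mul_one] at h3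
      refine h3.trans ?_
      have h4 : ∑ a ∈ pathSets P β 0 j (ρ + 1) 2, ∏ p ∈ a, w p ≤
          l ^ (ρ + 1 + j - 2) * walk j (ρ + 1) 2 := sum_pathSets_le hw hl' hl0.le (ρ + 1) 2
      -- The removed element contributes the missing power of `log 2`. For `ρ + j = 0` the
      -- subtraction truncates, but then no walk reaches height `2`.
      have h5 : l * (l ^ (ρ + 1 + j - 2) * walk j (ρ + 1) 2) =
          l ^ (ρ + j) * walk j (ρ + 1) 2 := by
        rcases Nat.eq_zero_or_pos (ρ + j) with h0 | h0
        · have : walk j (ρ + 1) 2 = 0 := walk_eq_zero (by omega)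
          rw [this]; ring
        · rw [show ρ + j = (ρ + 1 + j - 2) + 1 by omega, pow_succ]
          ring
      have h6 := walk_le (N := j) (r := ρ + 1) (y := 2) (by omega)
      push_cast at h6
      have h7 : (∑ p ∈ blocks P β 0 j, (deg p : ℝ) * w p) *
          ∑ a ∈ pathSets P β 0 j (ρ + 1) 2, ∏ p ∈ a, w p ≤
          (2 * 2 ^ j * l) * (l ^ (ρ + 1 + j - 2) * walk j (ρ + 1) 2) :=
        mul_le_mul hdegsum h4 (sum_nonneg fun a _ => hw' a) (by positivity)
      refine h7.trans ?_
      rw [mul_assoc (2 * 2 ^ j) l, h5]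
      refine mul_le_mul_of_nonneg_left (mul_le_mul_of_nonneg_left h6 ?_) ?_ <;> positivity
    have h8 : ∑ a ∈ pathSets P β 0 j (ρ + 1) 1, (∏ p ∈ a, w p) * (1 + ∑ p ∈ a, (deg p : ℝ)) =
        ∑ a ∈ pathSets P β 0 j (ρ + 1) 1, ∏ p ∈ a, w p +
        ∑ a ∈ pathSets P β 0 j (ρ + 1) 1, (∏ p ∈ a, w p) * ∑ p ∈ a, (deg p : ℝ) := by
      rw [← sum_add_distrib]
      exact sum_congr rfl fun a _ => by ring
    rw [h8]
    refine (add_le_add h1 h2).trans ?_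
    have h9 : (1 : ℝ) ≤ 2 ^ j := one_le_pow₀ (by norm_num)
    have h10 : 0 ≤ l ^ (ρ + j) * (Real.exp 1 * ((ρ : ℝ) + 1) ^ 2 * Real.exp j * decay (j + 1)) := by
      positivity
    rw [pow_add] at h10 ⊢
    nlinarith [mul_le_mul_of_nonneg_right h9 h10]
  refine (sum_le_sum hterm).trans ?_
  rw [← mul_sum]
  have h1 := hC' (range R)
  have e : (rate : ℝ) ^ j = 2 ^ j * l ^ j * Real.exp j := by
    rw [rate, mul_pow, mul_pow, ← Real.exp_nat_mul, mul_one]; ring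
  rw [e]
  refine (mul_le_mul_of_nonneg_left h1 (by positivity)).trans (le_of_eq ?_)
  ring

/-- Each of the `N - x` elements contributes `2 log 2`. As this exceeds `1`, the sum over the final
height `x` is dominated by small `x`. -/
lemma exists_suffix_le : ∃ C : ℝ, 0 < C ∧ ∀ (α : Type*) [DecidableEq α] (w : α → ℝ)
    (β : α → ℕ) (P : Finset α) (j N R : ℕ), (∀ p, 0 ≤ w p) →
    (∀ i, j ≤ i → i < j + N → ∑ p ∈ blocks P β i (i + 1), w p ≤ Real.log 2) →
    ∑ x ∈ range R, ∑ a ∈ pathSets P β j N 0 x, (∏ p ∈ a, w p) * 2 ^ #a ≤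
      C * rate ^ N * decay (N + 1) := by
  have hz0 : 0 ≤ (2 * Real.log 2)⁻¹ := inv_nonneg.2 (by linarith [one_lt_two_log_two])
  have hz1 : (2 * Real.log 2)⁻¹ < 1 := inv_lt_one_of_one_lt₀ one_lt_two_log_two
  obtain ⟨C, hC, hC'⟩ := exists_sum_pow_mul_geometric_le 1 hz0 hz1
  refine ⟨4 * C, by positivity, ?_⟩
  intro α _ w β P j N R hw hl
  have hl0 : 0 < Real.log 2 := log_two_pos
  have hd := decay_nonneg (N + 1)
  have hterm : ∀ x ∈ range R, ∑ a ∈ pathSets P β j N 0 x, (∏ p ∈ a, w p) * 2 ^ #a ≤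
      (4 * (2 * Real.log 2) ^ N * Real.exp N * decay (N + 1)) *
        (((x : ℝ) + 1) ^ 1 * (2 * Real.log 2)⁻¹ ^ x) := by
    intro x _
    have h1 : ∑ a ∈ pathSets P β j N 0 x, (∏ p ∈ a, w p) * (2 : ℝ) ^ #a =
        2 ^ (N - x) * ∑ a ∈ pathSets P β j N 0 x, ∏ p ∈ a, w p := by
      rw [mul_sum]
      refine sum_congr rfl fun a ha => ?_
      have := (mem_pathSets.1 ha).2.2
      rw [show #a = N - x by omega]
      ring
    rw [h1]
    have h2 := sum_pathSets_le hw hl hl0.le 0 x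
    refine (mul_le_mul_of_nonneg_left h2 (by positivity)).trans ?_
    rw [zero_add]
    rcases Nat.lt_or_ge N x with hx | hx
    · rw [walk_eq_zero (by omega)]
      simp only [mul_zero]
      positivity
    · have e : (2 * Real.log 2) ^ N * (2 * Real.log 2)⁻¹ ^ x = (2 : ℝ) ^ (N - x) *
          Real.log 2 ^ (N - x) := by
        rw [← mul_pow, inv_pow, pow_sub₀ _ (by positivity) hx]
      have h3 := walk_zero_le' N x
      calc (2 : ℝ) ^ (N - x) * (Real.log 2 ^ (N - x) * walk N 0 x)
          ≤ 2 ^ (N - x) * (Real.log 2 ^ (N - x) *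
            (4 * (x + 1) * Real.exp N * decay (N + 1))) := by gcongr
        _ = (2 ^ (N - x) * Real.log 2 ^ (N - x)) *
            (4 * (x + 1) * Real.exp N * decay (N + 1)) := by ring
        _ = _ := by rw [← e]; ring
  refine (sum_le_sum hterm).trans ?_
  rw [← mul_sum]
  have h1 := hC' (range R)
  have e : (rate : ℝ) ^ N = (2 * Real.log 2) ^ N * Real.exp N := by
    rw [rate, show 2 * Real.exp 1 * Real.log 2 = (2 * Real.log 2) * Real.exp 1 by ring, mul_pow,
      ← Real.exp_nat_mul, mul_one]
  rw [e]
  refine (mul_le_mul_of_nonneg_left h1 (by positivity)).trans (le_of_eq ?_)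
  ring

lemma rate_pos : 0 < rate := by
  have := log_two_pos
  unfold rate
  positivity

/-- The powers of `rate` from prefix and suffix multiply to `rate ^ J`, and the sum over the cut is
a convolution of `decay` with itself, which is again of order `decay`. -/
lemma exists_sum_card_subsums_le_of_blocks : ∃ C : ℝ, 0 < C ∧
    ∀ (α : Type*) [DecidableEq α] (w : α → ℝ) (deg β : α → ℕ) (P : Finset α) (J : ℕ),
    (∀ p, 0 ≤ w p) → (∀ p ∈ P, β p < J) → (∀ p ∈ P, deg p ≤ 2 ^ (β p + 1)) →
    (∀ i < J, ∑ p ∈ blocks P β i (i + 1), w p ≤ Real.log 2) →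
    ∑ a ∈ P.powerset, (∏ p ∈ a, w p) * (#(subsums deg a) : ℝ) ≤
      C * rate ^ J * decay (J + 1) := by
  obtain ⟨C₁, hC₁, h₁⟩ := exists_prefix_le
  obtain ⟨C₂, hC₂, h₂⟩ := exists_suffix_le
  refine ⟨C₁ * C₂ * 24, by positivity, ?_⟩
  intro α _ w deg β P J hw hβ hdeg hl
  refine (sum_card_subsums_le_sum_split hw deg hβ).trans ?_
  have hr := rate_pos
  have hterm : ∀ j ∈ range (J + 1),
      (∑ ρ ∈ range (#P + 1), ∑ a ∈ pathSets P β 0 j (ρ + 1) 1,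
          (∏ p ∈ a, w p) * (1 + ∑ p ∈ a, (deg p : ℝ))) *
        ∑ x ∈ range (J + 1), ∑ a ∈ pathSets P β j (J - j) 0 x, (∏ p ∈ a, w p) * 2 ^ #a ≤
      C₁ * C₂ * rate ^ J * (decay (j + 1) * decay (J - j + 1)) := by
    intro j hj
    have hj' : j ≤ J := by simp at hj; omega
    have e1 := h₁ α w deg β P j (#P + 1) hw hdeg fun i hi => hl i (by omega)
    have e2 := h₂ α w β P j (J - j) (J + 1) hw fun i _ hi => hl i (by omega)
    have d1 := decay_nonneg (j + 1)
    refine (mul_le_mul e1 e2 (sum_nonneg fun x _ => sum_nonneg fun a _ =>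
      mul_nonneg (prod_nonneg fun p _ => hw p) (by positivity)) (by positivity)).trans
      (le_of_eq ?_)
    rw [show rate ^ J = rate ^ j * rate ^ (J - j) by rw [← pow_add]; congr 1; omega]
    ring
  refine (sum_le_sum hterm).trans ?_
  rw [← mul_sum]
  refine (mul_le_mul_of_nonneg_left (sum_decay_mul_decay_le J) (by positivity)).trans
    (le_of_eq ?_)
  ring

lemma sum_powerset_card_subsums_le_mul {w : α → ℝ} (hw : ∀ p, 0 ≤ w p) (deg : α → ℕ)
    {P : Finset α} (q : α → Prop) [DecidablePred q] :
    ∑ a ∈ P.powerset, (∏ p ∈ a, w p) * (#(subsums deg a) : ℝ) ≤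
      (∑ a ∈ (P.filter q).powerset, (∏ p ∈ a, w p) * (#(subsums deg a) : ℝ)) *
      ∑ a ∈ (P.filter fun p => ¬ q p).powerset, (∏ p ∈ a, w p) * (#(subsums deg a) : ℝ) := by
  have hw' : ∀ a : Finset α, 0 ≤ ∏ p ∈ a, w p := fun a => prod_nonneg fun p _ => hw p
  rw [sum_mul_sum, ← sum_product']
  refine le_trans (b := ∑ a ∈ P.powerset,
    ((∏ p ∈ a.filter q, w p) * (#(subsums deg (a.filter q)) : ℝ)) *
    ((∏ p ∈ a.filter fun p => ¬ q p, w p) * (#(subsums deg (a.filter fun p => ¬ q p)) : ℝ)))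
    (sum_le_sum fun a _ => ?_) ?_
  · rw [← prod_filter_mul_prod_filter_not a q w]
    have e1 := card_subsums_union_le deg (a.filter q) (a.filter fun p => ¬ q p)
    rw [filter_union_filter_not_eq] at e1
    have e2 : (#(subsums deg a) : ℝ) ≤ (#(subsums deg (a.filter q)) : ℝ) *
        (#(subsums deg (a.filter fun p => ¬ q p)) : ℝ) := by exact_mod_cast e1
    refine (mul_le_mul_of_nonneg_left e2 (mul_nonneg (hw' _) (hw' _))).trans (le_of_eq ?_)
    ring
  · refine le_trans (le_of_eq ?_) (sum_le_sum_of_subset_of_nonneg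
      (s := P.powerset.image fun a => (a.filter q, a.filter fun p => ¬ q p)) ?_ ?_)
    · rw [sum_image]
      intro a _ b _ hab
      simp only [Prod.mk.injEq] at hab
      rw [← filter_union_filter_not_eq q a, hab.1, hab.2, filter_union_filter_not_eq]
    · intro y hy
      obtain ⟨a, ha, rfl⟩ := mem_image.1 hy
      rw [mem_powerset] at ha
      exact mem_product.2 ⟨mem_powerset.2 (filter_subset_filter _ ha),
        mem_powerset.2 (filter_subset_filter _ ha)⟩
    · intro y _ _
      exact mul_nonneg (mul_nonneg (hw' _) (by positivity)) (mul_nonneg (hw' _) (by positivity))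

lemma sum_Ioc_one_div_le {a b : ℕ} (ha : 1 ≤ a) (hab : a ≤ b) :
    ∑ m ∈ Ioc a b, (1 : ℝ) / m ≤ Real.log b - Real.log a := by
  induction b, hab using Nat.le_induction with
  | base => simp
  | succ b hab ih =>
    rw [sum_Ioc_succ_top hab]
    have hb : (0 : ℝ) < b := by
      have : 0 < b := by omega
      exact_mod_cast this
    have h1 : (1 : ℝ) / ((b + 1 : ℕ) : ℝ) ≤ Real.log ((b + 1 : ℕ) : ℝ) - Real.log b := by
      have h2 := Real.log_le_sub_one_of_pos (x := b / ((b + 1 : ℕ) : ℝ)) (by positivity)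
      rw [Real.log_div hb.ne' (by positivity)] at h2
      have h3 : (b : ℝ) / ((b + 1 : ℕ) : ℝ) - 1 = - (1 / ((b + 1 : ℕ) : ℝ)) := by
        push_cast; field_simp; ring
      linarith
    linarith

lemma le_sum_Ico_one_div {a b : ℕ} (ha : 1 ≤ a) (hab : a ≤ b) :
    Real.log b - Real.log a ≤ ∑ m ∈ Ico a b, (1 : ℝ) / m := by
  induction b, hab using Nat.le_induction with
  | base => simp
  | succ b hab ih =>
    rw [sum_Ico_succ_top hab]
    have hb : (0 : ℝ) < b := by
      have : 0 < b := by omega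
      exact_mod_cast this
    have h2 := Real.log_le_sub_one_of_pos (x := ((b + 1 : ℕ) : ℝ) / b) (by positivity)
    rw [Real.log_div (by positivity) hb.ne'] at h2
    have h3 : ((b + 1 : ℕ) : ℝ) / b - 1 = 1 / b := by
      push_cast; field_simp; ring
    linarith

/-- The blocks `(2 ^ i, 2 ^ (i + 1)]` have weight at most `log 2` by comparison with an integral.
Degree `1` lies in none of them; it is split off by submultiplicativity and costs at most `exp 2`,
from the sum of `2 ^ b / b!`. -/
lemma exists_sum_card_subsums_le : ∃ C : ℝ, 0 < C ∧
    ∀ (α : Type*) [DecidableEq α] (w : α → ℝ) (deg : α → ℕ) (P : Finset α) (J : ℕ),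
    (∀ p, 0 ≤ w p) → (∀ p ∈ P, 1 ≤ deg p ∧ deg p ≤ 2 ^ J) →
    (∀ m, 1 ≤ m → ∑ p ∈ P.filter (fun p => deg p = m), w p ≤ 1 / m) →
    ∑ a ∈ P.powerset, (∏ p ∈ a, w p) * (#(subsums deg a) : ℝ) ≤
      C * rate ^ J * decay (J + 1) := by
  obtain ⟨C, hC, h⟩ := exists_sum_card_subsums_le_of_blocks
  refine ⟨Real.exp 2 * C, by positivity, ?_⟩
  intro α _ w deg P J hw hdeg hsum
  have hw' : ∀ a : Finset α, 0 ≤ ∏ p ∈ a, w p := fun a => prod_nonneg fun p _ => hw p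
  refine (sum_powerset_card_subsums_le_mul hw deg fun p => deg p = 1).trans ?_
  have h1 : ∑ a ∈ (P.filter fun p => deg p = 1).powerset,
      (∏ p ∈ a, w p) * (#(subsums deg a) : ℝ) ≤ Real.exp 2 := by
    set P₁ := P.filter fun p => deg p = 1 with hP₁
    rw [sum_powerset]
    refine le_trans (sum_le_sum (g := fun b => (2 : ℝ) ^ b / (b.factorial : ℝ)) fun b _ => ?_)
      (Real.sum_le_exp_of_nonneg (by norm_num) _)
    have h2 : ∑ a ∈ P₁.powersetCard b, (∏ p ∈ a, w p) * (#(subsums deg a) : ℝ) ≤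
        ∑ a ∈ P₁.powersetCard b, (∏ p ∈ a, w p) * 2 ^ b := by
      refine sum_le_sum fun a ha => mul_le_mul_of_nonneg_left ?_ (hw' a)
      have := card_subsums_le_two_pow deg a
      rw [(mem_powersetCard.1 ha).2] at this
      exact_mod_cast this
    refine h2.trans ?_
    rw [← sum_mul]
    have h3 := sum_powersetCard_le hw (hsum 1 le_rfl) b
    norm_num at h3
    calc _ ≤ 1 / (b.factorial : ℝ) * 2 ^ b := by
          refine mul_le_mul_of_nonneg_right ?_ (by positivity)
          rw [one_div]; exact h3
      _ = _ := by ring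
  have hβ : ∀ p ∈ P.filter (fun p => ¬ deg p = 1), ∀ i, Nat.clog 2 (deg p) - 1 = i ↔
      2 ^ i < deg p ∧ deg p ≤ 2 ^ (i + 1) := by
    intro p hp i
    rw [mem_filter] at hp
    have h2 : 2 ≤ deg p := by have := hdeg p hp.1; omega
    have h3 : 0 < Nat.clog 2 (deg p) := Nat.clog_pos (by norm_num) h2
    rw [← Nat.clog_le_iff_le_pow (by norm_num), ← Nat.lt_clog_iff_pow_lt (by norm_num)]
    omega
  have h2 := h α w deg (fun p => Nat.clog 2 (deg p) - 1) (P.filter fun p => ¬ deg p = 1) J hw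
    (fun p hp => by
      have h3 := ((hβ p hp _).1 rfl).1
      have h4 := (hdeg p (mem_filter.1 hp).1).2
      exact (Nat.pow_lt_pow_iff_right (by norm_num)).1 (h3.trans_le h4))
    (fun p hp => ((hβ p hp _).1 rfl).2)
    (fun i _ => by
      have e : blocks (P.filter fun p => ¬ deg p = 1) (fun p => Nat.clog 2 (deg p) - 1) i (i + 1) ⊆
          (Ioc (2 ^ i) (2 ^ (i + 1))).biUnion fun m => P.filter fun p => deg p = m := by
        intro p hp
        obtain ⟨hp1, hp2, hp3⟩ := mem_blocks.1 hp
        have := (hβ p hp1 i).1 (by omega)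
        exact mem_biUnion.2 ⟨deg p, mem_Ioc.2 this, mem_filter.2 ⟨(mem_filter.1 hp1).1, rfl⟩⟩
      refine (sum_le_sum_of_subset_of_nonneg e fun p _ _ => hw p).trans ?_
      rw [sum_biUnion]
      · refine (sum_le_sum (g := fun m : ℕ => (1 : ℝ) / m) fun m hm => ?_).trans
          ((sum_Ioc_one_div_le Nat.one_le_two_pow
            (Nat.pow_le_pow_right (by norm_num) (Nat.le_succ i))).trans (le_of_eq ?_))
        · refine hsum m ?_
          exact Nat.one_le_of_lt (mem_Ioc.1 hm).1
        · push_cast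
          rw [Real.log_pow, Real.log_pow]
          push_cast
          ring
      · intro m _ n _ hmn
        rw [Function.onFun, disjoint_left]
        intro p hp hq
        exact hmn ((mem_filter.1 hp).2.symm.trans (mem_filter.1 hq).2))
  refine (mul_le_mul h1 h2 (sum_nonneg fun a _ => mul_nonneg (hw' a) (by positivity))
    (by positivity)).trans (le_of_eq ?_)
  ring

/-- Removing one element at most halves the number of subset sums, and the sum of `deg p * w p` is
at most `2 ^ J` because each degree contributes at most `1`. So the degree factor costs `2 * 2 ^ J`
and the constant term another `2 ^ J`. -/
lemma exists_sum_card_subsums_mul_le : ∃ C : ℝ, 0 < C ∧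
    ∀ (α : Type*) [DecidableEq α] (w : α → ℝ) (deg : α → ℕ) (P : Finset α) (J : ℕ),
    (∀ p, 0 ≤ w p) → (∀ p ∈ P, 1 ≤ deg p ∧ deg p ≤ 2 ^ J) →
    (∀ m, 1 ≤ m → ∑ p ∈ P.filter (fun p => deg p = m), w p ≤ 1 / m) →
    ∑ a ∈ P.powerset, (∏ p ∈ a, w p) * (#(subsums deg a) : ℝ) * (∑ p ∈ a, (deg p : ℝ) + 2 ^ J) ≤
      C * 2 ^ J * rate ^ J * decay (J + 1) := by
  obtain ⟨C, hC, h⟩ := exists_sum_card_subsums_le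
  refine ⟨3 * C, by positivity, ?_⟩
  intro α _ w deg P J hw hdeg hsum
  have hw' : ∀ a : Finset α, 0 ≤ ∏ p ∈ a, w p := fun a => prod_nonneg fun p _ => hw p
  have h0 := h α w deg P J hw hdeg hsum
  have hdw : ∑ p ∈ P, (deg p : ℝ) * w p ≤ 2 ^ J := by
    have e : P ⊆ (Ioc 0 (2 ^ J)).biUnion fun m => P.filter fun p => deg p = m := by
      intro p hp
      have := hdeg p hp
      exact mem_biUnion.2 ⟨deg p, mem_Ioc.2 (by omega), mem_filter.2 ⟨hp, rfl⟩⟩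
    refine (sum_le_sum_of_subset_of_nonneg e fun p _ _ =>
      mul_nonneg (by positivity) (hw p)).trans ?_
    rw [sum_biUnion]
    · have : ∀ m ∈ Ioc 0 (2 ^ J), ∑ p ∈ P.filter (fun p => deg p = m), (deg p : ℝ) * w p ≤ 1 := by
        intro m hm
        have hm' : 1 ≤ m := (mem_Ioc.1 hm).1
        have hm0 : (0 : ℝ) < m := by exact_mod_cast hm'
        have e2 : ∑ p ∈ P.filter (fun p => deg p = m), (deg p : ℝ) * w p =
            m * ∑ p ∈ P.filter (fun p => deg p = m), w p := by
          rw [mul_sum]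
          exact sum_congr rfl fun p hp => by rw [(mem_filter.1 hp).2]
        rw [e2]
        refine (mul_le_mul_of_nonneg_left (hsum m hm') hm0.le).trans (le_of_eq ?_)
        field_simp
      refine (sum_le_sum this).trans (le_of_eq ?_)
      simp
    · intro m _ n _ hmn
      rw [Function.onFun, disjoint_left]
      intro p hp hq
      exact hmn ((mem_filter.1 hp).2.symm.trans (mem_filter.1 hq).2)
  have h1 := sum_sum_mem_le hw (g := fun p => (deg p : ℝ)) (fun p => by positivity)
    (X := fun a => 2 * (#(subsums deg a) : ℝ)) (fun _ => by positivity) (P := P)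
    (𝒞 := P.powerset) (𝒟 := P.powerset) (fun a ha => mem_powerset.1 ha)
    (fun a ha p _ => mem_powerset.2 ((erase_subset _ _).trans (mem_powerset.1 ha)))
  have h2 : ∑ a ∈ P.powerset, (∏ p ∈ a, w p) * (#(subsums deg a) : ℝ) * ∑ p ∈ a, (deg p : ℝ) ≤
      ∑ a ∈ P.powerset, (∏ p ∈ a, w p) *
        ∑ p ∈ a, (deg p : ℝ) * (2 * (#(subsums deg (a.erase p)) : ℝ)) := by
    refine sum_le_sum fun a _ => ?_
    rw [mul_assoc]
    refine mul_le_mul_of_nonneg_left ?_ (hw' a)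
    rw [mul_sum]
    refine sum_le_sum fun p _ => ?_
    rw [mul_comm]
    refine mul_le_mul_of_nonneg_left ?_ (by positivity)
    exact_mod_cast card_subsums_le_erase deg a p
  set S := ∑ a ∈ P.powerset, (∏ p ∈ a, w p) * (#(subsums deg a) : ℝ) with hS
  have hS0 : 0 ≤ S := sum_nonneg fun a _ => mul_nonneg (hw' a) (by positivity)
  have e3 : ∑ a ∈ P.powerset, (∏ p ∈ a, w p) * (2 * (#(subsums deg a) : ℝ)) = 2 * S := by
    rw [hS, mul_sum]
    exact sum_congr rfl fun a _ => by ring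
  rw [e3] at h1
  have h3 := mul_le_mul_of_nonneg_right hdw (show 0 ≤ 2 * S by positivity)
  have e4 : ∑ a ∈ P.powerset, (∏ p ∈ a, w p) * (#(subsums deg a) : ℝ) *
      (∑ p ∈ a, (deg p : ℝ) + 2 ^ J) =
      ∑ a ∈ P.powerset, (∏ p ∈ a, w p) * (#(subsums deg a) : ℝ) * ∑ p ∈ a, (deg p : ℝ) +
      2 ^ J * S := by
    rw [hS, mul_sum, ← sum_add_distrib]
    exact sum_congr rfl fun a _ => by ring
  rw [e4]
  have h4 := mul_le_mul_of_nonneg_left h0 (show (0 : ℝ) ≤ 3 * 2 ^ J by positivity)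
  nlinarith

end UpperSum

end PolyTable

namespace PolyTable
open Finset

/-! ### Lower bound for the weighted number of subset sums by a second moment -/

section LowerSum

set_option linter.unusedSectionVars false

variable {α : Type*} [DecidableEq α]

/-- The pairs of subsets of `a` with equal degree sums. -/
def equalPairs (deg : α → ℕ) (a : Finset α) : Finset (Finset α × Finset α) :=
  (a.powerset ×ˢ a.powerset).filter fun x => ∑ p ∈ x.1, deg p = ∑ p ∈ x.2, deg p

/-- The pairs of subsets of `a` which agree in the blocks above `j`, and whose degree sums
differ by `m`. -/
def shiftedPairs (deg β : α → ℕ) (j m : ℕ) (a : Finset α) : Finset (Finset α × Finset α) :=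
  (a.powerset ×ˢ a.powerset).filter fun x =>
    (x.1.filter fun p => j < β p) = (x.2.filter fun p => j < β p) ∧
      m + ∑ p ∈ x.1, deg p = ∑ p ∈ x.2, deg p

/-- Cauchy-Schwarz for the number of representations of each subset sum. -/
lemma two_pow_sq_le (deg : α → ℕ) (a : Finset α) :
    (2 ^ #a) ^ 2 ≤ #(subsums deg a) * #(equalPairs deg a) := by
  have h1 : #(equalPairs deg a) = ∑ n ∈ subsums deg a,
      #(a.powerset.filter fun d => ∑ p ∈ d, deg p = n) ^ 2 := by
    rw [card_eq_sum_card_fiberwise (f := fun x => ∑ p ∈ x.1, deg p) (t := subsums deg a)]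
    · refine sum_congr rfl fun n _ => ?_
      rw [sq, ← card_product]
      congr 1
      ext ⟨x, y⟩
      simp only [equalPairs, mem_filter, mem_product]
      constructor
      · rintro ⟨⟨⟨h1, h2⟩, h3⟩, h4⟩; exact ⟨⟨h1, h4⟩, h2, by rw [← h3, h4]⟩
      · rintro ⟨⟨h1, h4⟩, h2, h3⟩; exact ⟨⟨⟨h1, h2⟩, by rw [h3, h4]⟩, h4⟩
    · intro x hx
      simp only [equalPairs, coe_filter, Set.mem_ofPred_eq, mem_product, mem_powerset] at hx
      exact mem_coe.2 (mem_subsums.2 ⟨x.1, hx.1.1, rfl⟩)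
  have h2 : 2 ^ #a = ∑ n ∈ subsums deg a, #(a.powerset.filter fun d => ∑ p ∈ d, deg p = n) := by
    rw [← card_powerset]
    exact card_eq_sum_card_fiberwise fun d hd => mem_coe.2 (mem_image_of_mem _ hd)
  rw [h1, h2]
  exact sq_sum_le_card_mul_sum_sq

/-- If the two subsets differ, choose `p` in their symmetric difference with the highest block index
and delete it. What remains agrees above that block and has degree sums differing by `deg p`. The
factor `2` records which of the two subsets contained `p`. -/
lemma card_equalPairs_le (deg β : α → ℕ) (a : Finset α) :
    #(equalPairs deg a) ≤ 2 ^ #a +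
      2 * ∑ p ∈ a, #(shiftedPairs deg β (β p) (deg p) (a.erase p)) := by
  have hsub : equalPairs deg a ⊆ (a.powerset.image fun d => (d, d)) ∪
      ((a.biUnion fun p => (shiftedPairs deg β (β p) (deg p) (a.erase p)).image
        fun x => (insert p x.1, x.2)) ∪
      (a.biUnion fun p => (shiftedPairs deg β (β p) (deg p) (a.erase p)).image
        fun x => (x.2, insert p x.1))) := by
    have key : ∀ x y : Finset α, x ⊆ a → y ⊆ a → ∑ p ∈ x, deg p = ∑ p ∈ y, deg p →
        ∀ p ∈ x, p ∉ y → (∀ q, (q ∈ x ∧ q ∉ y ∨ q ∈ y ∧ q ∉ x) → β q ≤ β p) →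
        (x.erase p, y) ∈ shiftedPairs deg β (β p) (deg p) (a.erase p) := by
      intro x y hx hy hxy p hp hpy hmax
      simp only [shiftedPairs, mem_filter, mem_product, mem_powerset]
      refine ⟨⟨erase_subset_erase p hx, fun q hq => mem_erase.2 ⟨?_, hy hq⟩⟩, ?_, ?_⟩
      · rintro rfl; exact hpy hq
      · ext q
        simp only [mem_filter, mem_erase]
        constructor
        · rintro ⟨⟨h1, h2⟩, h3⟩
          refine ⟨?_, h3⟩
          by_contra h4
          have := hmax q (Or.inl ⟨h2, h4⟩)
          omega
        · rintro ⟨h1, h3⟩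
          refine ⟨⟨?_, ?_⟩, h3⟩
          · rintro rfl; omega
          · by_contra h4
            have := hmax q (Or.inr ⟨h1, h4⟩)
            omega
      · rw [add_sum_erase x deg hp, hxy]
    rintro ⟨x, y⟩ hxy
    simp only [equalPairs, mem_filter, mem_product, mem_powerset] at hxy
    obtain ⟨⟨hx, hy⟩, hd⟩ := hxy
    by_cases he : x = y
    · subst he
      exact mem_union_left _ (mem_image.2 ⟨x, mem_powerset.2 hx, rfl⟩)
    refine mem_union_right _ ?_
    have hne : (symmDiff x y).Nonempty := by
      rw [nonempty_iff_ne_empty]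
      intro h
      exact he (symmDiff_eq_bot.1 h)
    obtain ⟨p, hp, hmax⟩ := exists_max_image (symmDiff x y) β hne
    have hmax' : ∀ q, (q ∈ x ∧ q ∉ y ∨ q ∈ y ∧ q ∉ x) → β q ≤ β p :=
      fun q hq => hmax q (mem_symmDiff.2 hq)
    rcases mem_symmDiff.1 hp with ⟨h1, h2⟩ | ⟨h1, h2⟩
    · refine mem_union_left _ (mem_biUnion.2 ⟨p, hx h1, mem_image.2 ⟨(x.erase p, y),
        key x y hx hy hd p h1 h2 hmax', ?_⟩⟩)
      simp [insert_erase h1]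
    · refine mem_union_right _ (mem_biUnion.2 ⟨p, hy h1, mem_image.2 ⟨(y.erase p, x),
        key y x hy hx hd.symm p h1 h2 (fun q hq => hmax' q hq.symm), ?_⟩⟩)
      simp [insert_erase h1]
  refine (card_le_card hsub).trans ((card_union_le _ _).trans ?_)
  refine add_le_add (card_image_le.trans (card_powerset a).le) ((card_union_le _ _).trans ?_)
  rw [two_mul]
  exact add_le_add (card_biUnion_le.trans (sum_le_sum fun p _ => card_image_le))
    (card_biUnion_le.trans (sum_le_sum fun p _ => card_image_le))

/-- The pairs of subsets of `a` which agree in the blocks above `j`. -/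
def agreeingPairs (β : α → ℕ) (j : ℕ) (a : Finset α) : Finset (Finset α × Finset α) :=
  (a.powerset ×ˢ a.powerset).filter fun x =>
    (x.1.filter fun p => j < β p) = (x.2.filter fun p => j < β p)

lemma card_agreeingPairs_le (β : α → ℕ) (j : ℕ) (a : Finset α) :
    #(agreeingPairs β j a) ≤ 2 ^ #a * 2 ^ #(a.filter fun p => β p < j + 1) := by
  rw [← card_powerset, ← card_powerset, ← card_product]
  refine card_le_card_of_injOn (fun x => (x.1, x.2.filter fun p => β p < j + 1)) ?_ ?_
  · rintro ⟨x, y⟩ h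
    simp only [agreeingPairs, coe_filter, mem_product, mem_powerset, Set.mem_ofPred_eq] at h
    exact mem_coe.2 (mem_product.2 ⟨mem_powerset.2 h.1.1,
      mem_powerset.2 (filter_subset_filter _ h.1.2)⟩)
  · rintro ⟨x, y⟩ h ⟨x', y'⟩ h' heq
    simp only [agreeingPairs, coe_filter, mem_product, mem_powerset, Set.mem_ofPred_eq] at h h'
    simp only [Prod.mk.injEq] at heq ⊢
    obtain ⟨rfl, h3⟩ := heq
    refine ⟨rfl, ?_⟩
    have e : ∀ z : Finset α, z.filter (fun p => ¬ β p < j + 1) = z.filter fun p => j < β p :=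
      fun z => filter_congr fun p _ => by omega
    rw [← filter_union_filter_not_eq (fun p => β p < j + 1) y, h3, e, ← h.2, h'.2, ← e,
      filter_union_filter_not_eq]

/-- For a fixed pair of subsets the shift prescribes the degree of `p`, so only elements of one
degree contribute. -/
lemma sum_mul_card_shiftedPairs_le {w : α → ℝ} (hw : ∀ p, 0 ≤ w p) (deg β : α → ℕ) {S : Finset α}
    {j : ℕ} {c : ℝ} (hc : ∀ m, ∑ p ∈ S.filter (fun p => deg p = m), w p ≤ c)
    (a : Finset α) :
    ∑ p ∈ S, w p * (#(shiftedPairs deg β j (deg p) a) : ℝ) ≤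
      c * (#(agreeingPairs β j a) : ℝ) := by
  have h1 : ∀ p, (#(shiftedPairs deg β j (deg p) a) : ℝ) = ∑ x ∈ agreeingPairs β j a,
      if deg p + ∑ p ∈ x.1, deg p = ∑ p ∈ x.2, deg p then (1 : ℝ) else 0 := by
    intro p
    rw [← sum_filter, sum_const, nsmul_eq_mul, mul_one]
    congr 2
    ext x
    simp only [shiftedPairs, agreeingPairs, mem_filter]
    tauto
  simp_rw [h1, mul_sum]
  rw [sum_comm, mul_comm c, ← nsmul_eq_mul]
  refine sum_le_card_nsmul _ _ _ fun x _ => ?_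
  -- Truncated subtraction is harmless here: whenever the equation holds, this difference equals
  -- `deg p`.
  refine le_trans ?_ (hc (∑ p ∈ x.2, deg p - ∑ p ∈ x.1, deg p))
  rw [sum_filter]
  refine sum_le_sum fun p _ => ?_
  have := hw p
  split_ifs with h2 h3 h3
  · simp
  · omega
  · simpa using this
  · simp

/-- `∏ (1 - 2 ^ (-(j + 2))) ≥ 1 / 2`. -/
lemma half_le_prod (N : ℕ) : (1 : ℝ) / 2 ≤ ∏ j ∈ range N, (1 - (1 / 2) ^ (j + 2)) := by
  -- The extra term `(1 / 2) ^ (N + 1)` is what makes the induction close.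
  have h : (1 : ℝ) / 2 + (1 / 2) ^ (N + 1) ≤ ∏ j ∈ range N, (1 - (1 / 2 : ℝ) ^ (j + 2)) := by
    induction N with
    | zero => norm_num
    | succ N ih =>
      rw [prod_range_succ]
      have h0 : (0 : ℝ) < (1 / 2) ^ (N + 1) := by positivity
      have h1 : ((1 : ℝ) / 2) ^ (N + 1) ≤ 1 / 2 := by
        calc ((1 : ℝ) / 2) ^ (N + 1) ≤ (1 / 2) ^ 1 :=
              pow_le_pow_of_le_one (by norm_num) (by norm_num) (by omega)
          _ = 1 / 2 := by norm_num
      have h2 : (0 : ℝ) ≤ 1 - (1 / 2) ^ (N + 2) := by rw [pow_succ]; linarith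
      refine le_trans ?_ (mul_le_mul_of_nonneg_right ih h2)
      rw [pow_succ _ (N + 1)] at *
      nlinarith
  have : (0 : ℝ) < (1 / 2) ^ (N + 1) := by positivity
  linarith

lemma blocks_eq_self {P : Finset α} {β : α → ℕ} {J : ℕ} (hP : ∀ p ∈ P, β p < J) :
    blocks P β 0 (0 + J) = P := by
  ext p; rw [mem_blocks]
  exact ⟨fun h => h.1, fun h => ⟨h, by omega, by have := hP p h; omega⟩⟩

lemma sum_eq_sum_blocks {P : Finset α} {β : α → ℕ} {J : ℕ} (hP : ∀ p ∈ P, β p < J) (f : α → ℝ) :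
    ∑ p ∈ P, f p = ∑ j ∈ range J, ∑ p ∈ blocks P β j (j + 1), f p := by
  rw [← sum_fiberwise_of_maps_to (t := range J) (g := β) fun p hp => mem_range.2 (hP p hp)]
  refine sum_congr rfl fun j _ => sum_congr ?_ fun _ _ => rfl
  ext p; rw [mem_filter, mem_blocks]
  constructor
  · rintro ⟨h1, h2⟩; exact ⟨h1, by omega, by omega⟩
  · rintro ⟨h1, h2⟩; exact ⟨h1, by omega⟩

/-- The diagonal pairs give `2 ^ #a`. Pairs whose highest difference lies in block `j` give at most
`2 ^ #a * 2 ^ (-z)` up to a constant, where `z` is the height after that block. Since the walk stays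
positive, the sum over `z` converges and the sum over `j` is a convolution of decays. So the
off-diagonal part has the order of the diagonal. -/
lemma exists_sum_equalPairs_le : ∃ C : ℝ, 0 < C ∧
    ∀ (α : Type*) [DecidableEq α] (w : α → ℝ) (deg β : α → ℕ) (P : Finset α) (J : ℕ), 2 ≤ J →
    (∀ p, 0 ≤ w p) → (∀ p ∈ P, β p < J) →
    (∀ i < J, ∑ p ∈ blocks P β i (i + 1), w p ≤ Real.log 2) →
    (∀ i < J, ∀ m, ∑ p ∈ (blocks P β i (i + 1)).filter (fun p => deg p = m), w p ≤
      (1 / 2) ^ i) →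
    ∑ a ∈ pathSets P β 0 J 0 1, (∏ p ∈ a, w p) * (#(equalPairs deg a) : ℝ) ≤
      C * (2 ^ J * (Real.log 2 ^ (J - 1) * Real.exp J * decay J)) := by
  obtain ⟨C, hC, hC'⟩ := exists_sum_pow_mul_geometric_le 3 (t := 1 / 2) (by norm_num) (by norm_num)
  refine ⟨1 + 2 * (2 * 16 * Real.exp 1 * C * 24) / Real.log 2,
    by have := log_two_pos; positivity, ?_⟩
  intro α _ w deg β P J hJ hw hβ hl hm
  set l := Real.log 2 with hldef
  have hl0 : 0 < l := log_two_pos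
  have hd := decay_nonneg J
  have hw' : ∀ a : Finset α, 0 ≤ ∏ p ∈ a, w p := fun a => prod_nonneg fun p _ => hw p
  have hdiag : ∑ a ∈ pathSets P β 0 J 0 1, (∏ p ∈ a, w p) * (2 : ℝ) ^ #a ≤
      2 ^ J * (l ^ (J - 1) * Real.exp J * decay J) := by
    have h1 : ∑ a ∈ pathSets P β 0 J 0 1, ∏ p ∈ a, w p ≤ l ^ (0 + J - 1) * walk J 0 1 :=
      sum_pathSets_le hw (fun j _ hj => hl j (by omega)) hl0.le 0 1
    rw [zero_add] at h1
    have h2 := walk_zero_le (N := J) (x := 1) (by omega)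
    calc ∑ a ∈ pathSets P β 0 J 0 1, (∏ p ∈ a, w p) * (2 : ℝ) ^ #a
        ≤ ∑ a ∈ pathSets P β 0 J 0 1, (∏ p ∈ a, w p) * (2 : ℝ) ^ J := by
          refine sum_le_sum fun a ha => mul_le_mul_of_nonneg_left ?_ (hw' a)
          have := (mem_pathSets.1 ha).2.2
          exact pow_le_pow_right₀ (by norm_num) (by omega)
      _ = 2 ^ J * ∑ a ∈ pathSets P β 0 J 0 1, ∏ p ∈ a, w p := by rw [← sum_mul, mul_comm]
      _ ≤ 2 ^ J * (l ^ (J - 1) * walk J 0 1) := by gcongr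
      _ ≤ 2 ^ J * (l ^ (J - 1) * ((1 : ℕ) * Real.exp J * decay J)) := by gcongr
      _ = _ := by push_cast; ring
  have hoff : ∑ a ∈ pathSets P β 0 J 0 1, (∏ p ∈ a, w p) *
      ∑ p ∈ a, (#(shiftedPairs deg β (β p) (deg p) (a.erase p)) : ℝ) ≤
      2 * 16 * Real.exp 1 * C * 24 * (2 ^ J * (l ^ (J - 2) * Real.exp J * decay J)) := by
    refine (sum_sum_erase_le hw
      (X := fun p a => (#(shiftedPairs deg β (β p) (deg p) a) : ℝ)) (fun p a => by positivity)
      (P := P) (𝒟 := pathSets P β 0 J 0 2)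
      (fun a ha => by have := (mem_pathSets.1 ha).1; rwa [blocks_eq_self hβ] at this)
      (fun a ha p hp => erase_mem_pathSets ha hp)).trans ?_
    have h1 : ∀ a ∈ pathSets P β 0 J 0 2, (∏ p ∈ a, w p) *
        ∑ p ∈ P, w p * (#(shiftedPairs deg β (β p) (deg p) a) : ℝ) ≤
        ∑ j ∈ range J, 2 ^ J * ((∏ p ∈ a, w p) *
          (2 * (1 / 2) ^ (0 + (j + 1) - #(a.filter fun p => β p < 0 + (j + 1))))) := by
      intro a ha
      rw [sum_eq_sum_blocks hβ, mul_sum]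
      refine sum_le_sum fun j hj => ?_
      have hj' := mem_range.1 hj
      obtain ⟨-, ha2, ha3⟩ := mem_pathSets.1 ha
      have h2 : ∑ p ∈ blocks P β j (j + 1), w p * (#(shiftedPairs deg β (β p) (deg p) a) : ℝ) =
          ∑ p ∈ blocks P β j (j + 1), w p * (#(shiftedPairs deg β j (deg p) a) : ℝ) := by
        refine sum_congr rfl fun p hp => ?_
        have := mem_blocks.1 hp
        rw [show β p = j by omega]
      rw [h2, mul_left_comm]
      refine mul_le_mul_of_nonneg_left ?_ (hw' a)
      refine (sum_mul_card_shiftedPairs_le hw deg β (hm j hj') a).trans ?_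
      have h3 : (#(agreeingPairs β j a) : ℝ) ≤ 2 ^ #a * 2 ^ #(a.filter fun p => β p < j + 1) := by
        exact_mod_cast card_agreeingPairs_le β j a
      have h4 := ha2 (j + 1) (by omega) (by omega)
      rw [zero_add] at h4 ⊢
      set A := #(a.filter fun p => β p < j + 1) with hA
      have h5 : (2 : ℝ) ^ #a ≤ 2 ^ J := pow_le_pow_right₀ (by norm_num) (by omega)
      -- The weight `2 ^ (-j)` of one degree in block `j`, times `2 ^ A` choices for the lower part
      -- of the second subset, is `2` times `2` to minus the height `j + 1 - A`.
      have h6 : ((1 : ℝ) / 2) ^ j * 2 ^ A = 2 * (1 / 2) ^ (j + 1 - A) := by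
        have e : j = (j + 1 - A - 1) + A := by omega
        have e' : j + 1 - A = (j + 1 - A - 1) + 1 := by omega
        rw [e']
        conv_lhs => rw [e]
        rw [pow_add, pow_succ, mul_assoc, ← mul_pow]
        norm_num
        ring
      calc ((1 : ℝ) / 2) ^ j * (#(agreeingPairs β j a) : ℝ)
          ≤ (1 / 2) ^ j * (2 ^ J * 2 ^ A) := by
            refine mul_le_mul_of_nonneg_left (h3.trans ?_) (by positivity)
            gcongr
        _ = 2 ^ J * ((1 / 2) ^ j * 2 ^ A) := by ring
        _ = _ := by rw [h6]
    refine (sum_le_sum h1).trans ?_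
    rw [sum_comm]
    have h2 : ∀ j ∈ range J, ∑ a ∈ pathSets P β 0 J 0 2, (2 : ℝ) ^ J * ((∏ p ∈ a, w p) *
          (2 * (1 / 2) ^ (0 + (j + 1) - #(a.filter fun p => β p < 0 + (j + 1))))) ≤
        2 * 16 * Real.exp 1 * C * (2 ^ J * (l ^ (J - 2) * Real.exp J)) *
          (decay (j + 1 + 1) * decay (J - (j + 1) + 1)) := by
      intro j hj
      have hj' := mem_range.1 hj
      have hd1 := decay_nonneg (j + 1 + 1)
      have hd2 := decay_nonneg (J - (j + 1) + 1)
      have h3 := sum_pathSets_add w (fun z => 2 * (1 / 2 : ℝ) ^ z) P β 0 (j + 1) (J - (j + 1)) 0 2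
      rw [show j + 1 + (J - (j + 1)) = J by omega] at h3
      rw [← mul_sum, h3]
      have h4 : ∀ z ∈ range (0 + (j + 1) + 1),
          2 * (1 / 2 : ℝ) ^ z * (∑ a ∈ pathSets P β 0 (j + 1) 0 z, ∏ p ∈ a, w p) *
            ∑ a ∈ pathSets P β (0 + (j + 1)) (J - (j + 1)) z 2, ∏ p ∈ a, w p ≤
          (2 * 16 * Real.exp 1 * (l ^ (J - 2) * Real.exp J) *
            (decay (j + 1 + 1) * decay (J - (j + 1) + 1))) *
            (((z : ℝ) + 1) ^ 3 * (1 / 2) ^ z) := by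
        intro z hz
        have hz' := mem_range.1 hz
        rcases Nat.eq_zero_or_pos z with rfl | hz0
        · rw [pathSets_succ_zero]
          simp only [sum_empty, mul_zero, zero_mul]
          positivity
        have e1 := sum_pathSets_le (i := 0) (N := j + 1) (P := P) (β := β) hw
          (fun i _ hi => hl i (by omega)) hl0.le 0 z
        have e2 := sum_pathSets_le (i := 0 + (j + 1)) (N := J - (j + 1)) (P := P) (β := β) hw
          (fun i _ hi => hl i (by omega)) hl0.le z 2
        rcases Nat.lt_or_ge (z + (J - (j + 1))) 2 with h5 | h5
        · rw [walk_eq_zero h5, mul_zero] at e2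
          have e3 := le_antisymm e2 (sum_nonneg fun a _ => hw' a)
          rw [e3, mul_zero]
          positivity
        · have e3 := walk_zero_le' (j + 1) z
          have e4 := walk_le (N := J - (j + 1)) (r := z) (y := 2) hz0
          have e5 : l ^ (0 + (j + 1) - z) * l ^ (z + (J - (j + 1)) - 2) = l ^ (J - 2) := by
            rw [← pow_add]; congr 1; omega
          have e6 : Real.exp ((j + 1 : ℕ) : ℝ) * Real.exp ((J - (j + 1) : ℕ) : ℝ) =
              Real.exp J := by
            rw [← Real.exp_add, ← Nat.cast_add]; congr 2; omega
          have e7 : ((z : ℝ) + 1) * (z : ℝ) ^ 2 ≤ ((z : ℝ) + 1) ^ 3 := by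
            have : (0 : ℝ) ≤ z := by positivity
            nlinarith
          have hW1 := walk_nonneg (j + 1) 0 z
          have hW2 := walk_nonneg (J - (j + 1)) z 2
          calc 2 * (1 / 2 : ℝ) ^ z * (∑ a ∈ pathSets P β 0 (j + 1) 0 z, ∏ p ∈ a, w p) *
                ∑ a ∈ pathSets P β (0 + (j + 1)) (J - (j + 1)) z 2, ∏ p ∈ a, w p
              ≤ 2 * (1 / 2 : ℝ) ^ z * (l ^ (0 + (j + 1) - z) * walk (j + 1) 0 z) *
                (l ^ (z + (J - (j + 1)) - 2) * walk (J - (j + 1)) z 2) := by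
                refine mul_le_mul (mul_le_mul_of_nonneg_left e1 (by positivity)) e2
                  (sum_nonneg fun a _ => hw' a) (by positivity)
            _ = 2 * (1 / 2 : ℝ) ^ z * l ^ (J - 2) *
                (walk (j + 1) 0 z * walk (J - (j + 1)) z 2) := by rw [← e5]; ring
            _ ≤ 2 * (1 / 2 : ℝ) ^ z * l ^ (J - 2) *
                ((4 * (z + 1) * Real.exp ((j + 1 : ℕ) : ℝ) * decay (j + 1 + 1)) *
                (2 * Real.exp 1 * (2 : ℕ) * (z : ℝ) ^ 2 * Real.exp ((J - (j + 1) : ℕ) : ℝ) *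
                  decay (J - (j + 1) + 1))) := by gcongr
            _ = 2 * 16 * Real.exp 1 * (l ^ (J - 2) * Real.exp J) *
                (decay (j + 1 + 1) * decay (J - (j + 1) + 1)) *
                ((((z : ℝ) + 1) * (z : ℝ) ^ 2) * (1 / 2) ^ z) := by
                rw [← e6]; push_cast; ring
            _ ≤ _ := by gcongr
      refine (mul_le_mul_of_nonneg_left (sum_le_sum h4) (by positivity)).trans ?_
      rw [← mul_sum]
      refine (mul_le_mul_of_nonneg_left (mul_le_mul_of_nonneg_left (hC' _)
        (by positivity)) (by positivity)).trans (le_of_eq ?_)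
      ring
    refine (sum_le_sum h2).trans ?_
    rw [← mul_sum]
    have h3 : ∑ j ∈ range J, decay (j + 1 + 1) * decay (J - (j + 1) + 1) ≤ 24 * decay J := by
      have h4 := sum_decay_mul_decay_le J
      rw [sum_range_succ'] at h4
      have h5 := mul_nonneg (decay_nonneg (0 + 1)) (decay_nonneg (J - 0 + 1))
      have h6 : decay (J + 1) ≤ decay J := decay_anti (by omega) (by omega)
      linarith
    refine (mul_le_mul_of_nonneg_left h3 (by positivity)).trans (le_of_eq ?_)
    ring
  have hsum : ∑ a ∈ pathSets P β 0 J 0 1, (∏ p ∈ a, w p) * (#(equalPairs deg a) : ℝ) ≤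
      ∑ a ∈ pathSets P β 0 J 0 1, (∏ p ∈ a, w p) * (2 : ℝ) ^ #a +
      2 * ∑ a ∈ pathSets P β 0 J 0 1, (∏ p ∈ a, w p) *
        ∑ p ∈ a, (#(shiftedPairs deg β (β p) (deg p) (a.erase p)) : ℝ) := by
    rw [mul_sum, ← sum_add_distrib]
    refine sum_le_sum fun a _ => ?_
    have h1 : (#(equalPairs deg a) : ℝ) ≤ 2 ^ #a +
        2 * ∑ p ∈ a, (#(shiftedPairs deg β (β p) (deg p) (a.erase p)) : ℝ) := by
      exact_mod_cast card_equalPairs_le deg β a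
    refine (mul_le_mul_of_nonneg_left h1 (hw' a)).trans (le_of_eq ?_)
    ring
  refine hsum.trans ((add_le_add hdiag (mul_le_mul_of_nonneg_left hoff (by norm_num))).trans
    (le_of_eq ?_))
  have e : l ^ (J - 1) = l ^ (J - 2) * l := by
    rw [← pow_succ]; congr 1; omega
  rw [e]
  field_simp

/-- Only sets with walk from `0` to `1` are kept; they have `J - 1` elements. Their mass is bounded
below by the ballot formula, those of large degree are discarded by Markov's inequality, and the
second moment shows that `L(a)` has order `2 ^ J` on average over the rest. The condition on `e`
makes the loss in block `j` at most `2 ^ (-(j + 2))`, so that the product of the losses stays above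
`1 / 2`. -/
lemma exists_le_sum_card_subsums : ∃ c K : ℝ, 0 < c ∧ 0 < K ∧
    ∀ (α : Type*) [DecidableEq α] (w : α → ℝ) (deg β : α → ℕ) (P : Finset α) (J : ℕ) (D : ℝ)
    (e : ℕ → ℝ), 2 ≤ J → 0 < D → (∀ p, 0 ≤ w p) → (∀ p ∈ P, β p < J) →
    (∀ i < J, ∑ p ∈ blocks P β i (i + 1), w p = Real.log 2) →
    (∀ i < J, ∀ m, ∑ p ∈ (blocks P β i (i + 1)).filter (fun p => deg p = m), w p ≤
      (1 / 2) ^ i) →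
    (∀ p ∈ P, (deg p : ℝ) ≤ D * 2 ^ β p) → (∀ p ∈ P, w p ≤ e (β p)) →
    (∀ i, 0 ≤ e i) → (∀ i : ℕ, ((i : ℝ) + 1) ^ 2 * e i ≤ (1 / 2) ^ (i + 2) * Real.log 2) →
    c * (rate ^ J * decay J) ≤
      ∑ a ∈ P.powerset.filter (fun a => ∑ p ∈ a, (deg p : ℝ) ≤ K * D * 2 ^ J),
        (∏ p ∈ a, w p) * (#(subsums deg a) : ℝ) := by
  obtain ⟨C, hC, hC'⟩ := exists_sum_equalPairs_le
  have hl0 : 0 < Real.log 2 := log_two_pos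
  have he0 : 0 < Real.exp 1 := Real.exp_pos 1
  set c₁ := 1 / (8 * Real.exp 1) with hc₁
  refine ⟨c₁ ^ 2 / (C * (2 * Real.log 2)) / 2, 8 * Real.exp 1, by positivity, by positivity, ?_⟩
  intro α _ w deg β P J D e hJ hD hw hβ hl hm hdeg hwe hen he
  set l := Real.log 2 with hldef
  have hw' : ∀ a : Finset α, 0 ≤ ∏ p ∈ a, w p := fun a => prod_nonneg fun p _ => hw p
  have hdJ : 0 < decay J := decay_pos (by omega)
  set X := l ^ (J - 1) * Real.exp J * decay J with hX
  have hX0 : 0 < X := by positivity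
  set T := 8 * Real.exp 1 * D * 2 ^ J with hT
  have hT0 : 0 < T := by positivity
  have hmass : X / (2 * Real.exp 1) ≤ ∑ a ∈ pathSets P β 0 J 0 1, ∏ p ∈ a, w p := by
    have h1 := le_sum_pathSets (N := J) (P := P) (β := β) (l := l)
      (c := fun j => 1 - (1 / 2 : ℝ) ^ (j + 2)) hw
      (fun j _ => sub_nonneg.2 (pow_le_one₀ (by norm_num) (by norm_num)))
      -- The hypothesis on `e` is stated for `j + 1`, the largest number of elements that a positive
      -- walk allows in block `j`.
      (fun j hj b hb => by
        have hb' : (b : ℝ) ≤ j + 1 := by exact_mod_cast hb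
        have h2 : (b : ℝ) ^ 2 * e j ≤ (1 / 2) ^ (j + 2) * l := by
          refine le_trans (mul_le_mul_of_nonneg_right ?_ (hen j)) (he j)
          gcongr
        have h3 : ((1 : ℝ) / 2) ^ (j + 2) ≤ 1 := pow_le_one₀ (by norm_num) (by norm_num)
        refine le_trans ?_ (le_sum_powersetCard (e := e j) hw hl0 (hl j hj).ge
          (fun p hp => ?_) b ?_ (hen j))
        · refine mul_le_mul_of_nonneg_right ?_ (by positivity)
          rw [sub_le_sub_iff_left, div_le_iff₀ hl0]
          exact h2
        · obtain ⟨h4, h5, h6⟩ := mem_blocks.1 hp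
          have := hwe p h4
          rwa [show β p = j by omega] at this
        · nlinarith) hl0.le 1
    refine le_trans ?_ h1
    have h2 := le_walk_one (N := J) (by omega)
    calc X / (2 * Real.exp 1) = 1 / 2 * (l ^ (J - 1) * (Real.exp J * decay J / Real.exp 1)) := by
          rw [hX]; field_simp
      _ ≤ (∏ j ∈ range J, (1 - (1 / 2 : ℝ) ^ (j + 2))) * (l ^ (J - 1) * walk J 0 1) := by
          have hp := half_le_prod J
          exact mul_le_mul hp (mul_le_mul_of_nonneg_left h2 (by positivity)) (by positivity)
            (by linarith)
  have hdegsum : ∑ a ∈ pathSets P β 0 J 0 1, (∏ p ∈ a, w p) * ∑ p ∈ a, (deg p : ℝ) ≤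
      D * 2 ^ J * (2 * X) := by
    have h1 := sum_sum_mem_le hw (g := fun p => (deg p : ℝ)) (fun p => by positivity)
      (X := fun _ => 1) (fun _ => zero_le_one) (P := P)
      (𝒞 := pathSets P β 0 J 0 1) (𝒟 := pathSets P β 0 J 0 2)
      (fun a ha => by have := (mem_pathSets.1 ha).1; rwa [blocks_eq_self hβ] at this)
      (fun a ha p hp => erase_mem_pathSets ha hp)
    simp only [mul_one] at h1
    have h2 : ∑ p ∈ P, (deg p : ℝ) * w p ≤ D * 2 ^ J * l := by
      rw [sum_eq_sum_blocks hβ]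
      have h3 : ∀ j ∈ range J, ∑ p ∈ blocks P β j (j + 1), (deg p : ℝ) * w p ≤
          D * l * 2 ^ j := by
        intro j hj
        rw [show D * l * 2 ^ j = D * 2 ^ j * l by ring, ← hl j (mem_range.1 hj), mul_sum]
        refine sum_le_sum fun p hp => mul_le_mul_of_nonneg_right ?_ (hw p)
        obtain ⟨h4, h5, h6⟩ := mem_blocks.1 hp
        have := hdeg p h4
        rwa [show β p = j by omega] at this
      refine (sum_le_sum h3).trans ?_
      rw [← mul_sum]
      have h4 : ∑ j ∈ range J, (2 : ℝ) ^ j ≤ 2 ^ J := by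
        have := geom_sum_eq (x := (2 : ℝ)) (by norm_num) J
        rw [this]; norm_num
      calc D * l * ∑ j ∈ range J, (2 : ℝ) ^ j ≤ D * l * 2 ^ J := by gcongr
        _ = _ := by ring
    have h3 : ∑ a ∈ pathSets P β 0 J 0 2, ∏ p ∈ a, w p ≤ l ^ (0 + J - 2) * walk J 0 2 :=
      sum_pathSets_le hw (fun j _ hj => (hl j (by omega)).le) hl0.le 0 2
    have h4 := walk_zero_le (N := J) (x := 2) (by omega)
    refine h1.trans ((mul_le_mul h2 (h3.trans (mul_le_mul_of_nonneg_left h4 (by positivity)))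
      (sum_nonneg fun a _ => hw' a) (by positivity)).trans (le_of_eq ?_))
    rw [hX, show l ^ (J - 1) = l ^ (0 + J - 2) * l by rw [← pow_succ]; congr 1; omega]
    push_cast
    ring
  set 𝒜 := (pathSets P β 0 J 0 1).filter fun a => ∑ p ∈ a, (deg p : ℝ) ≤ T with h𝒜
  -- With threshold `8 e D 2 ^ J`, Markov discards at most `X / (4 e)`, half of the guaranteed mass
  -- `X / (2 e)`.
  have hgood : c₁ * X * 2 ≤ ∑ a ∈ 𝒜, ∏ p ∈ a, w p := by
    have h1 := sum_filter_add_sum_filter_not (pathSets P β 0 J 0 1)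
      (fun a => ∑ p ∈ a, (deg p : ℝ) ≤ T) (fun a => ∏ p ∈ a, w p)
    have h2 : T * ∑ a ∈ (pathSets P β 0 J 0 1).filter (fun a => ¬ ∑ p ∈ a, (deg p : ℝ) ≤ T),
        ∏ p ∈ a, w p ≤ D * 2 ^ J * (2 * X) := by
      refine le_trans ?_ hdegsum
      rw [mul_sum]
      refine le_trans (sum_le_sum fun a ha => ?_) (sum_le_sum_of_subset_of_nonneg
        (filter_subset _ _) fun a _ _ => mul_nonneg (hw' a) (sum_nonneg fun p _ => by positivity))
      have := (mem_filter.1 ha).2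
      rw [mul_comm]
      exact mul_le_mul_of_nonneg_left (not_le.1 this).le (hw' a)
    have h3 : ∑ a ∈ (pathSets P β 0 J 0 1).filter (fun a => ¬ ∑ p ∈ a, (deg p : ℝ) ≤ T),
        ∏ p ∈ a, w p ≤ X / (4 * Real.exp 1) := by
      refine le_of_mul_le_mul_left (h2.trans (le_of_eq ?_)) hT0
      rw [hT]; field_simp; ring
    have h4 : c₁ * X * 2 = X / (2 * Real.exp 1) - X / (4 * Real.exp 1) := by
      rw [hc₁]; field_simp; ring
    linarith
  have hsecond := hC' α w deg β P J hJ hw hβ (fun i hi => (hl i hi).le) hm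
  rw [← hX] at hsecond
  -- Small enough that the quadratic term `t ^ 2 * C` takes only a quarter of the linear term `2 *
  -- c₁ * t`.
  set t := c₁ / (2 * C) with ht
  have ht0 : 0 < t := by positivity
  -- By AM-GM, `L * E ≥ Y ^ 2` gives `L + t ^ 2 E ≥ 2 t Y`, where `2 Y = 2 ^ J`. This form of
  -- Cauchy-Schwarz is linear in `E` and can therefore be summed over `a`.
  have hpt : ∀ a ∈ 𝒜, (∏ p ∈ a, w p) * (t * 2 ^ J - t ^ 2 * (#(equalPairs deg a) : ℝ)) ≤
      (∏ p ∈ a, w p) * (#(subsums deg a) : ℝ) := by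
    intro a ha
    refine mul_le_mul_of_nonneg_left ?_ (hw' a)
    have h1 : ((2 : ℝ) ^ #a) ^ 2 ≤ (#(subsums deg a) : ℝ) * (#(equalPairs deg a) : ℝ) := by
      exact_mod_cast two_pow_sq_le deg a
    have h2 : #a + 1 = J := by
      have := (mem_pathSets.1 (mem_filter.1 ha).1).2.2
      omega
    have h3 : (2 : ℝ) ^ J = 2 * 2 ^ #a := by rw [← h2, pow_succ]; ring
    rw [h3]
    have hL : (0 : ℝ) ≤ (#(subsums deg a) : ℝ) := by positivity
    have hE : (0 : ℝ) ≤ (#(equalPairs deg a) : ℝ) := by positivity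
    set L := (#(subsums deg a) : ℝ)
    set E := (#(equalPairs deg a) : ℝ)
    set Y := (2 : ℝ) ^ #a with hY
    have hY0 : 0 < Y := by positivity
    by_contra hlt
    push Not at hlt
    have h4 : 0 ≤ L + t ^ 2 * E := by positivity
    have h5 : (L + t ^ 2 * E) ^ 2 < (t * (2 * Y)) ^ 2 := by
      apply pow_lt_pow_left₀ (by linarith) h4 (by norm_num)
    nlinarith [sq_nonneg (L - t ^ 2 * E), mul_le_mul_of_nonneg_left h1 (sq_nonneg t)]
  have hsub : 𝒜 ⊆ P.powerset.filter (fun a => ∑ p ∈ a, (deg p : ℝ) ≤ T) := by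
    intro a ha
    obtain ⟨h1, h2⟩ := mem_filter.1 ha
    have h3 := (mem_pathSets.1 h1).1
    rw [blocks_eq_self hβ] at h3
    exact mem_filter.2 ⟨mem_powerset.2 h3, h2⟩
  refine le_trans ?_ (sum_le_sum_of_subset_of_nonneg hsub
    fun a _ _ => mul_nonneg (hw' a) (by positivity))
  refine le_trans ?_ (sum_le_sum hpt)
  have h6 : ∑ a ∈ 𝒜, (∏ p ∈ a, w p) * (t * 2 ^ J - t ^ 2 * (#(equalPairs deg a) : ℝ)) =
      t * 2 ^ J * ∑ a ∈ 𝒜, ∏ p ∈ a, w p -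
      t ^ 2 * ∑ a ∈ 𝒜, (∏ p ∈ a, w p) * (#(equalPairs deg a) : ℝ) := by
    rw [mul_sum, mul_sum, ← sum_sub_distrib]
    exact sum_congr rfl fun a _ => by ring
  rw [h6]
  have h7 : ∑ a ∈ 𝒜, (∏ p ∈ a, w p) * (#(equalPairs deg a) : ℝ) ≤ C * (2 ^ J * X) :=
    (sum_le_sum_of_subset_of_nonneg (filter_subset _ _)
      fun a _ _ => mul_nonneg (hw' a) (by positivity)).trans hsecond
  have h8 := mul_le_mul_of_nonneg_left h7 (sq_nonneg t)
  have h9 := mul_le_mul_of_nonneg_left hgood (show 0 ≤ t * 2 ^ J by positivity)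
  have h10 : rate ^ J * decay J = l * (2 ^ J * X) := by
    rw [hX, rate, mul_pow, mul_pow, ← Real.exp_nat_mul, mul_one, ← hldef,
      show l ^ J = l * l ^ (J - 1) by rw [← pow_succ']; congr 1; omega]
    ring
  rw [h10]
  have h11 : c₁ ^ 2 / (C * (2 * l)) / 2 * (l * (2 ^ J * X)) = c₁ ^ 2 / (4 * C) * (2 ^ J * X) := by
    field_simp; ring
  have h12 : t * 2 ^ J * (c₁ * X * 2) - t ^ 2 * (C * (2 ^ J * X)) =
      3 * (c₁ ^ 2 / (4 * C) * (2 ^ J * X)) := by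
    rw [ht]; field_simp; ring
  have h13 : 0 ≤ c₁ ^ 2 / (4 * C) * (2 ^ J * X) := by positivity
  rw [h11]
  linarith

end LowerSum

end PolyTable

namespace PolyTable
open Finset

section Counting

set_option linter.unusedSectionVars false

variable {F : Type*} [Field F] [Fintype F]

/-! ### Monic polynomials over a finite field -/

lemma finite_degreeLT (n : ℕ) : Finite (Polynomial.degreeLT F n) :=
  Finite.of_equiv _ (Polynomial.degreeLTEquiv F n).toEquiv.symm

lemma finite_monicOfDegree (n : ℕ) : (MonicOfDegree F n).Finite := by
  have := finite_degreeLT (F := F) n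
  have h : Finite (MonicOfDegree F n) :=
    Finite.of_equiv _ (Polynomial.monicEquivDegreeLT (R := F) n).symm
  exact Set.toFinite _

variable (F) in
/-- The finite set of monic polynomials of degree `n`. -/
noncomputable def monics (n : ℕ) : Finset F[X] := (finite_monicOfDegree (F := F) n).toFinset

lemma mem_monics {n : ℕ} {f : F[X]} : f ∈ monics F n ↔ f.Monic ∧ f.natDegree = n := by
  simp [monics, MonicOfDegree]

lemma card_monics (n : ℕ) : #(monics F n) = Fintype.card F ^ n := by
  have h1 : #(monics F n) = (MonicOfDegree F n).ncard :=
    (Set.ncard_eq_toFinset_card _ (finite_monicOfDegree n)).symm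
  rw [h1, ← Nat.card_coe_set_eq]
  have h2 : Nat.card (MonicOfDegree F n) = Nat.card (Polynomial.degreeLT F n) :=
    Nat.card_congr (Polynomial.monicEquivDegreeLT (R := F) n)
  rw [h2, Nat.card_congr (Polynomial.degreeLTEquiv F n).toEquiv, Nat.card_fun]
  simp [Nat.card_eq_fintype_card]

open Classical in
variable (F) in
/-- The monic irreducible polynomials of degree `n`. -/
noncomputable def irreds (n : ℕ) : Finset F[X] := (monics F n).filter Irreducible

lemma mem_irreds {n : ℕ} {f : F[X]} :
    f ∈ irreds F n ↔ f.Monic ∧ f.natDegree = n ∧ Irreducible f := by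
  simp [irreds, mem_monics, and_assoc]

open Classical in
variable (F) in
/-- The pairs `(P, i)` with `P` monic irreducible and `P ^ i` of degree `j`. -/
noncomputable def primePowers (j : ℕ) : Finset (F[X] × ℕ) :=
  (((Icc 1 j).biUnion fun d => irreds F d) ×ˢ Icc 1 j).filter fun x => x.2 * x.1.natDegree = j

lemma mem_primePowers {j : ℕ} {x : F[X] × ℕ} :
    x ∈ primePowers F j ↔
      x.1.Monic ∧ Irreducible x.1 ∧ 1 ≤ x.2 ∧ x.2 * x.1.natDegree = j := by
  simp only [primePowers, mem_filter, mem_product, mem_biUnion, mem_Icc, mem_irreds]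
  constructor
  · rintro ⟨⟨⟨d, _, h1, h2, h3⟩, h4, _⟩, h5⟩
    exact ⟨h1, h3, h4, h5⟩
  · rintro ⟨h1, h2, h3, h4⟩
    have h5 : 1 ≤ x.1.natDegree := h2.natDegree_pos
    refine ⟨⟨⟨x.1.natDegree, ⟨h5, ?_⟩, h1, rfl, h2⟩, h3, ?_⟩, h4⟩
    · rw [← h4]; exact Nat.le_mul_of_pos_left _ h3
    · rw [← h4]; exact Nat.le_mul_of_pos_right _ h5

open Classical in
/-- The degree of a monic polynomial is the sum of the degrees of the primes over the prime
powers dividing it. -/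
lemma sum_primePowers_dvd {t : ℕ} {f : F[X]} (hf : f ∈ monics F t) :
    ∑ j ∈ Icc 1 t, ∑ x ∈ primePowers F j,
      (if x.1 ^ x.2 ∣ f then (x.1.natDegree : ℝ) else 0) = t := by
  obtain ⟨hm, hd⟩ := mem_monics.1 hf
  have hf0 : f ≠ 0 := hm.ne_zero
  set s := UniqueFactorizationMonoid.normalizedFactors f with hs
  have hirr : ∀ P ∈ s, Irreducible P := fun P hP =>
    UniqueFactorizationMonoid.irreducible_of_normalized_factor P hP
  have hmon : ∀ P ∈ s, P.Monic := fun P hP => by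
    rw [← UniqueFactorizationMonoid.normalize_normalized_factor P hP]
    exact Polynomial.monic_normalize (hirr P hP).ne_zero
  have hprod : s.prod = f := by
    rw [hs, UniqueFactorizationMonoid.prod_normalizedFactors_eq hf0, hm.normalize_eq_self]
  have hdeg : ∑ P ∈ s.toFinset, s.count P * P.natDegree = t := by
    rw [← hd]
    conv_rhs => rw [← hprod]
    rw [Polynomial.natDegree_multiset_prod _ fun h => (hirr 0 h).ne_zero rfl,
      Finset.sum_multiset_map_count]
    simp
  have hpow : ∀ P : F[X], P.Monic → Irreducible P → ∀ i, P ^ i ∣ f ↔ i ≤ s.count P := by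
    intro P hP hPi i
    rw [pow_dvd_iff_le_emultiplicity,
      UniqueFactorizationMonoid.emultiplicity_eq_count_normalizedFactors hPi hf0,
      hP.normalize_eq_self]
    exact_mod_cast Iff.rfl
  -- Each prime contributes its degree once for every `i` up to its multiplicity.
  have hsum : ∑ j ∈ Icc 1 t, ∑ x ∈ primePowers F j,
      (if x.1 ^ x.2 ∣ f then x.1.natDegree else 0) =
      ∑ P ∈ s.toFinset, ∑ _i ∈ Icc 1 (s.count P), P.natDegree := by
    rw [sum_sigma', sum_sigma', ← sum_filter]
    refine sum_bij' (fun y _ => ⟨y.2.1, y.2.2⟩)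
      (fun y _ => ⟨y.2 * y.1.natDegree, (y.1, y.2)⟩) ?_ ?_ ?_ ?_ ?_
    · rintro ⟨j, P, i⟩ h
      simp only [mem_filter, mem_sigma, mem_primePowers, mem_Icc] at h
      obtain ⟨⟨_, h1, h2, h3, _⟩, h4⟩ := h
      have h5 := (hpow P h1 h2 i).1 h4
      simp only [mem_sigma, Multiset.mem_toFinset, mem_Icc]
      exact ⟨Multiset.count_pos.1 (by omega), h3, h5⟩
    · rintro ⟨P, i⟩ h
      simp only [mem_sigma, Multiset.mem_toFinset, mem_Icc] at h
      obtain ⟨h1, h2, h3⟩ := h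
      have h4 : 1 ≤ P.natDegree := (hirr P h1).natDegree_pos
      simp only [mem_filter, mem_sigma, mem_primePowers, mem_Icc]
      refine ⟨⟨⟨Nat.mul_pos h2 h4, ?_⟩, hmon P h1, hirr P h1, h2, trivial⟩,
        (hpow P (hmon P h1) (hirr P h1) i).2 h3⟩
      rw [← hdeg]
      exact (Nat.mul_le_mul_right _ h3).trans (single_le_sum
        (f := fun P => s.count P * P.natDegree) (fun _ _ => Nat.zero_le _)
        (Multiset.mem_toFinset.2 h1))
    · rintro ⟨j, P, i⟩ h
      simp only [mem_filter, mem_sigma, mem_primePowers, mem_Icc] at h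
      obtain ⟨⟨_, h1, h2, h3, rfl⟩, h4⟩ := h
      rfl
    · rintro ⟨P, i⟩ h
      rfl
    · rintro ⟨j, P, i⟩ h
      rfl
  have hfin : ∑ P ∈ s.toFinset, ∑ _i ∈ Icc 1 (s.count P), P.natDegree = t := by
    rw [← hdeg]
    exact sum_congr rfl fun P _ => by simp
  rw [hfin] at hsum
  exact_mod_cast hsum

open Classical in
lemma sum_monics_dvd {t j : ℕ} (hj : j ≤ t) (φ : F[X] → ℝ) {Q : F[X]} (hQ : Q.Monic)
    (hd : Q.natDegree = j) :
    ∑ f ∈ monics F t, (if Q ∣ f then φ f else 0) = ∑ g ∈ monics F (t - j), φ (g * Q) := by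
  rw [← sum_filter]
  symm
  refine sum_bij (fun g _ => g * Q) ?_ ?_ ?_ ?_
  · intro g hg
    obtain ⟨h1, h2⟩ := mem_monics.1 hg
    rw [mem_filter, mem_monics]
    exact ⟨⟨h1.mul hQ, by rw [h1.natDegree_mul hQ]; omega⟩, Dvd.intro_left g rfl⟩
  · intro g _ g' _ h
    exact mul_right_cancel₀ hQ.ne_zero h
  · intro f hf
    rw [mem_filter, mem_monics] at hf
    obtain ⟨⟨h1, h2⟩, g, rfl⟩ := hf
    have hg : g.Monic := hQ.of_mul_monic_left h1
    refine ⟨g, mem_monics.2 ⟨hg, ?_⟩, mul_comm _ _⟩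
    rw [hQ.natDegree_mul hg] at h2
    omega
  · intro g _
    rfl

/-- The logarithmic derivative identity. -/
lemma mul_sum_monics (t : ℕ) (φ : F[X] → ℝ) :
    (t : ℝ) * ∑ f ∈ monics F t, φ f = ∑ j ∈ Icc 1 t, ∑ x ∈ primePowers F j,
      (x.1.natDegree : ℝ) * ∑ g ∈ monics F (t - j), φ (g * x.1 ^ x.2) := by
  classical
  have h1 : ∀ j ∈ Icc 1 t, ∀ x ∈ primePowers F j,
      (x.1.natDegree : ℝ) * ∑ g ∈ monics F (t - j), φ (g * x.1 ^ x.2) =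
      ∑ f ∈ monics F t, φ f * (if x.1 ^ x.2 ∣ f then (x.1.natDegree : ℝ) else 0) := by
    intro j hj x hx
    obtain ⟨h1, h2, h3, h4⟩ := mem_primePowers.1 hx
    rw [← sum_monics_dvd (mem_Icc.1 hj).2 φ (h1.pow x.2) (by rw [h1.natDegree_pow, h4]), mul_sum]
    refine sum_congr rfl fun f _ => ?_
    split_ifs <;> ring
  rw [sum_congr rfl fun j hj => sum_congr rfl (h1 j hj)]
  simp_rw [sum_comm (s := primePowers F _)]
  rw [sum_comm, mul_sum]
  refine sum_congr rfl fun f hf => ?_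
  simp_rw [← mul_sum]
  rw [sum_primePowers_dvd hf, mul_comm]

/-- The cardinality of the field, as a real number. -/
local notation "𝐪" => (Fintype.card F : ℝ)

lemma two_le_card : (2 : ℝ) ≤ 𝐪 := by
  have : 1 < Fintype.card F := Fintype.one_lt_card
  exact_mod_cast this

lemma card_pos : (0 : ℝ) < 𝐪 := by linarith [two_le_card (F := F)]

lemma card_monics_real (n : ℕ) : (#(monics F n) : ℝ) = 𝐪 ^ n := by
  rw [card_monics]; push_cast; rfl

/-- The identity with `φ = 1`, written for `t` and for `t + 1`: all terms except the last one at `t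
+ 1` agree up to a factor `q`. -/
lemma sum_primePowers (j : ℕ) (hj : 1 ≤ j) :
    ∑ x ∈ primePowers F j, (x.1.natDegree : ℝ) = 𝐪 ^ j := by
  have h : ∀ t : ℕ, (t : ℝ) * 𝐪 ^ t =
      ∑ j ∈ Icc 1 t, (∑ x ∈ primePowers F j, (x.1.natDegree : ℝ)) * 𝐪 ^ (t - j) := by
    intro t
    have := mul_sum_monics (F := F) t fun _ => 1
    simp only [sum_const, nsmul_eq_mul, mul_one, card_monics_real] at this
    rw [this]
    exact sum_congr rfl fun j _ => by rw [sum_mul]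
  obtain ⟨t, rfl⟩ : ∃ t, j = t + 1 := ⟨j - 1, by omega⟩
  have h1 := h (t + 1)
  rw [sum_Icc_succ_top (by omega), Nat.sub_self, pow_zero, mul_one] at h1
  have h2 : ∑ j ∈ Icc 1 t, (∑ x ∈ primePowers F j, (x.1.natDegree : ℝ)) * 𝐪 ^ (t + 1 - j) =
      𝐪 * ((t : ℝ) * 𝐪 ^ t) := by
    rw [h t, mul_sum]
    refine sum_congr rfl fun j hj => ?_
    have := (mem_Icc.1 hj).2
    rw [show t + 1 - j = (t - j) + 1 by omega, pow_succ]
    ring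
  rw [h2] at h1
  push_cast at h1
  rw [pow_succ] at h1 ⊢
  linarith

open Classical in
lemma sum_primePowers_one (j : ℕ) (ψ : F[X] → ℝ) :
    ∑ x ∈ (primePowers F j).filter (fun x => x.2 = 1), ψ x.1 = ∑ P ∈ irreds F j, ψ P := by
  refine sum_bij' (fun x _ => x.1) (fun P _ => (P, 1)) ?_ ?_ ?_ ?_ ?_
  · rintro ⟨P, i⟩ h
    simp only [mem_filter, mem_primePowers] at h
    obtain ⟨⟨h1, h2, h3, h4⟩, rfl⟩ := h
    exact mem_irreds.2 ⟨h1, by simpa using h4, h2⟩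
  · intro P h
    obtain ⟨h1, h2, h3⟩ := mem_irreds.1 h
    simp [mem_primePowers, h1, h2, h3]
  · rintro ⟨P, i⟩ h
    simp only [mem_filter] at h
    simp [h.2]
  · intro P _; rfl
  · intro x _; rfl

lemma card_irreds_le (j : ℕ) (hj : 1 ≤ j) : (j : ℝ) * (#(irreds F j) : ℝ) ≤ 𝐪 ^ j := by
  classical
  rw [← sum_primePowers j hj, mul_comm, ← nsmul_eq_mul, ← sum_const]
  have h := sum_primePowers_one (F := F) j fun P => (P.natDegree : ℝ)
  have h2 : ∑ P ∈ irreds F j, (P.natDegree : ℝ) = ∑ _P ∈ irreds F j, (j : ℝ) :=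
    sum_congr rfl fun P hP => by rw [(mem_irreds.1 hP).2.1]
  rw [← h2, ← h]
  exact sum_le_sum_of_subset_of_nonneg (filter_subset _ _) fun x _ _ => by positivity

lemma sum_pow_le (m : ℕ) : ∑ e ∈ Icc 1 m, 𝐪 ^ e ≤ 2 * 𝐪 ^ m := by
  induction m with
  | zero => simp
  | succ m ih =>
    rw [sum_Icc_succ_top (by omega)]
    have h2 := two_le_card (F := F)
    have h3 : (0 : ℝ) ≤ 𝐪 ^ m := by positivity
    rw [pow_succ]
    nlinarith

-- A prime power with exponent at least `2` has a base of degree at most `j / 2`, and the base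
-- determines the exponent.
open Classical in
lemma sum_primePowers_ne_one_le (j : ℕ) :
    ∑ x ∈ (primePowers F j).filter (fun x => x.2 ≠ 1), (x.1.natDegree : ℝ) ≤
      2 * 𝐪 ^ (j / 2) := by
  refine le_trans ?_ (sum_pow_le (j / 2))
  have h1 : ∀ e ∈ Icc 1 (j / 2), ∑ P ∈ irreds F e, (P.natDegree : ℝ) ≤ 𝐪 ^ e := by
    intro e he
    have h2 : ∑ P ∈ irreds F e, (P.natDegree : ℝ) = ∑ _P ∈ irreds F e, (e : ℝ) :=
      sum_congr rfl fun P hP => by rw [(mem_irreds.1 hP).2.1]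
    rw [h2, sum_const, nsmul_eq_mul, mul_comm]
    exact card_irreds_le e (mem_Icc.1 he).1
  refine le_trans ?_ (sum_le_sum h1)
  rw [sum_sigma']
  refine le_trans (le_of_eq ?_) (sum_le_sum_of_subset_of_nonneg
    (s := ((primePowers F j).filter fun x => x.2 ≠ 1).image
      fun x => (⟨x.1.natDegree, x.1⟩ : (_ : ℕ) × F[X])) ?_ fun x _ _ => by positivity)
  · rw [sum_image]
    rintro ⟨P, i⟩ h ⟨Q, k⟩ h' heq
    simp only [coe_filter, mem_primePowers, Set.mem_ofPred_eq] at h h'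
    simp only [Sigma.mk.injEq, heq_eq_eq] at heq
    obtain ⟨_, rfl⟩ := heq
    have hd : 0 < P.natDegree := h.1.2.1.natDegree_pos
    have : i = k := Nat.eq_of_mul_eq_mul_right hd (h.1.2.2.2.trans h'.1.2.2.2.symm)
    rw [this]
  · intro y hy
    obtain ⟨⟨P, i⟩, h, rfl⟩ := mem_image.1 hy
    simp only [mem_filter, mem_primePowers] at h
    obtain ⟨⟨h1, h2, h3, h4⟩, h5⟩ := h
    simp only [mem_sigma, mem_Icc, mem_irreds]
    refine ⟨⟨h2.natDegree_pos, ?_⟩, h1, trivial, h2⟩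
    rw [Nat.le_div_iff_mul_le (by norm_num), ← h4, mul_comm]
    exact Nat.mul_le_mul_right _ (by omega)

/-- `3 / 4` is a convenient rational base above `1 / √2`, uniform over all `q ≥ 2`. -/
lemma pow_half_le (j : ℕ) : 𝐪 ^ (j / 2) ≤ (3 / 4) ^ j * 𝐪 ^ j := by
  have hq := two_le_card (F := F)
  have hq0 := card_pos (F := F)
  have key : ∀ k : ℕ, 𝐪 ^ k ≤ (9 / 16 : ℝ) ^ k * 𝐪 ^ (2 * k) := by
    intro k
    rw [pow_mul, ← mul_pow]
    refine pow_le_pow_left₀ hq0.le ?_ k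
    nlinarith
  rcases Nat.even_or_odd' j with ⟨k, rfl | rfl⟩
  · rw [Nat.mul_div_cancel_left _ (by norm_num), pow_mul (3 / 4 : ℝ)]
    norm_num
    exact key k
  · rw [show (2 * k + 1) / 2 = k by omega, pow_succ, pow_succ 𝐪, pow_mul (3 / 4 : ℝ)]
    norm_num
    have h := key k
    have h0 : (0 : ℝ) ≤ (9 / 16 : ℝ) ^ k * 𝐪 ^ (2 * k) := by positivity
    nlinarith

lemma le_card_irreds (j : ℕ) (hj : 1 ≤ j) :
    𝐪 ^ j * (1 - 2 * (3 / 4) ^ j) ≤ (j : ℝ) * (#(irreds F j) : ℝ) := by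
  classical
  have h1 := sum_primePowers (F := F) j hj
  rw [← sum_filter_add_sum_filter_not _ (fun x => x.2 = 1),
    sum_primePowers_one j fun P => (P.natDegree : ℝ)] at h1
  have h2 : ∑ P ∈ irreds F j, (P.natDegree : ℝ) = ∑ _P ∈ irreds F j, (j : ℝ) :=
    sum_congr rfl fun P hP => by rw [(mem_irreds.1 hP).2.1]
  rw [h2, sum_const, nsmul_eq_mul] at h1
  have h3 := sum_primePowers_ne_one_le (F := F) j
  have h4 := pow_half_le (F := F) j
  nlinarith

/-! ### Polynomials without small prime factors -/

open Classical in
variable (F) in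
/-- The monic polynomials of degree `t` all of whose prime factors have degree at least `m`. -/
noncomputable def rough (m t : ℕ) : Finset F[X] :=
  (monics F t).filter fun f => ∀ P, P.Monic → Irreducible P → P ∣ f → m ≤ P.natDegree

lemma mem_rough {m t : ℕ} {f : F[X]} : f ∈ rough F m t ↔ (f.Monic ∧ f.natDegree = t) ∧
    ∀ P, P.Monic → Irreducible P → P ∣ f → m ≤ P.natDegree := by
  simp [rough, mem_monics]

/-- Strong induction with the logarithmic derivative identity. Only prime powers of degree `j ≥ m`
occur, and the cofactor is again rough. The degrees `m ≤ j < t` give `q ^ t / m` each and `j = t`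
gives `q ^ t`, together `t * q ^ t / m`. -/
lemma card_rough_le {m t : ℕ} (hm : 1 ≤ m) (ht : 1 ≤ t) :
    (m : ℝ) * (#(rough F m t) : ℝ) ≤ 𝐪 ^ t := by
  classical
  induction t using Nat.strong_induction_on with
  | _ t ih =>
    have hcard : ∀ s, (#(rough F m s) : ℝ) =
        ∑ f ∈ monics F s, if f ∈ rough F m s then (1 : ℝ) else 0 := by
      intro s
      rw [← sum_filter, sum_const, nsmul_eq_mul, mul_one]
      congr 2
      ext f
      simp only [mem_filter]
      exact ⟨fun h => ⟨mem_monics.2 (mem_rough.1 h).1, h⟩, fun h => h.2⟩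
    have hq0 := card_pos (F := F)
    have hm0 : (0 : ℝ) < m := by exact_mod_cast hm
    have ht0 : (0 : ℝ) < t := by exact_mod_cast ht
    have h1 := mul_sum_monics (F := F) t fun f => if f ∈ rough F m t then (1 : ℝ) else 0
    rw [← hcard] at h1
    have h2 : ∀ j ∈ Icc 1 t, ∑ x ∈ primePowers F j, (x.1.natDegree : ℝ) *
        ∑ g ∈ monics F (t - j), (if g * x.1 ^ x.2 ∈ rough F m t then (1 : ℝ) else 0) ≤
        if m ≤ j then 𝐪 ^ j * (#(rough F m (t - j)) : ℝ) else 0 := by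
      intro j hj
      obtain ⟨hj1, hj2⟩ := mem_Icc.1 hj
      have h3 : ∀ x ∈ primePowers F j, ∑ g ∈ monics F (t - j),
          (if g * x.1 ^ x.2 ∈ rough F m t then (1 : ℝ) else 0) ≤
          if m ≤ j then (#(rough F m (t - j)) : ℝ) else 0 := by
        intro x hx
        obtain ⟨p1, p2, p3, p4⟩ := mem_primePowers.1 hx
        split_ifs with hmj
        · rw [hcard]
          refine sum_le_sum fun g hg => ?_
          by_cases h4 : g * x.1 ^ x.2 ∈ rough F m t
          · have h5 : g ∈ rough F m (t - j) := mem_rough.2 ⟨mem_monics.1 hg,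
              fun P a b c => (mem_rough.1 h4).2 P a b (c.mul_right _)⟩
            simp [h4, h5]
          · simp only [h4, if_false]; split_ifs <;> norm_num
        · refine le_of_eq (sum_eq_zero fun g _ => if_neg fun h4 => hmj ?_)
          have h5 := (mem_rough.1 h4).2 x.1 p1 p2
            ((dvd_pow_self x.1 (by omega)).mul_left g)
          rw [← p4]
          exact h5.trans (Nat.le_mul_of_pos_left _ p3)
      refine (sum_le_sum fun x hx => mul_le_mul_of_nonneg_left (h3 x hx) (by positivity)).trans ?_
      rw [← sum_mul, sum_primePowers j hj1]
      split_ifs <;> simp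
    have h4 := h1.trans_le (sum_le_sum h2)
    -- For `1 ≤ t < m` there are no rough polynomials: the identity has no terms.
    rcases Nat.lt_or_ge t m with htm | htm
    · have h5 : ∑ j ∈ Icc 1 t, (if m ≤ j then 𝐪 ^ j * (#(rough F m (t - j)) : ℝ) else 0) = 0 :=
        sum_eq_zero fun j hj => if_neg (by have := mem_Icc.1 hj; omega)
      rw [h5] at h4
      have h6 : (#(rough F m t) : ℝ) = 0 :=
        le_antisymm (by
          by_contra hpos
          push Not at hpos
          have := mul_pos ht0 hpos
          linarith) (by positivity)
      rw [h6, mul_zero]; positivity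
    · have h5 : ∀ j ∈ Icc 1 t, (if m ≤ j then 𝐪 ^ j * (#(rough F m (t - j)) : ℝ) else 0) ≤
          (if j ∈ Ico m t then 𝐪 ^ t / m else 0) + (if j = t then 𝐪 ^ t else 0) := by
        intro j hj
        obtain ⟨hj1, hj2⟩ := mem_Icc.1 hj
        by_cases hjt : j = t
        · subst hjt
          have h6 : #(rough F m (j - j)) ≤ 1 := by
            have : rough F m (j - j) ⊆ monics F 0 := fun f hf => by
              have := (mem_rough.1 hf).1
              rw [Nat.sub_self] at this
              exact mem_monics.2 this
            have h7 := card_le_card this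
            rwa [card_monics, pow_zero] at h7
          have h7 : (#(rough F m (j - j)) : ℝ) ≤ 1 := by exact_mod_cast h6
          simp only [htm, if_true, mem_Ico, lt_irrefl, and_false, if_false, zero_add]
          exact mul_le_of_le_one_right (by positivity) h7
        · simp only [hjt, if_false, add_zero, mem_Ico]
          by_cases hmj : m ≤ j
          · rw [if_pos hmj, if_pos ⟨hmj, by omega⟩, le_div_iff₀ hm0]
            have h6 := ih (t - j) (by omega) (by omega)
            have h7 : 𝐪 ^ t = 𝐪 ^ j * 𝐪 ^ (t - j) := by rw [← pow_add]; congr 1; omega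
            rw [h7, mul_assoc, mul_comm _ (m : ℝ)]
            exact mul_le_mul_of_nonneg_left h6 (by positivity)
          · rw [if_neg hmj, if_neg (by omega)]
      have h6 := h4.trans (sum_le_sum h5)
      rw [sum_add_distrib, ← sum_filter, sum_ite_eq' , if_pos (mem_Icc.2 ⟨ht, le_rfl⟩),
        show (Icc 1 t).filter (fun j => j ∈ Ico m t) = Ico m t by
          ext j; simp only [mem_filter, mem_Icc, mem_Ico]; omega,
        sum_const, Nat.card_Ico, nsmul_eq_mul, Nat.cast_sub htm] at h6
      have h7 : ((t : ℝ) - m) * (𝐪 ^ t / m) + 𝐪 ^ t = t * (𝐪 ^ t / m) := by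
        field_simp; ring
      rw [h7] at h6
      have h8 := le_of_mul_le_mul_left h6 ht0
      rw [le_div_iff₀ hm0] at h8
      linarith

end Counting

end PolyTable

namespace PolyTable
open Finset

/-! ### Factorisations into smooth, rough, squarefree and square parts -/

section Decompositions

set_option linter.unusedSectionVars false

variable {F : Type*} [Field F] [Fintype F]

lemma exists_monic_prime_dvd {f : F[X]} (hd : f.natDegree ≠ 0) :
    ∃ P : F[X], P.Monic ∧ Irreducible P ∧ P ∣ f := by
  obtain ⟨P, h1, h2, h3⟩ := Polynomial.exists_monic_irreducible_factor f
    (fun hu => hd (Polynomial.natDegree_eq_zero_of_isUnit hu))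
  exact ⟨P, h1, h2, h3⟩

lemma exists_max_prime_dvd {f : F[X]} (hf : f.Monic) (hd : f.natDegree ≠ 0) :
    ∃ P : F[X], P.Monic ∧ Irreducible P ∧ P ∣ f ∧
      ∀ Q : F[X], Q.Monic → Irreducible Q → Q ∣ f → Q.natDegree ≤ P.natDegree := by
  classical
  set S := ((range (f.natDegree + 1)).biUnion fun d => irreds F d).filter (· ∣ f) with hS
  have hmem : ∀ Q : F[X], Q ∈ S ↔ (Q.Monic ∧ Irreducible Q) ∧ Q ∣ f := by
    intro Q
    simp only [hS, mem_filter, mem_biUnion, mem_range, mem_irreds]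
    constructor
    · rintro ⟨⟨d, _, h1, _, h2⟩, h3⟩; exact ⟨⟨h1, h2⟩, h3⟩
    · rintro ⟨⟨h1, h2⟩, h3⟩
      exact ⟨⟨Q.natDegree, Nat.lt_succ_of_le (Polynomial.natDegree_le_of_dvd h3 hf.ne_zero),
        h1, rfl, h2⟩, h3⟩
  obtain ⟨P₀, h1, h2, h3⟩ := exists_monic_prime_dvd hd
  obtain ⟨P, hP, hmax⟩ := exists_max_image S (fun Q => Q.natDegree)
    ⟨P₀, (hmem P₀).2 ⟨⟨h1, h2⟩, h3⟩⟩
  obtain ⟨⟨h4, h5⟩, h6⟩ := (hmem P).1 hP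
  exact ⟨P, h4, h5, h6, fun Q a b c => hmax Q ((hmem Q).2 ⟨⟨a, b⟩, c⟩)⟩

/-- Induction on monic polynomials by removing prime factors. -/
lemma monic_induction {p : F[X] → Prop} (h1 : p 1)
    (hmul : ∀ P g : F[X], P.Monic → Irreducible P → g.Monic → p g → p (P * g)) (f : F[X])
    (hf : f.Monic) : p f := by
  induction hn : f.natDegree using Nat.strong_induction_on generalizing f with
  | _ n ih =>
    by_cases hd : f.natDegree = 0
    · rw [hf.natDegree_eq_zero.1 hd]; exact h1
    · obtain ⟨P, hP, hPi, g, rfl⟩ := exists_monic_prime_dvd hd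
      have hg : g.Monic := hP.of_mul_monic_left hf
      refine hmul P g hP hPi hg (ih g.natDegree ?_ g hg rfl)
      have := hPi.natDegree_pos
      rw [hP.natDegree_mul hg] at hn
      omega

lemma dvd_mul_prime {P Q g : F[X]} (hP : P.Monic) (hQ : Q.Monic) (hPi : Irreducible P)
    (hQi : Irreducible Q) (h : Q ∣ P * g) : Q = P ∨ Q ∣ g := by
  rcases hQi.prime.dvd_or_dvd h with h | h
  · exact Or.inl (Polynomial.eq_of_monic_of_associated hQ hP
      (hQi.associated_of_dvd hPi h))
  · exact Or.inr h

lemma exists_smooth_mul_rough (m : ℕ) (f : F[X]) (hf : f.Monic) :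
    ∃ s w : F[X], s.Monic ∧ w.Monic ∧ f = s * w ∧
      (∀ Q : F[X], Q.Monic → Irreducible Q → Q ∣ s → Q.natDegree < m) ∧
      (∀ Q : F[X], Q.Monic → Irreducible Q → Q ∣ w → m ≤ Q.natDegree) := by
  refine monic_induction (p := fun f => ∃ s w : F[X], s.Monic ∧ w.Monic ∧ f = s * w ∧
      (∀ Q : F[X], Q.Monic → Irreducible Q → Q ∣ s → Q.natDegree < m) ∧
      (∀ Q : F[X], Q.Monic → Irreducible Q → Q ∣ w → m ≤ Q.natDegree)) ?_ ?_ f hf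
  · refine ⟨1, 1, Polynomial.monic_one, Polynomial.monic_one, by simp, ?_, ?_⟩ <;>
    · intro Q _ h1 h2
      exact absurd (isUnit_of_dvd_one h2) h1.not_isUnit
  · rintro P g hP hPi hg ⟨s, w, hs, hw, rfl, h1, h2⟩
    by_cases hm : P.natDegree < m
    · refine ⟨P * s, w, hP.mul hs, hw, by ring, fun Q a b c => ?_, h2⟩
      rcases dvd_mul_prime hP a hPi b c with rfl | h
      · exact hm
      · exact h1 Q a b h
    · refine ⟨s, P * w, hs, hP.mul hw, by ring, h1, fun Q a b c => ?_⟩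
      rcases dvd_mul_prime hP a hPi b c with rfl | h
      · exact not_lt.1 hm
      · exact h2 Q a b h

lemma exists_prod_mul_sq (f : F[X]) (hf : f.Monic) :
    ∃ (A : Finset F[X]) (e : F[X]), e.Monic ∧ f = (∏ P ∈ A, P) * e ^ 2 ∧
      ∀ P ∈ A, P.Monic ∧ Irreducible P := by
  classical
  refine monic_induction (p := fun f => ∃ (A : Finset F[X]) (e : F[X]), e.Monic ∧
      f = (∏ P ∈ A, P) * e ^ 2 ∧ ∀ P ∈ A, P.Monic ∧ Irreducible P) ?_ ?_ f hf
  · exact ⟨∅, 1, Polynomial.monic_one, by simp, by simp⟩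
  · rintro P g hP hPi hg ⟨A, e, he, rfl, hA⟩
    by_cases hPA : P ∈ A
    · refine ⟨A.erase P, P * e, hP.mul he, ?_, fun Q hQ => hA Q (mem_of_mem_erase hQ)⟩
      rw [← mul_prod_erase A (fun Q => Q) hPA]
      ring
    · refine ⟨insert P A, e, he, by rw [prod_insert hPA]; ring, fun Q hQ => ?_⟩
      rcases mem_insert.1 hQ with rfl | h
      · exact ⟨hP, hPi⟩
      · exact hA Q h

open Classical in
lemma natDegree_mem_subsums {A : Finset F[X]} (hA : ∀ P ∈ A, P.Monic ∧ Irreducible P)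
    {d : F[X]} (hd : d ∣ ∏ P ∈ A, P) : d.natDegree ∈ subsums Polynomial.natDegree A := by
  induction A using Finset.induction_on generalizing d with
  | empty =>
    rw [prod_empty] at hd
    refine mem_subsums.2 ⟨∅, by simp, ?_⟩
    rw [sum_empty, Polynomial.natDegree_eq_zero_of_isUnit (isUnit_of_dvd_one hd)]
  | insert P A hPA ih =>
    rw [prod_insert hPA] at hd
    obtain ⟨x, y, hx, hy, rfl⟩ := exists_dvd_and_dvd_of_dvd_mul hd
    have hA' : ∀ Q ∈ A, Q.Monic ∧ Irreducible Q := fun Q hQ => hA Q (mem_insert_of_mem hQ)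
    obtain ⟨hP, hPi⟩ := hA P (mem_insert_self _ _)
    have hprod0 : ∏ P ∈ A, P ≠ 0 := prod_ne_zero_iff.2 fun Q hQ => (hA' Q hQ).1.ne_zero
    have hx0 : x ≠ 0 := ne_zero_of_dvd_ne_zero hP.ne_zero hx
    have hy0 : y ≠ 0 := ne_zero_of_dvd_ne_zero hprod0 hy
    obtain ⟨B, hB, hBd⟩ := mem_subsums.1 (ih hA' hy)
    rw [Polynomial.natDegree_mul hx0 hy0, ← hBd]
    rcases (hPi.dvd_iff).1 hx with h | h
    · refine mem_subsums.2 ⟨B, hB.trans (subset_insert _ _), ?_⟩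
      rw [Polynomial.natDegree_eq_zero_of_isUnit h, zero_add]
    · refine mem_subsums.2 ⟨insert P B, insert_subset_insert _ hB, ?_⟩
      rw [sum_insert fun h => hPA (hB h), Polynomial.natDegree_eq_of_degree_eq
        (Polynomial.degree_eq_degree_of_associated h)]

/-- The possible degrees of the divisors of `(∏ A) * e ^ 2` with `e` of degree `i`. -/
noncomputable def divisorDegrees (A : Finset F[X]) (i : ℕ) : Finset ℕ :=
  image₂ (· + ·) (subsums Polynomial.natDegree A) (range (2 * i + 1))

lemma card_divisorDegrees_le (A : Finset F[X]) (i : ℕ) :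
    #(divisorDegrees A i) ≤ #(subsums Polynomial.natDegree A) * (2 * i + 1) := by
  refine (card_image₂_le _ _ _).trans ?_
  rw [card_range]

lemma natDegree_mem_divisorDegrees {A : Finset F[X]} (hA : ∀ P ∈ A, P.Monic ∧ Irreducible P)
    {e d : F[X]} (he : e.Monic) (hd : d ∣ (∏ P ∈ A, P) * e ^ 2) :
    d.natDegree ∈ divisorDegrees A e.natDegree := by
  classical
  obtain ⟨x, y, hx, hy, rfl⟩ := exists_dvd_and_dvd_of_dvd_mul hd
  have hprod0 : ∏ P ∈ A, P ≠ 0 := prod_ne_zero_iff.2 fun Q hQ => (hA Q hQ).1.ne_zero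
  have he0 : e ^ 2 ≠ 0 := (he.pow 2).ne_zero
  rw [Polynomial.natDegree_mul (ne_zero_of_dvd_ne_zero hprod0 hx) (ne_zero_of_dvd_ne_zero he0 hy)]
  have h1 := Polynomial.natDegree_le_of_dvd hy he0
  rw [he.natDegree_pow] at h1
  exact mem_image₂.2 ⟨_, natDegree_mem_subsums hA hx, _, mem_range.2 (by omega), rfl⟩

open Classical in
lemma le_of_mem_divisorDegrees {A : Finset F[X]} {i x : ℕ} (hx : x ∈ divisorDegrees A i) :
    x ≤ ∑ P ∈ A, P.natDegree + 2 * i := by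
  obtain ⟨l, hl, k, hk, rfl⟩ := mem_image₂.1 hx
  obtain ⟨d, hd, rfl⟩ := mem_subsums.1 hl
  have := sum_le_sum_of_subset (f := fun P : F[X] => P.natDegree) hd
  have := mem_range.1 hk
  omega

variable (F) in
open Classical in
/-- The monic irreducible polynomials of degree at most `m`. -/
noncomputable def primesUpTo (m : ℕ) : Finset F[X] := (Icc 1 m).biUnion fun d => irreds F d

lemma mem_primesUpTo {m : ℕ} {P : F[X]} :
    P ∈ primesUpTo F m ↔ P.Monic ∧ Irreducible P ∧ P.natDegree ≤ m := by
  simp only [primesUpTo, mem_biUnion, mem_Icc, mem_irreds]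
  constructor
  · rintro ⟨d, ⟨_, h⟩, h1, rfl, h2⟩; exact ⟨h1, h2, h⟩
  · rintro ⟨h1, h2, h3⟩; exact ⟨P.natDegree, ⟨h2.natDegree_pos, h3⟩, h1, rfl, h2⟩

/-- Here `w` is the rough part of `G₂`, nontrivial because it contains `P₂`; the remaining factors
`G₁ / P₁` and the smooth part of `G₂` are merged into `(∏ A) * e ^ 2`. As `G₁ / P₁` divides this
product, its degree is a subset sum up to a shift coming from `e ^ 2`. -/
lemma exists_structure {G₁ G₂ P₁ P₂ : F[X]} (h₁ : G₁.Monic) (h₂ : G₂.Monic) (hP₁ : P₁.Monic)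
    (hP₁d : P₁ ∣ G₁)
    (hmax : ∀ Q : F[X], Q.Monic → Irreducible Q → Q ∣ G₁ → Q.natDegree ≤ P₁.natDegree)
    (hP₂ : P₂.Monic) (hP₂i : Irreducible P₂) (hP₂d : P₂ ∣ G₂)
    (hle : P₁.natDegree ≤ P₂.natDegree) :
    ∃ A ⊆ primesUpTo F P₁.natDegree, ∃ e w : F[X], e.Monic ∧
      w ∈ rough F P₁.natDegree w.natDegree ∧ 1 ≤ w.natDegree ∧
      G₁ * G₂ = P₁ * ((∏ P ∈ A, P) * e ^ 2) * w ∧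
      G₁.natDegree - P₁.natDegree ∈ divisorDegrees A e.natDegree := by
  obtain ⟨d, rfl⟩ := hP₁d
  have hd : d.Monic := hP₁.of_mul_monic_left h₁
  obtain ⟨s, w, hs, hw, rfl, h3, h4⟩ := exists_smooth_mul_rough P₁.natDegree G₂ h₂
  obtain ⟨A, e, he, hAe, hA⟩ := exists_prod_mul_sq (d * s) (hd.mul hs)
  refine ⟨A, fun Q hQ => ?_, e, w, he, mem_rough.2 ⟨⟨hw, rfl⟩, h4⟩, ?_, ?_, ?_⟩
  · refine mem_primesUpTo.2 ⟨(hA Q hQ).1, (hA Q hQ).2, ?_⟩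
    have hdvd : Q ∣ d * s := by
      rw [hAe]; exact (dvd_prod_of_mem (fun P => P) hQ).mul_right _
    rcases (hA Q hQ).2.prime.dvd_or_dvd hdvd with h | h
    · exact hmax Q (hA Q hQ).1 (hA Q hQ).2 (h.mul_left _)
    · exact (h3 Q (hA Q hQ).1 (hA Q hQ).2 h).le
  · rcases hP₂i.prime.dvd_or_dvd hP₂d with h | h
    · have := h3 P₂ hP₂ hP₂i h; omega
    · exact hP₂i.natDegree_pos.trans_le (Polynomial.natDegree_le_of_dvd h hw.ne_zero)
  · rw [← hAe]; ring
  · rw [hP₁.natDegree_mul hd, Nat.add_sub_cancel_left]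
    exact natDegree_mem_divisorDegrees hA he (by rw [← hAe]; exact Dvd.intro _ rfl)

end Decompositions

end PolyTable

namespace PolyTable
open Finset

/-! ### Conversion of `rate ^ J * decay J` into the claimed order of magnitude -/

section Order

lemma decay_mul_le {j k : ℕ} : decay (j + 1) ≤ ((k : ℝ) + 1) ^ 2 * decay (j + k + 1) := by
  have hj : (0 : ℝ) < (j : ℝ) + 1 := by positivity
  have hJ : (0 : ℝ) < (j : ℝ) + k + 1 := by positivity
  have h1 : (j : ℝ) + k + 1 ≤ (j + 1) * (k + 1) := by
    have : (0 : ℝ) ≤ (j : ℝ) * k := by positivity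
    nlinarith
  have h2 : √((j : ℝ) + k + 1) ≤ √((j : ℝ) + 1) * (k + 1) := by
    rw [Real.sqrt_le_left (by positivity), mul_pow, Real.sq_sqrt hj.le]
    nlinarith [Nat.cast_nonneg (α := ℝ) k, mul_nonneg hj.le (Nat.cast_nonneg (α := ℝ) k)]
  have h3 : 0 < √((j : ℝ) + 1) := Real.sqrt_pos.2 hj
  have h4 : 0 < √((j : ℝ) + k + 1) := Real.sqrt_pos.2 hJ
  simp only [decay]
  push_cast
  rw [mul_one_div, div_le_div_iff₀ (by positivity) (by positivity)]
  calc 1 * (((j : ℝ) + k + 1) * √((j : ℝ) + k + 1))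
      ≤ 1 * (((j + 1) * (k + 1)) * (√((j : ℝ) + 1) * (k + 1))) := by gcongr
    _ = _ := by ring

/-- Geometric growth wins: seen from the top term, the others decrease geometrically up to the
polynomial factor of `decay_mul_le`. -/
lemma exists_sum_pow_mul_decay_le {r : ℝ} (hr : 1 < r) :
    ∃ C > 0, ∀ J : ℕ, ∑ j ∈ range (J + 1), r ^ j * decay (j + 1) ≤ C * (r ^ J * decay (J + 1)) := by
  have hr0 : 0 < r := by linarith
  obtain ⟨C, hC, h⟩ := exists_sum_pow_mul_geometric_le 2 (t := r⁻¹) (by positivity)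
    (inv_lt_one_of_one_lt₀ hr)
  refine ⟨C, hC, fun J => ?_⟩
  rw [← sum_range_reflect]
  refine le_trans (sum_le_sum (g := fun k : ℕ => (((k : ℝ) + 1) ^ 2 * r⁻¹ ^ k) *
    (r ^ J * decay (J + 1))) fun k hk => ?_) ?_
  · have hk' := mem_range.1 hk
    obtain ⟨j, rfl⟩ : ∃ j, J = j + k := ⟨J - k, by omega⟩
    rw [show j + k + 1 - 1 - k = j by omega, pow_add]
    have h1 := decay_mul_le (j := j) (k := k)
    have h2 : (((k : ℝ) + 1) ^ 2 * r⁻¹ ^ k) * (r ^ j * r ^ k * decay (j + k + 1)) =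
        r ^ j * (((k : ℝ) + 1) ^ 2 * decay (j + k + 1)) := by
      have : r⁻¹ ^ k * r ^ k = 1 := by rw [← mul_pow, inv_mul_cancel₀ hr0.ne', one_pow]
      linear_combination ((k : ℝ) + 1) ^ 2 * r ^ j * decay (j + k + 1) * this
    rw [h2]
    exact mul_le_mul_of_nonneg_left h1 (by positivity)
  · rw [← sum_mul]
    exact mul_le_mul_of_nonneg_right (h _) (mul_nonneg (by positivity) (decay_nonneg _))

/-- This is where `δ` comes from: `rate / 2 = e log 2 = 2 ^ (1 - δ)`. -/
lemma one_sub_delta : 1 - delta = Real.log (rate / 2) / Real.log 2 := by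
  have h1 : rate / 2 = Real.exp 1 * Real.log 2 := by unfold rate; ring
  rw [h1, Real.log_mul (Real.exp_pos 1).ne' log_two_pos.ne', Real.log_exp, delta]
  ring

lemma one_lt_rate_div_two : 1 < rate / 2 := by
  have h1 : rate / 2 = Real.exp 1 * Real.log 2 := by unfold rate; ring
  rw [h1]
  have h2 := Real.exp_one_gt_d9
  have h3 := Real.log_two_gt_d9
  nlinarith

lemma delta_nonneg : 0 ≤ delta := by
  have h1 : Real.log (Real.log 2) ≤ Real.log 2 - 1 := Real.log_le_sub_one_of_pos log_two_pos
  have h2 : (1 + Real.log (Real.log 2)) / Real.log 2 ≤ 1 := by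
    rw [div_le_one log_two_pos]; linarith
  unfold delta; linarith

lemma one_sub_delta_pos : 0 < 1 - delta := by
  rw [one_sub_delta]
  exact div_pos (Real.log_pos one_lt_rate_div_two) log_two_pos

lemma rate_div_two_pow (J : ℕ) : (rate / 2) ^ J = ((2 : ℝ) ^ J) ^ (1 - delta) := by
  have h0 : 0 < rate / 2 := by linarith [one_lt_rate_div_two]
  rw [one_sub_delta, ← Real.rpow_natCast 2 J, ← Real.rpow_mul (by norm_num),
    Real.rpow_def_of_pos (by norm_num), ← Real.rpow_natCast (rate / 2),
    Real.rpow_def_of_pos h0]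
  congr 1
  field_simp [log_two_pos.ne']

lemma rpow_three_halves {x : ℝ} (hx : 0 ≤ x) : x ^ (3 / 2 : ℝ) = x * √x := by
  rw [Real.sqrt_eq_rpow, show (3 / 2 : ℝ) = 1 + 1 / 2 by norm_num,
    Real.rpow_add_of_nonneg hx (by norm_num) (by norm_num), Real.rpow_one]

lemma order_eq (q n : ℕ) {b : ℕ} (hb : 1 ≤ b) :
    order q n b = (q : ℝ) ^ n * ((b : ℝ) ^ (1 - delta) / b *
      (1 / ((1 + Real.log b) * √(1 + Real.log b)))) := by
  have hb0 : (0 : ℝ) < b := by exact_mod_cast hb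
  have h := Real.log_natCast_nonneg b
  rw [order, rpow_three_halves (by linarith), Real.rpow_sub hb0, Real.rpow_one]
  have h1 : 0 < (b : ℝ) ^ delta := Real.rpow_pos_of_pos hb0 _
  have h2 : 0 < √(1 + Real.log b) := Real.sqrt_pos.2 (by linarith)
  have h3 : 0 < 1 + Real.log b := by linarith
  field_simp

lemma order_nonneg (q n b : ℕ) : 0 ≤ order q n b := by
  have h := Real.log_natCast_nonneg b
  unfold order
  positivity

/-- From `b ≤ 2 ^ J` and `log 2 < 1` follows `1 + log b ≤ J + 1`; from `2 ^ J ≤ 2 b` the power costs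
at most `2 ^ (1 - δ) ≤ 2`. -/
lemma le_two_mul_order (q n : ℕ) {b J : ℕ} (hb : 1 ≤ b) (h1 : b ≤ 2 ^ J) (h2 : 2 ^ J ≤ 2 * b) :
    (q : ℝ) ^ n * ((rate / 2) ^ J * decay (J + 1) / b) ≤ 2 * order q n b := by
  have hb0 : (0 : ℝ) < b := by exact_mod_cast hb
  have hlog := Real.log_natCast_nonneg b
  have h1' : (b : ℝ) ≤ 2 ^ J := by exact_mod_cast h1
  have h2' : (2 : ℝ) ^ J ≤ 2 * b := by exact_mod_cast h2
  have e1 : Real.log b ≤ J := by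
    refine (Real.log_le_log hb0 h1').trans ?_
    rw [Real.log_pow]
    exact mul_le_of_le_one_right (by positivity) log_two_lt_one.le
  have e2 : decay (J + 1) ≤ 1 / ((1 + Real.log b) * √(1 + Real.log b)) := by
    have h3 : 1 + Real.log b ≤ ((J + 1 : ℕ) : ℝ) := by push_cast; linarith
    have h4 : 0 < √(1 + Real.log b) := Real.sqrt_pos.2 (by linarith)
    unfold decay
    gcongr
  have e3 : (rate / 2) ^ J ≤ 2 * (b : ℝ) ^ (1 - delta) := by
    rw [rate_div_two_pow]
    calc ((2 : ℝ) ^ J) ^ (1 - delta) ≤ (2 * b) ^ (1 - delta) :=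
          Real.rpow_le_rpow (by positivity) h2' one_sub_delta_pos.le
      _ = (2 : ℝ) ^ (1 - delta) * (b : ℝ) ^ (1 - delta) :=
          Real.mul_rpow (by norm_num) hb0.le
      _ ≤ 2 * (b : ℝ) ^ (1 - delta) := by
          gcongr
          calc (2 : ℝ) ^ (1 - delta) ≤ 2 ^ (1 : ℝ) :=
                Real.rpow_le_rpow_of_exponent_le (by norm_num) (by linarith [delta_nonneg])
            _ = 2 := Real.rpow_one 2
  rw [order_eq q n hb]
  have h5 := decay_nonneg (J + 1)
  have h6 : 0 ≤ (b : ℝ) ^ (1 - delta) := by positivity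
  calc (q : ℝ) ^ n * ((rate / 2) ^ J * decay (J + 1) / b)
      ≤ (q : ℝ) ^ n * ((2 * (b : ℝ) ^ (1 - delta)) *
        (1 / ((1 + Real.log b) * √(1 + Real.log b))) / b) := by gcongr
    _ = _ := by ring

/-- From `2 ^ J ≤ b` and `2 log 2 > 1` follows `1 + log b ≥ J / 2`, which costs `4` in the decay;
the other factor is `K ^ (1 - δ) ≤ K`. -/
lemma order_le_mul (q n : ℕ) {b J : ℕ} {K : ℝ} (hK : 1 ≤ K) (hJ : 1 ≤ J) (h1 : 2 ^ J ≤ b)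
    (h2 : (b : ℝ) ≤ K * 2 ^ J) :
    order q n b ≤ 4 * K * ((q : ℝ) ^ n * ((rate / 2) ^ J * decay J / b)) := by
  have hb : 1 ≤ b := Nat.one_le_two_pow.trans h1
  have hb0 : (0 : ℝ) < b := by exact_mod_cast hb
  have hJ0 : (1 : ℝ) ≤ J := by exact_mod_cast hJ
  have h1' : (2 : ℝ) ^ J ≤ b := by exact_mod_cast h1
  have e1 : (J : ℝ) / 2 ≤ 1 + Real.log b := by
    have h3 := Real.log_le_log (by positivity) h1'
    rw [Real.log_pow] at h3
    nlinarith [one_lt_two_log_two]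
  have e2 : 1 / ((1 + Real.log b) * √(1 + Real.log b)) ≤ 4 * decay J := by
    have h3 : √(J : ℝ) / 2 ≤ √(1 + Real.log b) := by
      refine Real.le_sqrt_of_sq_le ?_
      rw [div_pow, Real.sq_sqrt (by positivity)]
      linarith
    have h4 : 0 < √(J : ℝ) := Real.sqrt_pos.2 (by linarith)
    calc 1 / ((1 + Real.log b) * √(1 + Real.log b)) ≤ 1 / ((J : ℝ) / 2 * (√(J : ℝ) / 2)) := by
          gcongr
      _ = 4 * decay J := by unfold decay; field_simp; norm_num
  have e3 : (b : ℝ) ^ (1 - delta) ≤ K * (rate / 2) ^ J := by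
    rw [rate_div_two_pow]
    calc (b : ℝ) ^ (1 - delta) ≤ (K * 2 ^ J) ^ (1 - delta) :=
          Real.rpow_le_rpow (by positivity) h2 one_sub_delta_pos.le
      _ = K ^ (1 - delta) * ((2 : ℝ) ^ J) ^ (1 - delta) :=
          Real.mul_rpow (by linarith) (by positivity)
      _ ≤ K * ((2 : ℝ) ^ J) ^ (1 - delta) := by
          gcongr
          calc K ^ (1 - delta) ≤ K ^ (1 : ℝ) :=
                Real.rpow_le_rpow_of_exponent_le hK (by linarith [delta_nonneg])
            _ = K := Real.rpow_one K
  rw [order_eq q n hb]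
  have h7 : 0 < (rate / 2) ^ J := pow_pos (by linarith [one_lt_rate_div_two]) J
  calc (q : ℝ) ^ n * ((b : ℝ) ^ (1 - delta) / b *
      (1 / ((1 + Real.log b) * √(1 + Real.log b))))
      ≤ (q : ℝ) ^ n * ((K * (rate / 2) ^ J) / b * (4 * decay J)) := by gcongr
    _ = _ := by ring

end Order

/-! ### Upper bound for the number of polynomials with a divisor of degree `b` -/

section UpperBound

set_option linter.unusedSectionVars false

variable {F : Type*} [Field F] [Fintype F]

/-- The cardinality of the field, as a real number. -/
local notation "𝐪" => (Fintype.card F : ℝ)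

/-- The weight `q ^ (-deg P)`. -/
noncomputable def normInv (P : F[X]) : ℝ := (𝐪 ^ P.natDegree)⁻¹

lemma normInv_pos (P : F[X]) : 0 < normInv P := by
  have := card_pos (F := F)
  unfold normInv; positivity

lemma prod_normInv (A : Finset F[X]) :
    ∏ P ∈ A, normInv P = (𝐪 ^ ∑ P ∈ A, P.natDegree)⁻¹ := by
  simp only [normInv]
  rw [prod_inv_distrib, prod_pow_eq_pow_sum]

lemma sum_normInv_irreds_le {m : ℕ} (hm : 1 ≤ m) : ∑ P ∈ irreds F m, normInv P ≤ 1 / m := by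
  have hm0 : (0 : ℝ) < m := by exact_mod_cast hm
  have hq := card_pos (F := F)
  have h : ∑ P ∈ irreds F m, normInv P = ∑ _P ∈ irreds F m, (𝐪 ^ m)⁻¹ :=
    sum_congr rfl fun P hP => by rw [normInv, (mem_irreds.1 hP).2.1]
  rw [h, sum_const, nsmul_eq_mul, ← div_eq_mul_inv, div_le_div_iff₀ (by positivity) hm0, one_mul,
    mul_comm]
  exact card_irreds_le m hm

open Classical in
variable (F) in
/-- Products `P * ((∏ A) * e ^ 2) * w` of degree `n` with `P` prime of degree `m`, `e` of degree
`i` and `w` without prime factors of degree less than `m`. -/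
noncomputable def structured (n m : ℕ) (A : Finset F[X]) (i : ℕ) : Finset F[X] :=
  if m + (∑ P ∈ A, P.natDegree + 2 * i) < n then
    (irreds F m ×ˢ monics F i ×ˢ rough F m (n - (m + (∑ P ∈ A, P.natDegree + 2 * i)))).image
      fun x => x.1 * ((∏ P ∈ A, P) * x.2.1 ^ 2) * x.2.2
  else ∅

-- The prime and the rough factor save `1 / m` each. The square `e ^ 2` has degree `2 i` but only `q
-- ^ i` choices, which saves `q ^ (-i) ≤ 2 ^ (-i)`.
open Classical in
lemma card_structured_le (n : ℕ) {m : ℕ} (hm : 1 ≤ m) (A : Finset F[X]) (i : ℕ) :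
    (#(structured F n m A i) : ℝ) ≤
      𝐪 ^ n * ((∏ P ∈ A, normInv P) * (1 / (m : ℝ) ^ 2 * (1 / 2) ^ i)) := by
  have hq := card_pos (F := F)
  have hm0 : (0 : ℝ) < m := by exact_mod_cast hm
  have hprod : 0 ≤ ∏ P ∈ A, normInv P := prod_nonneg fun P _ => (normInv_pos P).le
  unfold structured
  split_ifs with h
  · refine (Nat.cast_le.2 card_image_le).trans ?_
    set d := ∑ P ∈ A, P.natDegree with hd
    rw [card_product, card_product, prod_normInv, ← hd]
    push_cast
    rw [card_monics_real]
    set s := n - (m + (d + 2 * i)) with hs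
    have h1 := card_irreds_le (F := F) m hm
    have h2 := card_rough_le (F := F) (m := m) (t := s) hm (by omega)
    rw [← le_div_iff₀' hm0] at h1 h2
    have hn : 𝐪 ^ n = 𝐪 ^ m * 𝐪 ^ d * 𝐪 ^ i * 𝐪 ^ i * 𝐪 ^ s := by
      rw [← pow_add, ← pow_add, ← pow_add, ← pow_add]; congr 1; omega
    have h3 : (2 : ℝ) ^ i ≤ 𝐪 ^ i := pow_le_pow_left₀ (by norm_num) two_le_card i
    have h4 : (1 : ℝ) ≤ 𝐪 ^ i * (1 / 2) ^ i := by
      rw [one_div, inv_pow, ← div_eq_mul_inv, one_le_div (by positivity)]; exact h3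
    calc (#(irreds F m) : ℝ) * (𝐪 ^ i * #(rough F m s))
        ≤ 𝐪 ^ m / m * (𝐪 ^ i * (𝐪 ^ s / m)) := by gcongr
      _ = (𝐪 ^ m / m * (𝐪 ^ i * (𝐪 ^ s / m))) * 1 := by ring
      _ ≤ (𝐪 ^ m / m * (𝐪 ^ i * (𝐪 ^ s / m))) * (𝐪 ^ i * (1 / 2) ^ i) := by gcongr
      _ = _ := by rw [hn]; field_simp
  · simp only [card_empty, Nat.cast_zero]
    positivity

open Classical in
/-- A polynomial with a divisor of degree `b` is a structured product. -/
lemma exists_mem_structured {n b : ℕ} (hb : 1 ≤ b) (hbn : 2 * b ≤ n) {f G : F[X]}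
    (hf : f ∈ monics F n) (hG : G.natDegree = b) (hdvd : G ∣ f) :
    ∃ t ∈ ({b, n - b} : Finset ℕ), ∃ m ∈ Icc 1 b, ∃ A ∈ (primesUpTo F m).powerset,
      ∃ i ∈ range (n + 1), t - m ∈ divisorDegrees A i ∧ f ∈ structured F n m A i := by
  obtain ⟨hfm, hfn⟩ := mem_monics.1 hf
  -- `G₁` is whichever of the two complementary divisors has the smaller largest prime; its degree
  -- `t` is `b` or `n - b`. The degree `m` of that prime is at most the degrees of both divisors,
  -- hence at most `b`.
  have hmain : ∀ G₁ G₂ P₁ P₂ : F[X], G₁.Monic → G₂.Monic → f = G₁ * G₂ →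
      (G₁.natDegree = b ∨ G₂.natDegree = b) → P₁.Monic → Irreducible P₁ → P₁ ∣ G₁ →
      (∀ Q : F[X], Q.Monic → Irreducible Q → Q ∣ G₁ → Q.natDegree ≤ P₁.natDegree) →
      P₂.Monic → Irreducible P₂ → P₂ ∣ G₂ → P₁.natDegree ≤ P₂.natDegree →
      ∃ t ∈ ({b, n - b} : Finset ℕ), ∃ m ∈ Icc 1 b, ∃ A ∈ (primesUpTo F m).powerset,
        ∃ i ∈ range (n + 1), t - m ∈ divisorDegrees A i ∧ f ∈ structured F n m A i := by
    intro G₁ G₂ P₁ P₂ hG₁ hG₂ hfG hdeg hP₁ hP₁i hP₁d hmax hP₂ hP₂i hP₂d hle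
    obtain ⟨A, hA, e, w, he, hw, hw1, hprod, hmem⟩ :=
      exists_structure hG₁ hG₂ hP₁ hP₁d hmax hP₂ hP₂i hP₂d hle
    have hApr : ∀ P ∈ A, P.Monic ∧ Irreducible P := fun P hP =>
      ⟨(mem_primesUpTo.1 (hA hP)).1, (mem_primesUpTo.1 (hA hP)).2.1⟩
    have hAm : (∏ P ∈ A, P).Monic := Polynomial.monic_prod_of_monic _ _ fun P hP => (hApr P hP).1
    have hAd : (∏ P ∈ A, P).natDegree = ∑ P ∈ A, P.natDegree :=
      Polynomial.natDegree_prod_of_monic _ _ fun P hP => (hApr P hP).1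
    have hwm : w.Monic := (mem_rough.1 hw).1.1
    have hsum : G₁.natDegree + G₂.natDegree = n := by
      rw [← hG₁.natDegree_mul hG₂, ← hfG, hfn]
    have hdegs : P₁.natDegree + (∑ P ∈ A, P.natDegree + 2 * e.natDegree) + w.natDegree = n := by
      rw [← hfn, hfG, hprod, (hP₁.mul (hAm.mul (he.pow 2))).natDegree_mul hwm,
        hP₁.natDegree_mul (hAm.mul (he.pow 2)), hAm.natDegree_mul (he.pow 2), he.natDegree_pow, hAd]
    have hl1 := Polynomial.natDegree_le_of_dvd hP₁d hG₁.ne_zero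
    have hl2 := Polynomial.natDegree_le_of_dvd hP₂d hG₂.ne_zero
    refine ⟨G₁.natDegree, ?_, P₁.natDegree, ?_, A, mem_powerset.2 hA, e.natDegree, ?_, hmem, ?_⟩
    · rw [mem_insert, mem_singleton]; omega
    · have := hP₁i.natDegree_pos
      rw [mem_Icc]; omega
    · rw [mem_range]; omega
    · unfold structured
      rw [if_pos (by omega)]
      refine mem_image.2 ⟨(P₁, e, w), ?_, by rw [hfG, hprod]⟩
      simp only [mem_product]
      refine ⟨mem_irreds.2 ⟨hP₁, rfl, hP₁i⟩, mem_monics.2 ⟨he, rfl⟩, ?_⟩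
      rwa [show n - (P₁.natDegree + (∑ P ∈ A, P.natDegree + 2 * e.natDegree)) = w.natDegree by
        omega]
  have hG0 : G ≠ 0 := ne_zero_of_dvd_ne_zero hfm.ne_zero hdvd
  have hNm : (normalize G).Monic := Polynomial.monic_normalize hG0
  have hNd : (normalize G).natDegree = b := by
    rw [← hG]
    exact Polynomial.natDegree_eq_of_degree_eq
      (Polynomial.degree_eq_degree_of_associated (normalize_associated G))
  obtain ⟨G', hG'⟩ := normalize_dvd_iff.2 hdvd
  have hG'm : G'.Monic := hNm.of_mul_monic_left (hG' ▸ hfm)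
  have hG'd : G'.natDegree = n - b := by
    have : b + G'.natDegree = n := by rw [← hNd, ← hNm.natDegree_mul hG'm, ← hG', hfn]
    omega
  obtain ⟨P₁, a1, a2, a3, a4⟩ := exists_max_prime_dvd hNm (by omega)
  obtain ⟨P₂, b1, b2, b3, b4⟩ := exists_max_prime_dvd hG'm (by omega)
  rcases le_total P₁.natDegree P₂.natDegree with h | h
  · exact hmain _ _ P₁ P₂ hNm hG'm hG' (Or.inl hNd) a1 a2 a3 a4 b1 b2 b3 h
  · exact hmain _ _ P₂ P₁ hG'm hNm (by rw [hG', mul_comm]) (Or.inr hNd) b1 b2 b3 b4 a1 a2 a3 h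

end UpperBound

end PolyTable

namespace PolyTable
open Finset

section UpperBound

set_option linter.unusedSectionVars false

variable {F : Type*} [Field F] [Fintype F]

/-- The cardinality of the field, as a real number. -/
local notation "𝐪" => (Fintype.card F : ℝ)

/-- For fixed `A` and `i` the degree `m` is determined by the divisor degree `t - m`. This is how
the number of subset sums enters the count. -/
lemma card_filter_sub_mem_le {b t : ℕ} (ht : b ≤ t) (s : Finset ℕ) (hs : s ⊆ Icc 1 b)
    (D : Finset ℕ) : #(s.filter fun m => t - m ∈ D) ≤ #D := by
  refine card_le_card_of_injOn (fun m => t - m) (fun m hm => ?_) ?_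
  · simp only [coe_filter, Set.mem_ofPred_eq] at hm
    exact hm.2
  · intro m hm m' hm' h
    simp only [coe_filter, Set.mem_ofPred_eq] at hm hm'
    have := mem_Icc.1 (hs hm.1)
    have := mem_Icc.1 (hs hm'.1)
    simp only at h
    omega

open Classical in
lemma sum_normInv_filter_primesUpTo_le (k m : ℕ) (hm : 1 ≤ m) :
    ∑ P ∈ (primesUpTo F k).filter (fun P => P.natDegree = m), normInv P ≤ 1 / m := by
  refine le_trans (sum_le_sum_of_subset_of_nonneg ?_ fun P _ _ => (normInv_pos P).le)
    (sum_normInv_irreds_le hm)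
  intro P hP
  obtain ⟨h1, h2⟩ := mem_filter.1 hP
  obtain ⟨h3, h4, _⟩ := mem_primesUpTo.1 h1
  exact mem_irreds.2 ⟨h3, h2, h4⟩

open Classical in
lemma exists_sum_subsums_primesUpTo_le : ∃ C > 0, ∀ (F : Type*) [Field F] [Fintype F] (j : ℕ),
    ∑ A ∈ (primesUpTo F (2 ^ j)).powerset, (∏ P ∈ A, normInv P) *
      (#(subsums Polynomial.natDegree A) : ℝ) * (∑ P ∈ A, (P.natDegree : ℝ) + 2 ^ j) ≤
      C * 2 ^ j * rate ^ j * decay (j + 1) := by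
  obtain ⟨C, hC, h⟩ := exists_sum_card_subsums_mul_le
  refine ⟨C, hC, fun F _ _ j => ?_⟩
  refine h F[X] normInv Polynomial.natDegree (primesUpTo F (2 ^ j)) j
    (fun P => (normInv_pos P).le) (fun P hP => ?_) fun m hm =>
      sum_normInv_filter_primesUpTo_le _ m hm
  obtain ⟨_, h2, h3⟩ := mem_primesUpTo.1 hP
  exact ⟨h2.natDegree_pos, h3⟩

lemma primesUpTo_mono {m k : ℕ} (h : m ≤ k) : primesUpTo F m ⊆ primesUpTo F k := fun P hP => by
  obtain ⟨h1, h2, h3⟩ := mem_primesUpTo.1 hP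
  exact mem_primesUpTo.2 ⟨h1, h2, h3.trans h⟩

open Classical in
/-- The contribution of the largest prime factors of degree in `(2 ^ (j - 1), 2 ^ j]`. -/
lemma exists_sum_dyadic_le : ∃ C > 0, ∀ (F : Type*) [Field F] [Fintype F] (n b t j : ℕ)
    (s : Finset ℕ), b ≤ t → s ⊆ Icc 1 b → (∀ m ∈ s, m ≤ 2 ^ j ∧ 2 ^ j ≤ 2 * m) →
    (b : ℝ) * ∑ m ∈ s, ∑ A ∈ (primesUpTo F m).powerset, ∑ i ∈ range (n + 1),
      (if t - m ∈ divisorDegrees A i then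
        (∏ P ∈ A, normInv P) * (1 / (m : ℝ) ^ 2 * (1 / 2) ^ i) else 0) ≤
      C * ((rate / 2) ^ j * decay (j + 1)) := by
  obtain ⟨C₀, hC₀, h₀⟩ := exists_sum_subsums_primesUpTo_le
  obtain ⟨C₁, hC₁, h₁⟩ := exists_sum_pow_mul_geometric_le 2 (t := 1 / 2) (by norm_num) (by norm_num)
  refine ⟨16 * C₁ * C₀, by positivity, fun F _ _ n b t j s hbt hs hsj => ?_⟩
  have hprod : ∀ A : Finset F[X], 0 ≤ ∏ P ∈ A, normInv P := fun A =>
    prod_nonneg fun P _ => (normInv_pos P).le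
  -- A divisor degree cannot exceed `deg A + 2 i`, so `b ≤ t` is at most `(deg A + 2 ^ j) * (2 i +
  -- 1)`. Trading the factor `b` for this one is what makes small `m` contribute little.
  have hterm : ∀ m ∈ s, ∀ A : Finset F[X], ∀ i : ℕ, t - m ∈ divisorDegrees A i →
      (b : ℝ) * ((∏ P ∈ A, normInv P) * (1 / (m : ℝ) ^ 2 * (1 / 2) ^ i)) ≤
      4 / 4 ^ j * ((∏ P ∈ A, normInv P) * (∑ P ∈ A, (P.natDegree : ℝ) + 2 ^ j)) *
        ((2 * i + 1) * (1 / 2) ^ i) := by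
    intro m hm A i hmem
    obtain ⟨hm1, hm2⟩ := hsj m hm
    obtain ⟨hm3, hm4⟩ := mem_Icc.1 (hs hm)
    have h2 := le_of_mem_divisorDegrees hmem
    have h3 : b ≤ (∑ P ∈ A, P.natDegree + 2 ^ j) * (2 * i + 1) := by
      have h5 : 1 ≤ 2 ^ j := Nat.one_le_two_pow
      have h6 : b ≤ ∑ P ∈ A, P.natDegree + 2 * i + 2 ^ j := by omega
      nlinarith [Nat.zero_le ((∑ P ∈ A, P.natDegree) * i), Nat.mul_le_mul_right i h5]
    have h4 : (b : ℝ) ≤ (∑ P ∈ A, (P.natDegree : ℝ) + 2 ^ j) * (2 * i + 1) := by exact_mod_cast h3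
    have hm0 : (0 : ℝ) < m := by exact_mod_cast hm3
    have h7 : 1 / (m : ℝ) ^ 2 ≤ 4 / 4 ^ j := by
      rw [div_le_div_iff₀ (by positivity) (by positivity), one_mul]
      have h8 : (2 : ℝ) ^ j ≤ 2 * m := by exact_mod_cast hm2
      calc (4 : ℝ) ^ j = (2 ^ j) ^ 2 := by rw [← pow_mul, mul_comm, pow_mul]; norm_num
        _ ≤ (2 * m) ^ 2 := by gcongr
        _ = 4 * m ^ 2 := by ring
    have h9 := hprod A
    calc (b : ℝ) * ((∏ P ∈ A, normInv P) * (1 / (m : ℝ) ^ 2 * (1 / 2) ^ i))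
        ≤ ((∑ P ∈ A, (P.natDegree : ℝ) + 2 ^ j) * (2 * i + 1)) *
          ((∏ P ∈ A, normInv P) * (4 / 4 ^ j * (1 / 2) ^ i)) := by gcongr
      _ = _ := by ring
  have hsum : (b : ℝ) * ∑ m ∈ s, ∑ A ∈ (primesUpTo F m).powerset, ∑ i ∈ range (n + 1),
      (if t - m ∈ divisorDegrees A i then
        (∏ P ∈ A, normInv P) * (1 / (m : ℝ) ^ 2 * (1 / 2) ^ i) else 0) ≤
      ∑ m ∈ s, ∑ A ∈ (primesUpTo F (2 ^ j)).powerset, ∑ i ∈ range (n + 1),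
      (if t - m ∈ divisorDegrees A i then
        4 / 4 ^ j * ((∏ P ∈ A, normInv P) * (∑ P ∈ A, (P.natDegree : ℝ) + 2 ^ j)) *
        ((2 * i + 1) * (1 / 2) ^ i) else 0) := by
    rw [mul_sum]
    refine sum_le_sum fun m hm => ?_
    rw [mul_sum]
    refine le_trans (sum_le_sum (g := fun A : Finset F[X] => ∑ i ∈ range (n + 1),
      (if t - m ∈ divisorDegrees A i then
        4 / 4 ^ j * ((∏ P ∈ A, normInv P) * (∑ P ∈ A, (P.natDegree : ℝ) + 2 ^ j)) *
        ((2 * i + 1) * (1 / 2) ^ i) else 0)) fun A _ => ?_)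
      (sum_le_sum_of_subset_of_nonneg (powerset_mono.2 (primesUpTo_mono (hsj m hm).1))
        fun A _ _ => sum_nonneg fun i _ => ?_)
    · rw [mul_sum]
      refine sum_le_sum fun i _ => ?_
      split_ifs with h
      · exact hterm m hm A i h
      · simp
    · have := hprod A
      split_ifs <;> positivity
  refine hsum.trans ?_
  rw [sum_comm]
  have hA : ∀ A : Finset F[X], ∑ m ∈ s, ∑ i ∈ range (n + 1),
      (if t - m ∈ divisorDegrees A i then
        4 / 4 ^ j * ((∏ P ∈ A, normInv P) * (∑ P ∈ A, (P.natDegree : ℝ) + 2 ^ j)) *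
        ((2 * i + 1) * (1 / 2) ^ i) else 0) ≤
      16 * C₁ / 4 ^ j * ((∏ P ∈ A, normInv P) * (#(subsums Polynomial.natDegree A) : ℝ) *
        (∑ P ∈ A, (P.natDegree : ℝ) + 2 ^ j)) := by
    intro A
    have hp := hprod A
    rw [sum_comm]
    have hi : ∀ i ∈ range (n + 1), ∑ m ∈ s, (if t - m ∈ divisorDegrees A i then
        4 / 4 ^ j * ((∏ P ∈ A, normInv P) * (∑ P ∈ A, (P.natDegree : ℝ) + 2 ^ j)) *
        ((2 * i + 1) * (1 / 2) ^ i) else 0) ≤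
        (16 / 4 ^ j * ((∏ P ∈ A, normInv P) * (#(subsums Polynomial.natDegree A) : ℝ) *
          (∑ P ∈ A, (P.natDegree : ℝ) + 2 ^ j))) * (((i : ℝ) + 1) ^ 2 * (1 / 2) ^ i) := by
      intro i _
      rw [← sum_filter, sum_const, nsmul_eq_mul]
      have h2 : #(s.filter fun m => t - m ∈ divisorDegrees A i) ≤
          #(subsums Polynomial.natDegree A) * (2 * i + 1) :=
        (card_filter_sub_mem_le hbt s hs _).trans (card_divisorDegrees_le A i)
      have h3 : (#(s.filter fun m => t - m ∈ divisorDegrees A i) : ℝ) ≤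
          (#(subsums Polynomial.natDegree A) : ℝ) * (2 * i + 1) := by exact_mod_cast h2
      have h4 : ((2 : ℝ) * i + 1) * (2 * i + 1) ≤ 4 * ((i : ℝ) + 1) ^ 2 := by
        have : (0 : ℝ) ≤ i := by positivity
        nlinarith
      calc _ ≤ ((#(subsums Polynomial.natDegree A) : ℝ) * (2 * i + 1)) * (4 / 4 ^ j *
            ((∏ P ∈ A, normInv P) * (∑ P ∈ A, (P.natDegree : ℝ) + 2 ^ j)) *
            ((2 * i + 1) * (1 / 2) ^ i)) := by gcongr
        _ = ((#(subsums Polynomial.natDegree A) : ℝ)) * (4 / 4 ^ j *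
            ((∏ P ∈ A, normInv P) * (∑ P ∈ A, (P.natDegree : ℝ) + 2 ^ j)) *
            ((((2 : ℝ) * i + 1) * (2 * i + 1)) * (1 / 2) ^ i)) := by ring
        _ ≤ ((#(subsums Polynomial.natDegree A) : ℝ)) * (4 / 4 ^ j *
            ((∏ P ∈ A, normInv P) * (∑ P ∈ A, (P.natDegree : ℝ) + 2 ^ j)) *
            ((4 * ((i : ℝ) + 1) ^ 2) * (1 / 2) ^ i)) := by gcongr
        _ = _ := by ring
    refine (sum_le_sum hi).trans ?_
    rw [← mul_sum]
    refine (mul_le_mul_of_nonneg_left (h₁ (range (n + 1))) (by positivity)).trans (le_of_eq ?_)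
    ring
  refine (sum_le_sum fun A _ => hA A).trans ?_
  rw [← mul_sum]
  refine (mul_le_mul_of_nonneg_left (h₀ F j) (by positivity)).trans (le_of_eq ?_)
  rw [div_pow, show (4 : ℝ) ^ j = 2 ^ j * 2 ^ j by rw [← mul_pow]; norm_num]
  field_simp

-- Grouping `m` dyadically leaves terms `(rate / 2) ^ j * decay (j + 1)`. As `rate / 2 > 1`, the
-- largest `j` dominates.
open Classical in
lemma exists_sum_structured_le : ∃ C > 0, ∀ (F : Type*) [Field F] [Fintype F] (n b t J : ℕ),
    1 ≤ b → b ≤ t → b ≤ 2 ^ J →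
    (b : ℝ) * ∑ m ∈ Icc 1 b, ∑ A ∈ (primesUpTo F m).powerset, ∑ i ∈ range (n + 1),
      (if t - m ∈ divisorDegrees A i then
        (∏ P ∈ A, normInv P) * (1 / (m : ℝ) ^ 2 * (1 / 2) ^ i) else 0) ≤
      C * ((rate / 2) ^ J * decay (J + 1)) := by
  obtain ⟨C, hC, h⟩ := exists_sum_dyadic_le
  obtain ⟨C', hC', h'⟩ := exists_sum_pow_mul_decay_le one_lt_rate_div_two
  refine ⟨C * C', by positivity, fun F _ _ n b t J hb hbt hJ => ?_⟩
  have hmaps : ∀ m ∈ Icc 1 b, Nat.clog 2 m ∈ range (J + 1) := fun m hm =>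
    mem_range.2 (Nat.lt_succ_of_le (Nat.clog_le_of_le_pow ((mem_Icc.1 hm).2.trans hJ)))
  rw [← sum_fiberwise_of_maps_to hmaps, mul_sum]
  refine le_trans (sum_le_sum fun j _ => h F n b t j _ hbt (filter_subset _ _) ?_) ?_
  · intro m hm
    obtain ⟨h1, rfl⟩ := mem_filter.1 hm
    refine ⟨Nat.le_pow_clog (by norm_num) m, ?_⟩
    rcases Nat.lt_or_ge 1 m with h2 | h2
    · have h3 := Nat.pow_pred_clog_lt_self (b := 2) (by norm_num) h2
      have h4 : 1 ≤ Nat.clog 2 m := Nat.clog_pos (by norm_num) h2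
      have h5 : 2 ^ Nat.clog 2 m = 2 * 2 ^ (Nat.clog 2 m - 1) := by
        rw [← pow_succ']; congr 1; omega
      have h6 : (Nat.clog 2 m).pred = Nat.clog 2 m - 1 := rfl
      rw [h6] at h3
      omega
    · have := (mem_Icc.1 h1).1
      obtain rfl : m = 1 := by omega
      simp
  · rw [← mul_sum, mul_assoc]
    exact mul_le_mul_of_nonneg_left (h' J) hC.le

open Classical in
/-- The upper bound for the number of monic polynomials with a divisor of degree `b`. -/
lemma exists_card_divisor_le : ∃ C > 0, ∀ (F : Type*) [Field F] [Fintype F] (n b : ℕ),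
    1 ≤ b → 2 * b ≤ n →
    (#((monics F n).filter fun f => ∃ G : F[X], G.natDegree = b ∧ G ∣ f) : ℝ) ≤
      C * order (Fintype.card F) n b := by
  obtain ⟨C, hC, h⟩ := exists_sum_structured_le
  refine ⟨4 * C, by positivity, fun F _ _ n b hb hbn => ?_⟩
  have hb0 : (0 : ℝ) < b := by exact_mod_cast hb
  have hq := card_pos (F := F)
  -- `2 ^ J` is the smallest power of two that is at least `b`.
  obtain ⟨J, hJ1, hJ2⟩ : ∃ J, b ≤ 2 ^ J ∧ 2 ^ J ≤ 2 * b := by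
    refine ⟨Nat.clog 2 b, Nat.le_pow_clog (by norm_num) b, ?_⟩
    rcases Nat.lt_or_ge 1 b with h2 | h2
    · have h3 := Nat.pow_pred_clog_lt_self (b := 2) (by norm_num) h2
      have h4 : 1 ≤ Nat.clog 2 b := Nat.clog_pos (by norm_num) h2
      have h5 : 2 ^ Nat.clog 2 b = 2 * 2 ^ (Nat.clog 2 b - 1) := by
        rw [← pow_succ']; congr 1; omega
      have h6 : (Nat.clog 2 b).pred = Nat.clog 2 b - 1 := rfl
      rw [h6] at h3
      omega
    · obtain rfl : b = 1 := by omega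
      simp
  set T : ℕ → ℝ := fun t => ∑ m ∈ Icc 1 b, ∑ A ∈ (primesUpTo F m).powerset, ∑ i ∈ range (n + 1),
      (if t - m ∈ divisorDegrees A i then
        (∏ P ∈ A, normInv P) * (1 / (m : ℝ) ^ 2 * (1 / 2) ^ i) else 0) with hT
  have hTt : ∀ t, b ≤ t → Fintype.card F ^ n * T t ≤ C * (2 * order (Fintype.card F) n b) := by
    intro t ht
    have h1 := h F n b t J hb ht hJ1
    have h2 := le_two_mul_order (Fintype.card F) n hb hJ1 hJ2
    rw [← le_div_iff₀' hb0] at h1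
    calc (Fintype.card F : ℝ) ^ n * T t
        ≤ (Fintype.card F : ℝ) ^ n * (C * ((rate / 2) ^ J * decay (J + 1)) / b) := by gcongr
      _ = C * ((Fintype.card F : ℝ) ^ n * ((rate / 2) ^ J * decay (J + 1) / b)) := by ring
      _ ≤ _ := by gcongr
  have hcover : (monics F n).filter (fun f => ∃ G : F[X], G.natDegree = b ∧ G ∣ f) ⊆
      ({b, n - b} : Finset ℕ).biUnion fun t => (Icc 1 b).biUnion fun m =>
        (primesUpTo F m).powerset.biUnion fun A => (range (n + 1)).biUnion fun i =>
          if t - m ∈ divisorDegrees A i then structured F n m A i else ∅ := by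
    intro f hf
    obtain ⟨hf1, G, hG, hdvd⟩ := mem_filter.1 hf
    obtain ⟨t, ht, m, hm, A, hA, i, hi, h1, h2⟩ := exists_mem_structured hb hbn hf1 hG hdvd
    simp only [mem_biUnion]
    exact ⟨t, ht, m, hm, A, hA, i, hi, by rw [if_pos h1]; exact h2⟩
  have hcard : (#((monics F n).filter fun f => ∃ G : F[X], G.natDegree = b ∧ G ∣ f) : ℝ) ≤
      ∑ t ∈ ({b, n - b} : Finset ℕ), (Fintype.card F : ℝ) ^ n * T t := by
    have h1 : #((monics F n).filter fun f => ∃ G : F[X], G.natDegree = b ∧ G ∣ f) ≤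
        ∑ t ∈ ({b, n - b} : Finset ℕ), ∑ m ∈ Icc 1 b, ∑ A ∈ (primesUpTo F m).powerset,
          ∑ i ∈ range (n + 1),
            #(if t - m ∈ divisorDegrees A i then structured F n m A i else ∅) := by
      refine (card_le_card hcover).trans (card_biUnion_le.trans (sum_le_sum fun t _ => ?_))
      refine card_biUnion_le.trans (sum_le_sum fun m _ => ?_)
      exact card_biUnion_le.trans (sum_le_sum fun A _ => card_biUnion_le)
    refine (Nat.cast_le.2 h1).trans ?_
    push_cast
    refine sum_le_sum fun t _ => ?_
    simp only [hT, mul_sum]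
    refine sum_le_sum fun m hm => sum_le_sum fun A _ => sum_le_sum fun i _ => ?_
    split_ifs
    · exact card_structured_le n (mem_Icc.1 hm).1 A i
    · simp
  refine hcard.trans ?_
  have hnn : ∀ t ∈ ({b, n - b} : Finset ℕ), (Fintype.card F : ℝ) ^ n * T t ≤
      C * (2 * order (Fintype.card F) n b) := fun t ht => hTt t (by
    rw [mem_insert, mem_singleton] at ht; omega)
  refine (sum_le_card_nsmul _ _ _ hnn).trans ?_
  rw [nsmul_eq_mul]
  have h2 : (#({b, n - b} : Finset ℕ) : ℝ) ≤ 2 := by exact_mod_cast card_le_two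
  have h3 := order_nonneg (Fintype.card F) n b
  nlinarith [mul_nonneg hC.le h3]

end UpperBound

end PolyTable

namespace PolyTable
open Finset

/-! ### Almost primes and rough polynomials in arithmetic progressions -/

section Progressions

set_option linter.unusedSectionVars false

variable {F : Type*} [Field F] [Fintype F]

/-- The cardinality of the field, as a real number. -/
local notation "𝐪" => (Fintype.card F : ℝ)

open Classical in
/-- The monic polynomials of degree `t` congruent to `c` modulo `M`. -/
noncomputable def progression (M c : F[X]) (t : ℕ) : Finset F[X] :=
  (monics F t).filter fun f => M ∣ f - c

lemma mem_progression {M c f : F[X]} {t : ℕ} :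
    f ∈ progression M c t ↔ (f.Monic ∧ f.natDegree = t) ∧ M ∣ f - c := by
  simp [progression, mem_monics]

/-- Division with remainder: the elements are exactly `M * k + c %ₘ M` with `k` monic. -/
lemma card_progression {M : F[X]} (hM : M.Monic) (c : F[X]) {t : ℕ} (ht : M.natDegree ≤ t) :
    #(progression M c t) = Fintype.card F ^ (t - M.natDegree) := by
  rw [← card_monics]
  symm
  have hr : (c %ₘ M).degree < M.degree := Polynomial.degree_modByMonic_lt c hM
  have hc : c %ₘ M + M * (c /ₘ M) = c := Polynomial.modByMonic_add_div c M
  have hlt : ∀ k : F[X], k.Monic → (c %ₘ M).degree < (M * k).degree := fun k hk => by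
    rw [hk.degree_mul]
    refine hr.trans_le ?_
    exact le_add_of_nonneg_right (by
      rw [Polynomial.degree_eq_natDegree hk.ne_zero]; exact_mod_cast Nat.zero_le _)
  refine card_bij (fun k _ => M * k + c %ₘ M) ?_ ?_ ?_
  · intro k hk
    obtain ⟨h1, h2⟩ := mem_monics.1 hk
    refine mem_progression.2 ⟨⟨(hM.mul h1).add_of_left (hlt k h1), ?_⟩, ?_⟩
    · rw [Polynomial.natDegree_add_eq_left_of_degree_lt (hlt k h1), hM.natDegree_mul h1]; omega
    · refine ⟨k - c /ₘ M, ?_⟩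
      linear_combination hc
  · intro k _ k' _ h
    exact mul_left_cancel₀ hM.ne_zero (add_right_cancel h)
  · intro f hf
    obtain ⟨⟨h1, h2⟩, h, h3⟩ := mem_progression.1 hf
    have h4 : M * (h + c /ₘ M) = f - c %ₘ M := by linear_combination -h3 + hc
    have h5 : (c %ₘ M).degree < f.degree := hr.trans_le (by
      rw [Polynomial.degree_eq_natDegree hM.ne_zero, Polynomial.degree_eq_natDegree h1.ne_zero]
      exact_mod_cast h2 ▸ ht)
    have h6 : (M * (h + c /ₘ M)).Monic := by
      rw [h4, sub_eq_add_neg]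
      exact h1.add_of_left (by rwa [Polynomial.degree_neg])
    have h7 : (h + c /ₘ M).Monic := hM.of_mul_monic_left h6
    refine ⟨h + c /ₘ M, mem_monics.2 ⟨h7, ?_⟩, by rw [h4]; ring⟩
    have h8 : (M * (h + c /ₘ M)).natDegree = t := by
      rw [h4, Polynomial.natDegree_eq_of_degree_eq (Polynomial.degree_sub_eq_left_of_degree_lt h5),
        h2]
    rw [hM.natDegree_mul h7] at h8
    omega

lemma exists_inverse_class {M c Q : F[X]} (hQ : IsCoprime Q M) (hc : IsCoprime c M) :
    ∃ c' : F[X], IsCoprime c' M ∧ ∀ g : F[X], M ∣ g * Q - c ↔ M ∣ g - c' := by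
  obtain ⟨u, v, huv⟩ := hQ
  have hu : IsCoprime u M := ⟨Q, v, by linear_combination huv⟩
  refine ⟨u * c, hu.mul_left hc, fun g => ⟨fun ⟨h, hh⟩ => ?_, fun ⟨h, hh⟩ => ?_⟩⟩
  · exact ⟨u * h + g * v, by linear_combination u * hh - g * huv⟩
  · exact ⟨Q * h - v * c, by linear_combination Q * hh + c * huv⟩

-- If `Q` is invertible modulo `M`, the condition fixes a class of `g`. Otherwise it has no
-- solutions, because `c` is invertible.
open Classical in
lemma sum_monics_dvd_mul_sub_le {M c Q : F[X]} (hM : M.Monic) (hc : IsCoprime c M) {s : ℕ}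
    (hs : M.natDegree ≤ s) :
    ∑ g ∈ monics F s, (if M ∣ g * Q - c then (1 : ℝ) else 0) ≤ 𝐪 ^ (s - M.natDegree) := by
  by_cases hQ : IsCoprime Q M
  · obtain ⟨c', _, h⟩ := exists_inverse_class hQ hc
    rw [← sum_filter, sum_const, nsmul_eq_mul, mul_one]
    have h1 := card_progression hM c' hs
    have h2 : (monics F s).filter (fun g => M ∣ g * Q - c) = progression M c' s := by
      ext g; simp [progression, h]
    rw [h2, h1]
    push_cast
    rfl
  · rw [sum_eq_zero]
    · have := card_pos (F := F)
      positivity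
    · intro g _
      refine if_neg fun ⟨h, hh⟩ => hQ ?_
      obtain ⟨u, v, huv⟩ := hc
      exact ⟨u * g, v - u * h, by linear_combination huv + u * hh⟩

open Classical in
/-- The terms of the logarithmic derivative identity for an arithmetic progression which come from
prime factors with a cofactor of degree at most `deg M`. -/
lemma exists_le_sum_irreds_dvd {M : F[X]} (hM : M.Monic) : ∃ κ > 0, ∃ t₀ : ℕ, ∀ t ≥ t₀,
    M.natDegree + 1 ≤ t ∧ ∀ c : F[X], IsCoprime c M → κ * 𝐪 ^ t ≤
      ∑ j ∈ Ioc (t - (M.natDegree + 1)) t, ∑ P ∈ irreds F j, (P.natDegree : ℝ) *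
        ∑ g ∈ monics F (t - j), if M ∣ g * P - c then (1 : ℝ) else 0 := by
  set D := M.natDegree with hD
  have hq := card_pos (F := F)
  have hlim : Tendsto (fun t : ℕ => 2 * (D + 1 : ℝ) * 𝐪 ^ D * ((4 / 3) ^ D * (3 / 4) ^ t)) atTop
      (nhds 0) := by
    have h1 := tendsto_pow_atTop_nhds_zero_of_lt_one (r := (3 / 4 : ℝ)) (by norm_num) (by norm_num)
    simpa using (h1.const_mul ((4 / 3 : ℝ) ^ D)).const_mul (2 * (D + 1 : ℝ) * 𝐪 ^ D)
  obtain ⟨t₁, ht₁⟩ := eventually_atTop.1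
    (hlim.eventually_le_const (u := 1 / (2 * 𝐪 ^ D)) (by positivity))
  refine ⟨1 / (2 * 𝐪 ^ D), by positivity, max t₁ (D + 1), fun t ht => ?_⟩
  have htD : D + 1 ≤ t := (le_max_right _ _).trans ht
  refine ⟨htD, fun c hc => ?_⟩
  have herr := ht₁ t ((le_max_left _ _).trans ht)
  have hid := mul_sum_monics (F := F) t fun f => if M ∣ f - c then (1 : ℝ) else 0
  have htot : ∑ f ∈ monics F t, (if M ∣ f - c then (1 : ℝ) else 0) = 𝐪 ^ (t - D) := by
    rw [← sum_filter, sum_const, nsmul_eq_mul, mul_one]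
    have := card_progression hM c (t := t) (by omega)
    rw [progression] at this
    rw [this]; push_cast; rfl
  rw [htot, ← sum_filter_add_sum_filter_not _ (fun j => j ≤ t - (D + 1))] at hid
  have hs1 : (Icc 1 t).filter (fun j => j ≤ t - (D + 1)) = Icc 1 (t - (D + 1)) := by
    ext j; simp only [mem_filter, mem_Icc]; omega
  have hs2 : (Icc 1 t).filter (fun j => ¬ j ≤ t - (D + 1)) = Ioc (t - (D + 1)) t := by
    ext j; simp only [mem_filter, mem_Icc, mem_Ioc]; omega
  rw [hs1, hs2] at hid
  -- The identity has total `t * q ^ (t - D)`. While the cofactor has degree at least `D + 1`, each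
  -- `j` gives at most `q ^ (t - D)`, so at least `(D + 1) * q ^ (t - D)` must come from cofactors
  -- of degree at most `D`. Proper prime powers among these are exponentially negligible.
  have hmain : ∑ j ∈ Icc 1 (t - (D + 1)), ∑ x ∈ primePowers F j, (x.1.natDegree : ℝ) *
      ∑ g ∈ monics F (t - j), (if M ∣ g * x.1 ^ x.2 - c then (1 : ℝ) else 0) ≤
      ((t : ℝ) - (D + 1)) * 𝐪 ^ (t - D) := by
    have h1 : ∀ j ∈ Icc 1 (t - (D + 1)), ∑ x ∈ primePowers F j, (x.1.natDegree : ℝ) *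
        ∑ g ∈ monics F (t - j), (if M ∣ g * x.1 ^ x.2 - c then (1 : ℝ) else 0) ≤ 𝐪 ^ (t - D) := by
      intro j hj
      obtain ⟨hj1, hj2⟩ := mem_Icc.1 hj
      refine (sum_le_sum fun x _ => mul_le_mul_of_nonneg_left
        (sum_monics_dvd_mul_sub_le hM hc (by omega)) (by positivity)).trans ?_
      rw [← sum_mul, sum_primePowers j hj1, ← pow_add]
      exact le_of_eq (by congr 1; omega)
    refine (sum_le_sum h1).trans ?_
    rw [sum_const, nsmul_eq_mul, Nat.card_Icc, Nat.add_sub_cancel, Nat.cast_sub htD]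
    push_cast
    exact le_rfl
  have hedge : ∑ j ∈ Ioc (t - (D + 1)) t, ∑ x ∈ primePowers F j, (x.1.natDegree : ℝ) *
      ∑ g ∈ monics F (t - j), (if M ∣ g * x.1 ^ x.2 - c then (1 : ℝ) else 0) ≤
      ∑ j ∈ Ioc (t - (D + 1)) t, ∑ P ∈ irreds F j, (P.natDegree : ℝ) *
        (∑ g ∈ monics F (t - j), if M ∣ g * P - c then (1 : ℝ) else 0) +
      2 * (D + 1 : ℝ) * 𝐪 ^ t * ((4 / 3) ^ D * (3 / 4) ^ t) := by
    have h1 : ∀ j ∈ Ioc (t - (D + 1)) t, ∑ x ∈ primePowers F j, (x.1.natDegree : ℝ) *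
        ∑ g ∈ monics F (t - j), (if M ∣ g * x.1 ^ x.2 - c then (1 : ℝ) else 0) ≤
        ∑ P ∈ irreds F j, (P.natDegree : ℝ) *
        (∑ g ∈ monics F (t - j), if M ∣ g * P - c then (1 : ℝ) else 0) +
        2 * 𝐪 ^ t * ((4 / 3) ^ D * (3 / 4) ^ t) := by
      intro j hj
      obtain ⟨hj1, hj2⟩ := mem_Ioc.1 hj
      rw [← sum_filter_add_sum_filter_not _ (fun x : F[X] × ℕ => x.2 = 1)]
      refine add_le_add (le_of_eq ?_) ?_
      · rw [← sum_primePowers_one]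
        refine sum_congr rfl fun x hx => ?_
        rw [(mem_filter.1 hx).2, pow_one]
      · have h2 : ∀ x ∈ (primePowers F j).filter (fun x => ¬ x.2 = 1), (x.1.natDegree : ℝ) *
            ∑ g ∈ monics F (t - j), (if M ∣ g * x.1 ^ x.2 - c then (1 : ℝ) else 0) ≤
            (x.1.natDegree : ℝ) * 𝐪 ^ (t - j) := by
          intro x _
          refine mul_le_mul_of_nonneg_left ?_ (by positivity)
          rw [← card_monics_real, ← nsmul_one, ← sum_const]
          exact sum_le_sum fun g _ => by split_ifs <;> norm_num
        refine (sum_le_sum h2).trans ?_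
        rw [← sum_mul]
        have h3 := sum_primePowers_ne_one_le (F := F) j
        have h4 := pow_half_le (F := F) j
        have h5 : ((3 : ℝ) / 4) ^ j ≤ (4 / 3) ^ D * (3 / 4) ^ t := by
          have h6 : ((3 : ℝ) / 4) ^ t = (3 / 4) ^ j * (3 / 4) ^ (t - j) := by
            rw [← pow_add]; congr 1; omega
          have h7 : (1 : ℝ) ≤ (4 / 3) ^ D * (3 / 4) ^ (t - j) := by
            have h8 : ((3 : ℝ) / 4) ^ D ≤ (3 / 4) ^ (t - j) :=
              pow_le_pow_of_le_one (by norm_num) (by norm_num) (by omega)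
            calc (1 : ℝ) = (4 / 3) ^ D * (3 / 4) ^ D := by rw [← mul_pow]; norm_num
              _ ≤ _ := by gcongr
          rw [h6]
          have h9 : (0 : ℝ) ≤ (3 / 4) ^ j := by positivity
          nlinarith
        calc (∑ x ∈ (primePowers F j).filter (fun x => ¬ x.2 = 1), (x.1.natDegree : ℝ)) *
              𝐪 ^ (t - j) ≤ (2 * ((3 / 4) ^ j * 𝐪 ^ j)) * 𝐪 ^ (t - j) := by
              gcongr; exact h3.trans (by linarith)
          _ = 2 * (𝐪 ^ j * 𝐪 ^ (t - j)) * (3 / 4) ^ j := by ring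
          _ = 2 * 𝐪 ^ t * (3 / 4) ^ j := by rw [← pow_add]; congr 3; omega
          _ ≤ _ := by gcongr
    refine (sum_le_sum h1).trans ?_
    rw [sum_add_distrib, sum_const, nsmul_eq_mul, Nat.card_Ioc,
      show t - (t - (D + 1)) = D + 1 by omega]
    push_cast
    exact le_of_eq (by ring)
  have hqt : 𝐪 ^ t = 𝐪 ^ D * 𝐪 ^ (t - D) := by rw [← pow_add]; congr 1; omega
  have hD1 : 𝐪 ^ (t - D) ≤ (D + 1 : ℝ) * 𝐪 ^ (t - D) :=
    le_mul_of_one_le_left (by positivity) (by linarith [Nat.cast_nonneg (α := ℝ) D])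
  have herr2 : 2 * (D + 1 : ℝ) * 𝐪 ^ t * ((4 / 3) ^ D * (3 / 4) ^ t) ≤ 𝐪 ^ (t - D) / 2 := by
    calc 2 * (D + 1 : ℝ) * 𝐪 ^ t * ((4 / 3) ^ D * (3 / 4) ^ t)
        = 𝐪 ^ (t - D) * (2 * (D + 1 : ℝ) * 𝐪 ^ D * ((4 / 3) ^ D * (3 / 4) ^ t)) := by
          rw [hqt]; ring
      _ ≤ 𝐪 ^ (t - D) * (1 / (2 * 𝐪 ^ D)) := by gcongr
      _ ≤ 𝐪 ^ (t - D) * (1 / (2 * 1)) := by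
          gcongr
          exact one_le_pow₀ (by linarith [two_le_card (F := F)])
      _ = _ := by ring
  have hκ : 1 / (2 * 𝐪 ^ D) * 𝐪 ^ t = 𝐪 ^ (t - D) / 2 := by rw [hqt]; field_simp
  rw [hκ]
  linarith

open Classical in
/-- The pairs `(g, P)` with `P` prime, `deg g ≤ deg M`, `deg (g * P) = t` and `g * P ≡ c`. -/
noncomputable def primeMultiples (M c : F[X]) (t : ℕ) : Finset (F[X] × F[X]) :=
  (Ioc (t - (M.natDegree + 1)) t).biUnion fun j =>
    (irreds F j).biUnion fun P => ((monics F (t - j)).filter fun g => M ∣ g * P - c) ×ˢ {P}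

lemma mem_primeMultiples {M c : F[X]} {t : ℕ} (ht : M.natDegree + 1 ≤ t) {x : F[X] × F[X]} :
    x ∈ primeMultiples M c t ↔ x.1.Monic ∧ x.2.Monic ∧ Irreducible x.2 ∧
      x.1.natDegree ≤ M.natDegree ∧ x.1.natDegree + x.2.natDegree = t ∧ M ∣ x.1 * x.2 - c := by
  obtain ⟨g, P⟩ := x
  simp only [primeMultiples, mem_biUnion, mem_product, mem_filter, mem_singleton, mem_Ioc,
    mem_monics, mem_irreds]
  constructor
  · rintro ⟨j, ⟨h1, h2⟩, P', ⟨h3, rfl, h4⟩, ⟨⟨h5, h6⟩, h7⟩, rfl⟩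
    exact ⟨h5, h3, h4, by omega, by omega, h7⟩
  · rintro ⟨h1, h2, h3, h4, h5, h6⟩
    exact ⟨P.natDegree, ⟨by omega, by omega⟩, P, ⟨h2, rfl, h3⟩, ⟨⟨h1, by omega⟩, h6⟩, rfl⟩

lemma exists_le_card_primeMultiples {M : F[X]} (hM : M.Monic) : ∃ κ > 0, ∃ t₀ : ℕ, ∀ t ≥ t₀,
    M.natDegree + 1 ≤ t ∧ ∀ c : F[X], IsCoprime c M →
      κ * 𝐪 ^ t ≤ t * (#(primeMultiples M c t) : ℝ) := by
  classical
  obtain ⟨κ, hκ, t₀, h⟩ := exists_le_sum_irreds_dvd hM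
  refine ⟨κ, hκ, t₀, fun t ht => ⟨(h t ht).1, fun c hc => ((h t ht).2 c hc).trans ?_⟩⟩
  rw [primeMultiples, card_biUnion, Nat.cast_sum, mul_sum]
  · refine sum_le_sum fun j hj => ?_
    rw [card_biUnion, Nat.cast_sum, mul_sum]
    · refine sum_le_sum fun P hP => ?_
      rw [card_product, card_singleton, mul_one, ← sum_filter, sum_const, nsmul_eq_mul, mul_one,
        (mem_irreds.1 hP).2.1]
      have : (j : ℝ) ≤ t := by exact_mod_cast (mem_Ioc.1 hj).2
      gcongr
    · intro P _ P' _ hne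
      rw [Function.onFun, disjoint_left]
      rintro ⟨g, Q⟩ h1 h2
      simp only [mem_product, mem_singleton] at h1 h2
      exact hne (h1.2.symm.trans h2.2)
  · intro j _ j' _ hne
    rw [Function.onFun, disjoint_left]
    rintro ⟨g, Q⟩ h1 h2
    simp only [mem_biUnion, mem_product, mem_singleton, mem_irreds] at h1 h2
    obtain ⟨P, ⟨_, h3, _⟩, _, rfl⟩ := h1
    obtain ⟨P', ⟨_, h4, _⟩, _, rfl⟩ := h2
    exact hne (h3.symm.trans h4)

open Classical in
/-- The elements of an arithmetic progression whose prime factors all have degree at most `deg M`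
or more than `Y`. -/
noncomputable def roughProgression (M : F[X]) (Y : ℕ) (c : F[X]) (t : ℕ) : Finset F[X] :=
  (progression M c t).filter fun v =>
    ∀ P, P.Monic → Irreducible P → P ∣ v → P.natDegree ≤ M.natDegree ∨ Y < P.natDegree

lemma mem_roughProgression {M c v : F[X]} {Y t : ℕ} : v ∈ roughProgression M Y c t ↔
    ((v.Monic ∧ v.natDegree = t) ∧ M ∣ v - c) ∧
    ∀ P, P.Monic → Irreducible P → P ∣ v → P.natDegree ≤ M.natDegree ∨ Y < P.natDegree := by
  simp [roughProgression, mem_progression]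

lemma isCoprime_of_natDegree_lt {P M : F[X]} (hP : Irreducible P) (hM : M ≠ 0)
    (h : M.natDegree < P.natDegree) : IsCoprime P M :=
  (hP.coprime_iff_not_dvd).2 fun hd => by
    have := Polynomial.natDegree_le_of_dvd hd hM
    omega

lemma sum_three_quarters_le (s : Finset ℕ) : ∑ j ∈ s, ((3 : ℝ) / 4) ^ j ≤ 4 := by
  have h := tsum_geometric_of_lt_one (r := (3 / 4 : ℝ)) (by norm_num) (by norm_num)
  have h2 := Summable.sum_le_tsum s (fun i _ => by positivity)
    (summable_geometric_of_lt_one (r := (3 / 4 : ℝ)) (by norm_num) (by norm_num))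
  rw [h] at h2
  norm_num at h2 ⊢
  exact h2

/-- The induction of `card_rough_le` run for a lower bound. Primes of degree in `(Y, t - Y - (D +
1)]` leave a cofactor to which the induction hypothesis applies, in the class divided by the prime.
The missing degrees are paid for by the edge terms with cofactor of degree at most `D`, which is why
prime factors of degree at most `deg M` are admitted. -/
lemma exists_le_card_roughProgression {M : F[X]} (hM : M.Monic) : ∃ κ > 0, ∃ t₀ : ℕ, ∀ Y ≥ t₀,
    ∀ t ≥ Y + (M.natDegree + 1), ∀ c : F[X], IsCoprime c M →
      κ * 𝐪 ^ t ≤ Y * (#(roughProgression M Y c t) : ℝ) := by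
  classical
  obtain ⟨κ, hκ, t₀, h⟩ := exists_le_sum_irreds_dvd hM
  set D := M.natDegree with hD
  have hq := card_pos (F := F)
  refine ⟨κ / (D + 11), by positivity, max t₀ (D + 1), fun Y hY t => ?_⟩
  have hYD : D + 1 ≤ Y := (le_max_right _ _).trans hY
  have hY0 : (1 : ℝ) ≤ Y := by exact_mod_cast (show 1 ≤ Y by omega)
  set c₀ := κ / (D + 11) with hc₀
  have hc₀pos : 0 < c₀ := by positivity
  induction t using Nat.strong_induction_on with
  | _ t ih =>
    intro ht c hc
    obtain ⟨-, hedge⟩ := h t (by have := (le_max_left t₀ (D + 1)).trans hY; omega)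
    have hedge := hedge c hc
    have hcard : ∀ c s, (#(roughProgression M Y c s) : ℝ) =
        ∑ f ∈ monics F s, if f ∈ roughProgression M Y c s then (1 : ℝ) else 0 := by
      intro c s
      rw [← sum_filter, sum_const, nsmul_eq_mul, mul_one]
      congr 2
      ext f
      simp only [mem_filter]
      exact ⟨fun h => ⟨mem_monics.2 (mem_roughProgression.1 h).1.1, h⟩, fun h => h.2⟩
    set φ : F[X] → ℝ := fun f => if f ∈ roughProgression M Y c t then 1 else 0 with hφ
    have hφ0 : ∀ f, 0 ≤ φ f := fun f => by simp only [hφ]; split_ifs <;> norm_num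
    have hid := mul_sum_monics (F := F) t φ
    rw [← hcard] at hid
    have hprime : ∑ j ∈ Icc 1 t, ∑ P ∈ irreds F j,
        (P.natDegree : ℝ) * ∑ g ∈ monics F (t - j), φ (g * P) ≤
        t * (#(roughProgression M Y c t) : ℝ) := by
      rw [hid]
      refine sum_le_sum fun j _ => ?_
      rw [← sum_primePowers_one j fun P =>
        (P.natDegree : ℝ) * ∑ g ∈ monics F (t - j), φ (g * P)]
      refine le_trans (le_of_eq (sum_congr rfl fun x hx => ?_))
        (sum_le_sum_of_subset_of_nonneg (filter_subset _ _) fun x _ _ =>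
          mul_nonneg (by positivity) (sum_nonneg fun g _ => hφ0 _))
      rw [(mem_filter.1 hx).2, pow_one]
    have hφmul : ∀ j, Y < j → j ≤ t → ∀ P ∈ irreds F j, ∀ g ∈ monics F (t - j),
        (M ∣ g * P - c) → (∀ Q, Q.Monic → Irreducible Q → Q ∣ g →
          Q.natDegree ≤ D ∨ Y < Q.natDegree) → φ (g * P) = 1 := by
      intro j hj hjt P hP g hg hdvd hQ
      obtain ⟨hP1, hP2, hP3⟩ := mem_irreds.1 hP
      obtain ⟨hg1, hg2⟩ := mem_monics.1 hg
      refine if_pos (mem_roughProgression.2 ⟨⟨⟨hg1.mul hP1, ?_⟩, hdvd⟩, fun Q q1 q2 q3 => ?_⟩)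
      · rw [hg1.natDegree_mul hP1]; omega
      · rw [mul_comm] at q3
        rcases dvd_mul_prime hP1 q1 hP3 q2 q3 with rfl | h'
        · right; omega
        · exact hQ Q q1 q2 h'
    have hsplit : ∑ j ∈ Ioc (t - (D + 1)) t, (∑ P ∈ irreds F j,
          (P.natDegree : ℝ) * ∑ g ∈ monics F (t - j), φ (g * P)) +
        ∑ j ∈ Ioc Y (t - Y - (D + 1)), (∑ P ∈ irreds F j,
          (P.natDegree : ℝ) * ∑ g ∈ monics F (t - j), φ (g * P)) ≤
        ∑ j ∈ Icc 1 t, ∑ P ∈ irreds F j,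
          (P.natDegree : ℝ) * ∑ g ∈ monics F (t - j), φ (g * P) := by
      rw [← sum_union]
      · refine sum_le_sum_of_subset_of_nonneg ?_ fun j _ _ => sum_nonneg fun P _ =>
          mul_nonneg (by positivity) (sum_nonneg fun g _ => hφ0 _)
        intro j hj
        simp only [mem_union, mem_Ioc, mem_Icc] at hj ⊢
        omega
      · rw [disjoint_left]
        intro j hj hj'
        simp only [mem_Ioc] at hj hj'
        omega
    have hA : ∑ j ∈ Ioc (t - (D + 1)) t, ∑ P ∈ irreds F j, (P.natDegree : ℝ) *
        (∑ g ∈ monics F (t - j), if M ∣ g * P - c then (1 : ℝ) else 0) ≤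
        ∑ j ∈ Ioc (t - (D + 1)) t, (∑ P ∈ irreds F j,
          (P.natDegree : ℝ) * ∑ g ∈ monics F (t - j), φ (g * P)) := by
      refine sum_le_sum fun j hj => sum_le_sum fun P hP => mul_le_mul_of_nonneg_left
        (sum_le_sum fun g hg => ?_) (by positivity)
      obtain ⟨hj1, hj2⟩ := mem_Ioc.1 hj
      split_ifs with hdvd
      · rw [hφmul j (by omega) hj2 P hP g hg hdvd fun Q q1 q2 q3 => Or.inl ?_]
        have := Polynomial.natDegree_le_of_dvd q3 (mem_monics.1 hg).1.ne_zero
        have := (mem_monics.1 hg).2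
        omega
      · exact hφ0 _
    -- About `t - 2 Y - (D + 1)` degrees are available, and the `8` is the total error `2 * 4` of
    -- the prime counts.
    have hB : c₀ * 𝐪 ^ t / Y * ((t : ℝ) - 2 * Y - (D + 1) - 8) ≤
        ∑ j ∈ Ioc Y (t - Y - (D + 1)), (∑ P ∈ irreds F j,
          (P.natDegree : ℝ) * ∑ g ∈ monics F (t - j), φ (g * P)) := by
      have h1 : ∀ j ∈ Ioc Y (t - Y - (D + 1)), c₀ * 𝐪 ^ t / Y * (1 - 2 * (3 / 4) ^ j) ≤
          ∑ P ∈ irreds F j, (P.natDegree : ℝ) * ∑ g ∈ monics F (t - j), φ (g * P) := by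
        intro j hj
        obtain ⟨hj1, hj2⟩ := mem_Ioc.1 hj
        have h2 : ∀ P ∈ irreds F j, (j : ℝ) * (c₀ * 𝐪 ^ (t - j) / Y) ≤
            (P.natDegree : ℝ) * ∑ g ∈ monics F (t - j), φ (g * P) := by
          intro P hP
          obtain ⟨hP1, hP2, hP3⟩ := mem_irreds.1 hP
          rw [hP2]
          refine mul_le_mul_of_nonneg_left ?_ (by positivity)
          obtain ⟨c', hc', hiff⟩ := exists_inverse_class
            (isCoprime_of_natDegree_lt hP3 hM.ne_zero (by omega)) hc
          rw [div_le_iff₀' (by linarith)]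
          refine (ih (t - j) (by omega) (by omega) c' hc').trans ?_
          refine mul_le_mul_of_nonneg_left ?_ (by positivity)
          rw [hcard]
          refine sum_le_sum fun g hg => ?_
          split_ifs with hmem
          · obtain ⟨⟨h3, h4⟩, h5⟩ := mem_roughProgression.1 hmem
            rw [hφmul j hj1 (by omega) P hP g hg ((hiff g).2 h4) h5]
          · exact hφ0 _
        refine le_trans ?_ (sum_le_sum h2)
        rw [sum_const, nsmul_eq_mul]
        have h3 := le_card_irreds (F := F) j (by omega)
        have h4 : 𝐪 ^ t = 𝐪 ^ j * 𝐪 ^ (t - j) := by rw [← pow_add]; congr 1; omega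
        calc c₀ * 𝐪 ^ t / Y * (1 - 2 * (3 / 4) ^ j)
            = 𝐪 ^ j * (1 - 2 * (3 / 4) ^ j) * (c₀ * 𝐪 ^ (t - j) / Y) := by rw [h4]; ring
          _ ≤ j * (#(irreds F j) : ℝ) * (c₀ * 𝐪 ^ (t - j) / Y) := by gcongr
          _ = _ := by ring
      refine le_trans ?_ (sum_le_sum h1)
      rw [← mul_sum, sum_sub_distrib, ← mul_sum, sum_const, nsmul_eq_mul, mul_one, Nat.card_Ioc]
      have h2 := sum_three_quarters_le (Ioc Y (t - Y - (D + 1)))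
      have h3 : (t : ℝ) - 2 * Y - (D + 1) ≤ ((t - Y - (D + 1) - Y : ℕ) : ℝ) := by
        have : t ≤ (t - Y - (D + 1) - Y) + (2 * Y + (D + 1)) := by omega
        have h4 : (t : ℝ) ≤ ((t - Y - (D + 1) - Y : ℕ) : ℝ) + (2 * Y + (D + 1)) := by
          exact_mod_cast this
        linarith
      gcongr
      linarith
    have hfin := (add_le_add (hedge.trans hA) hB).trans (hsplit.trans hprime)
    have ht0 : (0 : ℝ) < t := by exact_mod_cast (show 0 < t by omega)
    have hκ' : κ = c₀ * (D + 11) := by rw [hc₀]; field_simp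
    have hge : c₀ * 𝐪 ^ t / Y * t ≤
        κ * 𝐪 ^ t + c₀ * 𝐪 ^ t / Y * ((t : ℝ) - 2 * Y - (D + 1) - 8) := by
      -- The divisor `D + 11` in `c₀` is chosen so that `2 Y + (D + 1) + 8 ≤ Y * (D + 11)` for `Y ≥
      -- 1`.
      have h1 : c₀ * 𝐪 ^ t / Y * (2 * Y + (D + 1) + 8) ≤ κ * 𝐪 ^ t := by
        rw [hκ']
        calc c₀ * 𝐪 ^ t / Y * (2 * Y + (D + 1) + 8) ≤ c₀ * 𝐪 ^ t / Y * (Y * (D + 11)) := by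
              gcongr
              nlinarith [Nat.cast_nonneg (α := ℝ) D]
          _ = _ := by field_simp
      linarith
    have h2 := hge.trans hfin
    rw [mul_comm] at h2
    have h3 := le_of_mul_le_mul_left h2 ht0
    rw [div_le_iff₀' (by linarith)] at h3
    exact h3

end Progressions

end PolyTable

namespace PolyTable
open Finset

/-! ### Blocks of primes of weight at least `log 2` -/

section PrimeBlocks

set_option linter.unusedSectionVars false

variable {F : Type*} [Field F] [Fintype F]

/-- The cardinality of the field, as a real number. -/
local notation "𝐪" => (Fintype.card F : ℝ)

open Classical in
variable (F) in
/-- The monic irreducible polynomials of degree in `[N - 1, N * 2 ^ J - 1)`. -/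
noncomputable def blockPrimes (N J : ℕ) : Finset F[X] :=
  (Ico (N - 1) (N * 2 ^ J - 1)).biUnion fun m => irreds F m

lemma mem_blockPrimes {N J : ℕ} {P : F[X]} : P ∈ blockPrimes F N J ↔
    P.Monic ∧ Irreducible P ∧ N - 1 ≤ P.natDegree ∧ P.natDegree < N * 2 ^ J - 1 := by
  simp only [blockPrimes, mem_biUnion, mem_Ico, mem_irreds]
  constructor
  · rintro ⟨m, ⟨h1, h2⟩, h3, rfl, h4⟩; exact ⟨h3, h4, h1, h2⟩
  · rintro ⟨h1, h2, h3, h4⟩; exact ⟨_, ⟨h3, h4⟩, h1, rfl, h2⟩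

/-- The index `i` of the block `[N * 2 ^ i - 1, N * 2 ^ (i + 1) - 1)` containing `deg P`. -/
noncomputable def blockIndex (N : ℕ) (P : F[X]) : ℕ := Nat.log 2 ((P.natDegree + 1) / N)

lemma blockIndex_eq_iff {N i : ℕ} (hN : 1 ≤ N) {P : F[X]} (hP : N ≤ P.natDegree + 1) :
    blockIndex N P = i ↔ N * 2 ^ i ≤ P.natDegree + 1 ∧ P.natDegree + 1 < N * 2 ^ (i + 1) := by
  unfold blockIndex
  rw [Nat.log_eq_iff (Or.inr ⟨by norm_num, (Nat.div_pos hP (by omega)).ne'⟩),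
    Nat.le_div_iff_mul_le (by omega), Nat.div_lt_iff_lt_mul (by omega), mul_comm N, mul_comm N]

lemma blockIndex_lt {N J : ℕ} (hN : 1 ≤ N) {P : F[X]} (hP : P ∈ blockPrimes F N J) :
    blockIndex N P < J := by
  obtain ⟨_, _, h1, h2⟩ := mem_blockPrimes.1 hP
  have h3 := ((blockIndex_eq_iff hN (P := P) (by omega)).1 rfl).1
  by_contra hJ
  have h4 : N * 2 ^ J ≤ N * 2 ^ blockIndex N P :=
    Nat.mul_le_mul_left _ (Nat.pow_le_pow_right (by norm_num) (not_lt.1 hJ))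
  omega

lemma blocks_blockPrimes {N J i : ℕ} (hN : 1 ≤ N) (hi : i < J) :
    blocks (blockPrimes F N J) (blockIndex N) i (i + 1) =
      (blockPrimes F N (i + 1)).filter fun P => N * 2 ^ i - 1 ≤ P.natDegree := by
  have h1 : N * 2 ^ (i + 1) ≤ N * 2 ^ J :=
    Nat.mul_le_mul_left _ (Nat.pow_le_pow_right (by norm_num) hi)
  have h2 : 1 ≤ N * 2 ^ (i + 1) := Nat.mul_pos hN (by positivity)
  have h3 : N ≤ N * 2 ^ i := Nat.le_mul_of_pos_right _ (by positivity)
  ext P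
  rw [blocks, mem_filter, mem_filter, mem_blockPrimes, mem_blockPrimes]
  constructor
  · rintro ⟨⟨a1, a2, a3, a4⟩, a5, a6⟩
    have := (blockIndex_eq_iff (i := i) hN (P := P) (by omega)).1 (by omega)
    exact ⟨⟨a1, a2, a3, by omega⟩, by omega⟩
  · rintro ⟨⟨a1, a2, a3, a4⟩, a5⟩
    have := (blockIndex_eq_iff (i := i) hN (P := P) (by omega)).2 ⟨by omega, by omega⟩
    exact ⟨⟨a1, a2, a3, by omega⟩, by omega, by omega⟩

lemma sum_irreds_normInv_ge {m : ℕ} (hm : 1 ≤ m) :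
    1 / (m : ℝ) * (1 - 2 * (3 / 4) ^ m) ≤ ∑ P ∈ irreds F m, normInv P := by
  have hm0 : (0 : ℝ) < m := by exact_mod_cast hm
  have hq := card_pos (F := F)
  have h : ∑ P ∈ irreds F m, normInv P = ∑ _P ∈ irreds F m, (𝐪 ^ m)⁻¹ :=
    sum_congr rfl fun P hP => by rw [normInv, (mem_irreds.1 hP).2.1]
  rw [h, sum_const, nsmul_eq_mul, ← div_eq_mul_inv, le_div_iff₀ (by positivity)]
  have h1 := le_card_irreds (F := F) m hm
  rw [← div_le_iff₀' hm0] at h1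
  refine le_trans (le_of_eq ?_) h1
  ring

lemma sum_Ico_three_quarters_le (a b : ℕ) :
    ∑ m ∈ Ico a b, ((3 : ℝ) / 4) ^ m ≤ 4 * (3 / 4) ^ a := by
  rw [sum_Ico_eq_sum_range]
  simp_rw [pow_add]
  rw [← mul_sum, mul_comm (4 : ℝ)]
  exact mul_le_mul_of_nonneg_left (sum_three_quarters_le _) (by positivity)

/-- The interval `[E, 2 E]` includes both ends, so the harmonic sum exceeds `log 2` by at least `1 /
(4 E)`. This pays for the error in the count of primes once `E ≥ 13`. It is the reason for the shift
by one in the block limits. -/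
lemma log_two_le_sum_Ico {E : ℕ} (hE : 13 ≤ E) :
    Real.log 2 ≤ ∑ m ∈ Ico E (2 * E + 1), 1 / (m : ℝ) * (1 - 2 * (3 / 4) ^ m) := by
  have hE0 : (0 : ℝ) < E := by exact_mod_cast (show 0 < E by omega)
  have h1 := le_sum_Ico_one_div (a := E) (b := 2 * E + 1) (by omega) (by omega)
  have h2 : ∑ m ∈ Ico E (2 * E + 1), 1 / (m : ℝ) * (2 * (3 / 4) ^ m) ≤ 1 / (4 * E) := by
    calc ∑ m ∈ Ico E (2 * E + 1), 1 / (m : ℝ) * (2 * (3 / 4) ^ m)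
        ≤ ∑ m ∈ Ico E (2 * E + 1), 1 / (E : ℝ) * (2 * (3 / 4) ^ m) := by
          refine sum_le_sum fun m hm => ?_
          have : (E : ℝ) ≤ m := by exact_mod_cast (mem_Ico.1 hm).1
          gcongr
      _ = 2 / E * ∑ m ∈ Ico E (2 * E + 1), ((3 : ℝ) / 4) ^ m := by
          rw [mul_sum]; exact sum_congr rfl fun m _ => by ring
      _ ≤ 2 / E * (4 * (3 / 4) ^ E) := by gcongr; exact sum_Ico_three_quarters_le _ _
      _ ≤ 2 / E * (4 * (3 / 4) ^ 13) := by
          gcongr 2 / E * (4 * ?_)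
          exact pow_le_pow_of_le_one (by norm_num) (by norm_num) hE
      _ ≤ 2 / E * (1 / 8) := by gcongr; norm_num
      _ = _ := by field_simp; norm_num
  have h3 : Real.log 2 + 1 / (4 * E) ≤ Real.log ((2 * E + 1 : ℕ) : ℝ) - Real.log E := by
    rw [← Real.log_div (by positivity) hE0.ne']
    have h4 : (((2 * E + 1 : ℕ) : ℝ) / E) = 2 * (1 + 1 / (2 * E)) := by
      push_cast; field_simp
    rw [h4, Real.log_mul (by norm_num) (by positivity)]
    have h5 := Real.one_sub_inv_le_log_of_pos (x := 1 + 1 / (2 * (E : ℝ))) (by positivity)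
    have h6 : 1 / (4 * (E : ℝ)) ≤ 1 - (1 + 1 / (2 * (E : ℝ)))⁻¹ := by
      have h7 : 1 - (1 + 1 / (2 * (E : ℝ)))⁻¹ = 1 / (2 * E + 1) := by field_simp; ring
      rw [h7]
      have : (1 : ℝ) ≤ E := by exact_mod_cast (show 1 ≤ E by omega)
      exact one_div_le_one_div_of_le (by positivity) (by linarith)
    linarith
  have h4 : ∑ m ∈ Ico E (2 * E + 1), 1 / (m : ℝ) * (1 - 2 * (3 / 4) ^ m) =
      ∑ m ∈ Ico E (2 * E + 1), 1 / (m : ℝ) -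
      ∑ m ∈ Ico E (2 * E + 1), 1 / (m : ℝ) * (2 * (3 / 4) ^ m) := by
    rw [← sum_sub_distrib]; exact sum_congr rfl fun m _ => by ring
  rw [h4]
  linarith

lemma log_two_le_sum_block {N : ℕ} (hN : 14 ≤ N) (i : ℕ) :
    Real.log 2 ≤ ∑ P ∈ (blockPrimes F N (i + 1)).filter (fun P => N * 2 ^ i - 1 ≤ P.natDegree),
      normInv P := by
  classical
  have h3 : N ≤ N * 2 ^ i := Nat.le_mul_of_pos_right _ (by positivity)
  have hE : 2 * (N * 2 ^ i - 1) + 1 = N * 2 ^ (i + 1) - 1 := by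
    rw [pow_succ, ← mul_assoc]; omega
  have h4 : (blockPrimes F N (i + 1)).filter (fun P => N * 2 ^ i - 1 ≤ P.natDegree) =
      (Ico (N * 2 ^ i - 1) (2 * (N * 2 ^ i - 1) + 1)).biUnion fun m => irreds F m := by
    rw [hE]
    ext P
    simp only [mem_filter, mem_blockPrimes, mem_biUnion, mem_Ico, mem_irreds]
    constructor
    · rintro ⟨⟨a1, a2, a3, a4⟩, a5⟩; exact ⟨_, ⟨a5, a4⟩, a1, rfl, a2⟩
    · rintro ⟨m, ⟨a1, a2⟩, a3, rfl, a4⟩; exact ⟨⟨a3, a4, by omega, a2⟩, a1⟩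
  rw [h4, sum_biUnion]
  · refine (log_two_le_sum_Ico (by omega)).trans (sum_le_sum fun m hm => ?_)
    exact sum_irreds_normInv_ge (by have := mem_Ico.1 hm; omega)
  · intro m _ m' _ hne
    rw [Function.onFun, disjoint_left]
    intro P h1 h2
    exact hne ((mem_irreds.1 h1).2.1.symm.trans (mem_irreds.1 h2).2.1)

open Classical in
lemma exists_le_sum_subsums_blockPrimes : ∃ c K : ℝ, 0 < c ∧ 0 < K ∧
    ∀ (F : Type*) [Field F] [Fintype F] (N J : ℕ), 14 ≤ N → 2 ≤ J →
    c * (rate ^ J * decay J) ≤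
      ∑ a ∈ (blockPrimes F N J).powerset.filter
        (fun a => ∑ P ∈ a, (P.natDegree : ℝ) ≤ K * N * 2 ^ J),
        (∏ P ∈ a, normInv P) * (#(subsums Polynomial.natDegree a) : ℝ) := by
  obtain ⟨c, K, hc, hK, h⟩ := exists_le_sum_card_subsums
  refine ⟨c, 2 * K, hc, by positivity, fun F _ _ N J hN hJ => ?_⟩
  have hN1 : 1 ≤ N := by omega
  set Z : ℕ → ℝ := fun i => ∑ P ∈ (blockPrimes F N (i + 1)).filter
    (fun P => N * 2 ^ i - 1 ≤ P.natDegree), normInv P with hZ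
  have hZlog : ∀ i, Real.log 2 ≤ Z i := fun i => log_two_le_sum_block hN i
  have hZpos : ∀ i, 0 < Z i := fun i => log_two_pos.trans_le (hZlog i)
  -- The weights are scaled down so that every block has mass exactly `log 2`; since they only
  -- decrease, a lower bound for `w` is one for `normInv`.
  set w : F[X] → ℝ := fun P => Real.log 2 / Z (blockIndex N P) * normInv P with hw
  have hw0 : ∀ P, 0 ≤ w P := fun P => by
    have := hZpos (blockIndex N P); have := log_two_pos; have := (normInv_pos P).le
    simp only [hw]; positivity
  have hwle : ∀ P, w P ≤ normInv P := fun P =>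
    mul_le_of_le_one_left (normInv_pos P).le ((div_le_one (hZpos _)).2 (hZlog _))
  have hdeg : ∀ P ∈ blockPrimes F N J, N * 2 ^ blockIndex N P ≤ P.natDegree + 1 ∧
      P.natDegree + 1 < N * 2 ^ (blockIndex N P + 1) := fun P hP =>
    (blockIndex_eq_iff hN1 (by have := (mem_blockPrimes.1 hP).2.2.1; omega)).1 rfl
  have key := h F[X] w Polynomial.natDegree (blockIndex N) (blockPrimes F N J) J (2 * N)
    (fun i => (1 / 2) ^ (N * 2 ^ i - 1)) hJ (by positivity) hw0
    (fun P hP => blockIndex_lt hN1 hP) ?_ ?_ ?_ ?_ (fun i => by positivity) ?_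
  · refine key.trans ?_
    have e : K * (2 * (N : ℝ)) * 2 ^ J = 2 * K * N * 2 ^ J := by ring
    rw [e]
    refine sum_le_sum fun a _ => mul_le_mul_of_nonneg_right ?_ (by positivity)
    exact prod_le_prod (fun P _ => hw0 P) fun P _ => hwle P
  · intro i hi
    rw [blocks_blockPrimes hN1 hi]
    have h1 : ∀ P ∈ (blockPrimes F N (i + 1)).filter (fun P => N * 2 ^ i - 1 ≤ P.natDegree),
        w P = Real.log 2 / Z i * normInv P := by
      intro P hP
      rw [← blocks_blockPrimes hN1 (Nat.lt_succ_self i), blocks, mem_filter] at hP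
      have : blockIndex N P = i := by omega
      simp only [hw, this]
    rw [sum_congr rfl h1, ← mul_sum]
    exact div_mul_cancel₀ _ (hZpos i).ne'
  · intro i hi m
    rw [blocks_blockPrimes hN1 hi]
    have hNi : N ≤ N * 2 ^ i := Nat.le_mul_of_pos_right _ (by positivity)
    by_cases hm : N * 2 ^ i - 1 ≤ m
    · have hm1 : 2 ^ i ≤ m := by
        have h1 : 14 * 2 ^ i ≤ N * 2 ^ i := Nat.mul_le_mul_right _ hN
        have h2 : 1 ≤ 2 ^ i := Nat.one_le_two_pow
        omega
      have hm2 : 1 ≤ m := Nat.one_le_two_pow.trans hm1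
      calc _ ≤ ∑ P ∈ irreds F m, normInv P := by
            refine (sum_le_sum fun P _ => hwle P).trans
              (sum_le_sum_of_subset_of_nonneg (fun P hP => ?_) fun P _ _ => (normInv_pos P).le)
            obtain ⟨h1, h2⟩ := mem_filter.1 hP
            obtain ⟨h3, h4, _⟩ := mem_blockPrimes.1 (mem_filter.1 h1).1
            exact mem_irreds.2 ⟨h3, h2, h4⟩
        _ ≤ 1 / m := sum_normInv_irreds_le hm2
        _ ≤ (1 / 2) ^ i := by
            rw [one_div_pow]
            exact one_div_le_one_div_of_le (by positivity) (by exact_mod_cast hm1)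
    · rw [filter_eq_empty_iff.2, sum_empty]
      · positivity
      · intro P hP heq
        have := (mem_filter.1 hP).2
        omega
  · intro P hP
    have h1 := (hdeg P hP).2
    have h2 : P.natDegree ≤ 2 * N * 2 ^ blockIndex N P := by
      rw [pow_succ] at h1; linarith
    exact_mod_cast h2
  · intro P hP
    refine (hwle P).trans ?_
    have h1 := (hdeg P hP).1
    rw [normInv, one_div, inv_pow]
    refine inv_anti₀ (by positivity) ?_
    calc (2 : ℝ) ^ (N * 2 ^ blockIndex N P - 1) ≤ 2 ^ P.natDegree :=
          pow_le_pow_right₀ (by norm_num) (by omega)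
      _ ≤ _ := pow_le_pow_left₀ (by norm_num) two_le_card _
  · intro i
    have h1 : i + 1 ≤ 2 ^ i := Nat.lt_two_pow_self
    have h2 : ((i : ℝ) + 1) ^ 2 ≤ (2 ^ i) ^ 2 := by
      have : (i : ℝ) + 1 ≤ 2 ^ i := by exact_mod_cast h1
      gcongr
    have h3 : 3 * i + 3 ≤ N * 2 ^ i - 1 := by
      have : 14 * 2 ^ i ≤ N * 2 ^ i := Nat.mul_le_mul_right _ hN
      omega
    calc ((i : ℝ) + 1) ^ 2 * (1 / 2) ^ (N * 2 ^ i - 1)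
        ≤ (2 ^ i) ^ 2 * (1 / 2) ^ (3 * i + 3) := by
          refine mul_le_mul h2 (pow_le_pow_of_le_one (by norm_num) (by norm_num) h3)
            (by positivity) (by positivity)
      _ = (1 / 2) ^ (i + 2) * (1 / 2) := by
          rw [show 3 * i + 3 = (i + 2) + 1 + i + i by ring, pow_add, pow_add, pow_add]
          have : (2 : ℝ) ^ i * (1 / 2) ^ i = 1 := by rw [← mul_pow]; norm_num
          linear_combination (1 / 2) ^ (i + 2) * (1 / 2) * ((2 : ℝ) ^ i * (1 / 2) ^ i + 1) * this
      _ ≤ (1 / 2) ^ (i + 2) * Real.log 2 := by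
          gcongr
          linarith [one_lt_two_log_two]

end PrimeBlocks

end PolyTable

namespace PolyTable
open Finset

/-! ### Lower bound for `H₂` with a common modulus -/

section LowerBound

set_option linter.unusedSectionVars false

variable {F : Type*} [Field F] [Fintype F]

/-- The cardinality of the field, as a real number. -/
local notation "𝐪" => (Fintype.card F : ℝ)

lemma mem_of_dvd_prod {A : Finset F[X]} (hA : ∀ P ∈ A, P.Monic ∧ Irreducible P) {Q : F[X]}
    (hQ : Q.Monic) (hQi : Irreducible Q) (h : Q ∣ ∏ P ∈ A, P) : Q ∈ A := by
  obtain ⟨P, hP, hd⟩ := hQi.prime.exists_mem_finset_dvd h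
  rwa [Polynomial.eq_of_monic_of_associated hQ (hA P hP).1
    (hQi.associated_of_dvd (hA P hP).2 hd)]

lemma prime_dvd_cases {A : Finset F[X]} (hA : ∀ P ∈ A, P.Monic ∧ Irreducible P) {Q P g v : F[X]}
    (hQ : Q.Monic) (hQi : Irreducible Q) (hP : P.Monic) (hPi : Irreducible P) (hg : g ≠ 0)
    (h : Q ∣ (∏ P ∈ A, P) * (g * P) * v) :
    Q ∈ A ∨ Q.natDegree ≤ g.natDegree ∨ Q = P ∨ Q ∣ v := by
  rcases hQi.prime.dvd_or_dvd h with h | h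
  · rcases hQi.prime.dvd_or_dvd h with h | h
    · exact Or.inl (mem_of_dvd_prod hA hQ hQi h)
    · rw [mul_comm] at h
      rcases dvd_mul_prime hP hQ hPi hQi h with h | h
      · exact Or.inr (Or.inr (Or.inl h))
      · exact Or.inr (Or.inl (Polynomial.natDegree_le_of_dvd h hg))
  · exact Or.inr (Or.inr (Or.inr h))

open Classical in
lemma card_prime_divisors_le {T : Finset F[X]} {f : F[X]} {b : ℕ} (hb : 1 ≤ b) (hf : f ≠ 0)
    (hT : ∀ P ∈ T, P.Monic ∧ Irreducible P ∧ P ∣ f ∧ b < 2 * P.natDegree)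
    (hfb : f.natDegree ≤ 6 * b) : #T ≤ 12 := by
  have h1 : ∏ P ∈ T, P ∣ f := by
    refine Finset.prod_dvd_of_coprime (fun P hP Q hQ hne => ?_) fun P hP => (hT P hP).2.2.1
    refine ((hT P hP).2.1.coprime_iff_not_dvd).2 fun hd => hne ?_
    exact Polynomial.eq_of_monic_of_associated (hT P hP).1 (hT Q hQ).1
      ((hT P hP).2.1.associated_of_dvd (hT Q hQ).2.1 hd)
  have h2 := Polynomial.natDegree_le_of_dvd h1 hf
  rw [Polynomial.natDegree_prod_of_monic _ _ fun P hP => (hT P hP).1] at h2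
  have h3 : #T * b ≤ ∑ P ∈ T, 2 * P.natDegree := by
    rw [← smul_eq_mul]
    exact card_nsmul_le_sum _ _ _ fun P hP => (hT P hP).2.2.2.le
  rw [← mul_sum] at h3
  have h4 : #T * b ≤ 12 * b := by omega
  exact Nat.le_of_mul_le_mul_right h4 hb

/-- The congruence conditions on the cofactors of a prescribed subproduct. -/
lemma exists_cofactor_classes [DecidableEq F[X]] {M B₁ B₂ : F[X]}
    (hB₁ : IsCoprime B₁ M) (hB₂ : IsCoprime B₂ M)
    {a : Finset F[X]} (ha : ∀ P ∈ a, IsCoprime P M) {l : ℕ}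
    (hl : l ∈ subsums Polynomial.natDegree a) :
    ∃ (d : Finset F[X]) (c₁ c₂ : F[X]), d ⊆ a ∧ ∑ P ∈ d, P.natDegree = l ∧ IsCoprime c₁ M ∧
      IsCoprime c₂ M ∧ (∀ g, M ∣ g - c₁ → M ∣ g * (∏ P ∈ d, P) - B₁) ∧
      (∀ g, M ∣ g - c₂ → M ∣ g * (∏ P ∈ a \ d, P) - B₂) := by
  obtain ⟨d, hd, hdl⟩ := mem_subsums.1 hl
  have h1 : IsCoprime (∏ P ∈ d, P) M := IsCoprime.prod_left fun P hP => ha P (hd hP)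
  have h2 : IsCoprime (∏ P ∈ a \ d, P) M :=
    IsCoprime.prod_left fun P hP => ha P (Finset.mem_sdiff.1 hP).1
  obtain ⟨c₁, hc₁, h3⟩ := exists_inverse_class h1 hB₁
  obtain ⟨c₂, hc₂, h4⟩ := exists_inverse_class h2 hB₂
  exact ⟨d, c₁, c₂, hd, hdl, hc₁, hc₂, fun g => (h3 g).2, fun g => (h4 g).2⟩

lemma H₂_subset_monicOfDegree {n b : ℕ} (hb : b ≤ n) (A₁ A₂ M₁ M₂ : F[X]) :
    H₂ n b A₁ A₂ M₁ M₂ ⊆ MonicOfDegree F n := by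
  rintro P ⟨G₁, hG₁, G₂, hG₂, _, _, rfl⟩
  refine ⟨hG₁.1.mul hG₂.1, ?_⟩
  rw [hG₁.1.natDegree_mul hG₂.1, hG₁.2, hG₂.2]
  omega

open Classical in
/-- Counting the products `(∏ a) * (g * P) * v`, given that few of them coincide. -/
lemma exists_card_tuples_le {M B₁ B₂ : F[X]} (hB₁ : IsCoprime B₁ M) (hB₂ : IsCoprime B₂ M)
    (hM : M ≠ 0) {N J n b Y : ℕ} (hN : M.natDegree + 2 ≤ N) (hbn : 2 * b ≤ n)
    (hNb : 8 * (N * 2 ^ J) ≤ b) (hDb : 8 * (M.natDegree + 1) ≤ b) (hYb : b ≤ 8 * Y)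
    (hY : n ≤ 6 * b ∨ b ≤ Y) (𝒜 : Finset (Finset F[X]))
    (h𝒜 : ∀ a ∈ 𝒜, a ⊆ blockPrimes F N J ∧ 8 * ∑ P ∈ a, P.natDegree ≤ b) :
    ∃ c₁ c₂ : Finset F[X] → ℕ → F[X],
      (∀ a ∈ 𝒜, ∀ l ∈ subsums Polynomial.natDegree a,
        IsCoprime (c₁ a l) M ∧ IsCoprime (c₂ a l) M) ∧
      ∑ a ∈ 𝒜, ∑ l ∈ subsums Polynomial.natDegree a, #(primeMultiples M (c₁ a l) (b - l)) *
        #(roughProgression M Y (c₂ a l) (n - b - (∑ P ∈ a, P.natDegree - l))) ≤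
      #((range (M.natDegree + 1)).biUnion fun s => monics F s) * 12 *
        (H₂ n b B₁ B₂ M M).ncard := by
  set D := M.natDegree with hD
  have hpr : ∀ a ∈ 𝒜, ∀ P ∈ a, P.Monic ∧ Irreducible P := fun a ha P hP =>
    ⟨(mem_blockPrimes.1 ((h𝒜 a ha).1 hP)).1, (mem_blockPrimes.1 ((h𝒜 a ha).1 hP)).2.1⟩
  have hco : ∀ a ∈ 𝒜, ∀ P ∈ a, IsCoprime P M := fun a ha P hP => by
    have := (mem_blockPrimes.1 ((h𝒜 a ha).1 hP)).2.2.1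
    exact isCoprime_of_natDegree_lt (hpr a ha P hP).2 hM (by omega)
  have hdata : ∀ (a : Finset F[X]) (l : ℕ), ∃ (d : Finset F[X]) (c₁ c₂ : F[X]), a ∈ 𝒜 →
      l ∈ subsums Polynomial.natDegree a →
      d ⊆ a ∧ ∑ P ∈ d, P.natDegree = l ∧ IsCoprime c₁ M ∧
      IsCoprime c₂ M ∧ (∀ g, M ∣ g - c₁ → M ∣ g * (∏ P ∈ d, P) - B₁) ∧
      (∀ g, M ∣ g - c₂ → M ∣ g * (∏ P ∈ a \ d, P) - B₂) := by
    intro a l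
    by_cases h : a ∈ 𝒜 ∧ l ∈ subsums Polynomial.natDegree a
    · obtain ⟨d, c₁, c₂, h'⟩ := exists_cofactor_classes hB₁ hB₂ (hco a h.1) h.2
      exact ⟨d, c₁, c₂, fun _ _ => h'⟩
    · exact ⟨∅, 0, 0, fun h1 h2 => absurd ⟨h1, h2⟩ h⟩
  choose d c₁ c₂ hdc using hdata
  refine ⟨c₁, c₂, fun a ha l hl => ⟨(hdc a l ha hl).2.2.1, (hdc a l ha hl).2.2.2.1⟩, ?_⟩
  set Ω := 𝒜.sigma fun a => (subsums Polynomial.natDegree a).sigma fun l =>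
    primeMultiples M (c₁ a l) (b - l) ×ˢ
      roughProgression M Y (c₂ a l) (n - b - (∑ P ∈ a, P.natDegree - l)) with hΩ
  have hcardΩ : #Ω = ∑ a ∈ 𝒜, ∑ l ∈ subsums Polynomial.natDegree a,
      #(primeMultiples M (c₁ a l) (b - l)) *
        #(roughProgression M Y (c₂ a l) (n - b - (∑ P ∈ a, P.natDegree - l))) := by
    simp only [hΩ, card_sigma, card_product]
  rw [← hcardΩ]
  set f : (Σ _ : Finset F[X], Σ _ : ℕ, (F[X] × F[X]) × F[X]) → F[X] :=
    fun x => (∏ P ∈ x.1, P) * (x.2.2.1.1 * x.2.2.1.2) * x.2.2.2 with hf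
  have hmem : ∀ x ∈ Ω, x.1 ∈ 𝒜 ∧ x.2.1 ∈ subsums Polynomial.natDegree x.1 ∧
      x.2.1 ≤ ∑ P ∈ x.1, P.natDegree ∧
      (x.2.2.1.1.Monic ∧ x.2.2.1.2.Monic ∧ Irreducible x.2.2.1.2 ∧ x.2.2.1.1.natDegree ≤ D ∧
        x.2.2.1.1.natDegree + x.2.2.1.2.natDegree = b - x.2.1 ∧
        M ∣ x.2.2.1.1 * x.2.2.1.2 - c₁ x.1 x.2.1) ∧
      ((x.2.2.2.Monic ∧ x.2.2.2.natDegree = n - b - (∑ P ∈ x.1, P.natDegree - x.2.1)) ∧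
        M ∣ x.2.2.2 - c₂ x.1 x.2.1) ∧
      ∀ P, P.Monic → Irreducible P → P ∣ x.2.2.2 → P.natDegree ≤ D ∨ Y < P.natDegree := by
    rintro ⟨a, l, ⟨g, P⟩, v⟩ hx
    simp only [hΩ, mem_sigma, mem_product] at hx
    obtain ⟨ha, hl, h1, h2⟩ := hx
    have hla : l ≤ ∑ P ∈ a, P.natDegree := by
      obtain ⟨h3, h4, _⟩ := hdc a l ha hl
      rw [← h4]
      exact sum_le_sum_of_subset h3
    have := (h𝒜 a ha).2
    have hbl : M.natDegree + 1 ≤ b - l := by omega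
    exact ⟨ha, hl, hla, (mem_primeMultiples hbl).1 h1, mem_roughProgression.1 h2⟩
  have hne : ∀ x ∈ Ω, (f x).Monic := by
    intro x hx
    obtain ⟨h1, h2, h3, h4, h5, h6⟩ := hmem x hx
    exact ((Polynomial.monic_prod_of_monic _ _ fun P hP => (hpr _ h1 P hP).1).mul
      (h4.1.mul h4.2.1)).mul h5.1.1
  -- The factor of degree `b` is `g * P` times the subproduct of degree `l`, and the complementary
  -- subproduct goes with `v`; the classes `c₁`, `c₂` were chosen to make both congruences hold.
  have himage : ((Ω.image f : Finset F[X]) : Set F[X]) ⊆ H₂ n b B₁ B₂ M M := by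
    intro y hy
    obtain ⟨x, hx, rfl⟩ := mem_image.1 (mem_coe.1 hy)
    obtain ⟨h1, h2, h3, h4, h5, h6⟩ := hmem x hx
    obtain ⟨e1, e2, -, -, e3, e4⟩ := hdc x.1 x.2.1 h1 h2
    have hb8 := (h𝒜 x.1 h1).2
    have m1 : (∏ P ∈ d x.1 x.2.1, P).Monic :=
      Polynomial.monic_prod_of_monic _ _ fun P hP => (hpr _ h1 P (e1 hP)).1
    have m2 : (∏ P ∈ x.1 \ d x.1 x.2.1, P).Monic :=
      Polynomial.monic_prod_of_monic _ _ fun P hP => (hpr _ h1 P (Finset.mem_sdiff.1 hP).1).1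
    have n1 : (∏ P ∈ d x.1 x.2.1, P).natDegree = x.2.1 := by
      rw [Polynomial.natDegree_prod_of_monic _ _ fun P hP => (hpr _ h1 P (e1 hP)).1, e2]
    have n2 : (∏ P ∈ x.1 \ d x.1 x.2.1, P).natDegree = ∑ P ∈ x.1, P.natDegree - x.2.1 := by
      rw [Polynomial.natDegree_prod_of_monic _ _ fun P hP =>
        (hpr _ h1 P (Finset.mem_sdiff.1 hP).1).1, ← sum_sdiff e1, e2]
      omega
    refine ⟨(x.2.2.1.1 * x.2.2.1.2) * ∏ P ∈ d x.1 x.2.1, P, ⟨(h4.1.mul h4.2.1).mul m1, ?_⟩,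
      x.2.2.2 * ∏ P ∈ x.1 \ d x.1 x.2.1, P, ⟨h5.1.1.mul m2, ?_⟩, e3 _ h4.2.2.2.2.2,
      e4 _ h5.2, ?_⟩
    · rw [(h4.1.mul h4.2.1).natDegree_mul m1, h4.1.natDegree_mul h4.2.1, n1]
      omega
    · rw [h5.1.1.natDegree_mul m2, n2]
      omega
    · simp only [hf]
      rw [← prod_sdiff e1]
      ring
  -- A product determines its tuple up to the choice of `g` of degree at most `D` and of `P` among
  -- at most `12` primes: `a` is read off from `y`, `l` from the degree of `g * P`, and `v` by
  -- cancellation.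
  have hfibre : ∀ y ∈ Ω.image f, #(Ω.filter fun x => f x = y) ≤
      #((range (D + 1)).biUnion fun s => monics F s) * 12 := by
    intro y hy
    obtain ⟨x₀, hx₀, hx₀y⟩ := mem_image.1 hy
    have hdvd : ∀ x ∈ Ω, f x = y → ∀ Q : F[X], Q.Monic → Irreducible Q → Q ∣ y →
        Q ∈ x.1 ∨ Q.natDegree ≤ D ∨ Q = x.2.2.1.2 ∨ Y < Q.natDegree := by
      rintro x hx rfl Q hQ hQi hQd
      obtain ⟨h1, h2, h3, h4, h5, h6⟩ := hmem x hx
      rcases prime_dvd_cases (hpr _ h1) hQ hQi h4.2.1 h4.2.2.1 h4.1.ne_zero hQd with h | h | h | h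
      · exact Or.inl h
      · exact Or.inr (Or.inl (h.trans h4.2.2.2.1))
      · exact Or.inr (Or.inr (Or.inl h))
      · rcases h6 Q hQ hQi h with h | h
        · exact Or.inr (Or.inl h)
        · exact Or.inr (Or.inr (Or.inr h))
    have hsmall : ∀ x ∈ Ω, ∀ Q ∈ x.1, 8 * Q.natDegree ≤ b := by
      intro x hx Q hQ
      have h1 := (hmem x hx).1
      have h2 := (mem_blockPrimes.1 ((h𝒜 x.1 h1).1 hQ)).2.2.2
      omega
    have hbig : ∀ x ∈ Ω, b < 2 * x.2.2.1.2.natDegree ∧ x.2.2.1.2.natDegree ≤ b := by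
      intro x hx
      obtain ⟨h1, h2, h3, h4, h5, h6⟩ := hmem x hx
      have := (h𝒜 x.1 h1).2
      have := h4.2.2.2
      omega
    have hpd : ∀ x ∈ Ω, f x = y → x.2.2.1.2 ∣ y := by
      rintro x hx rfl
      simp only [hf]
      exact ((Dvd.intro_left _ rfl).mul_left _).mul_right _
    -- The degrees keep the parts separate: block primes have degree above `D` and below `b / 8 ≤
    -- Y`, whereas `P` has degree above `b / 2`.
    have haeq : ∀ x ∈ Ω, f x = y → x.1 = (blockPrimes F N J).filter (· ∣ y) := by
      intro x hx hxy
      have h1 := (hmem x hx).1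
      ext Q
      rw [mem_filter]
      constructor
      · intro hQ
        refine ⟨(h𝒜 x.1 h1).1 hQ, ?_⟩
        rw [← hxy]
        exact ((dvd_prod_of_mem (fun P => P) hQ).mul_right _).mul_right _
      · rintro ⟨hQ, hQd⟩
        obtain ⟨q1, q2, q3, q4⟩ := mem_blockPrimes.1 hQ
        have hb2 := hbig x hx
        rcases hdvd x hx hxy Q q1 q2 hQd with h | h | h | h
        · exact h
        · omega
        · rw [← h] at hb2
          omega
        · omega
    set T := (primesUpTo F b).filter fun Q => b < 2 * Q.natDegree ∧ Q ∣ y with hT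
    have hTmem : ∀ x ∈ Ω, f x = y → x.2.2.1.2 ∈ T := by
      intro x hx hxy
      obtain ⟨h1, h2, h3, h4, h5, h6⟩ := hmem x hx
      exact mem_filter.2 ⟨mem_primesUpTo.2 ⟨h4.2.1, h4.2.2.1, (hbig x hx).2⟩, (hbig x hx).1,
        hpd x hx hxy⟩
    -- If `n ≤ 6 b`, at most `12` prime factors can have degree above `b / 2`. If `Y ≥ b`, then `v`
    -- has no prime factor of degree in `(b / 2, b]`, so `P` is the only candidate.
    have hTcard : #T ≤ 12 := by
      rcases hY with hY | hY
      · have hym : y ∈ MonicOfDegree F n := H₂_subset_monicOfDegree (by omega) _ _ _ _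
          (himage (mem_coe.2 hy))
        refine card_prime_divisors_le (b := b) (by omega) hym.1.ne_zero (fun P hP => ?_)
          (by rw [hym.2]; exact hY)
        obtain ⟨h1, h2, h3⟩ := mem_filter.1 hP
        obtain ⟨h4, h5, _⟩ := mem_primesUpTo.1 h1
        exact ⟨h4, h5, h3, h2⟩
      · refine (card_le_card (t := {x₀.2.2.1.2}) fun Q hQ => ?_).trans (by simp)
        obtain ⟨h1, h2, h3⟩ := mem_filter.1 hQ
        obtain ⟨h4, h5, h6⟩ := mem_primesUpTo.1 h1
        rw [mem_singleton]
        rcases hdvd x₀ hx₀ hx₀y Q h4 h5 h3 with h | h | h | h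
        · have := hsmall x₀ hx₀ Q h
          omega
        · omega
        · exact h
        · omega
    refine le_trans ?_ (Nat.mul_le_mul_left _ hTcard)
    rw [← card_product]
    refine card_le_card_of_injOn (fun x => x.2.2.1) ?_ ?_
    · intro x hx
      simp only [coe_filter, Set.mem_ofPred_eq] at hx
      obtain ⟨h1, h2, h3, h4, h5, h6⟩ := hmem x hx.1
      simp only [coe_product, Set.mem_prod, mem_coe]
      refine ⟨mem_biUnion.2 ⟨_, mem_range.2 (Nat.lt_succ_of_le h4.2.2.2.1),
        mem_monics.2 ⟨h4.1, rfl⟩⟩, hTmem x hx.1 hx.2⟩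
    · rintro ⟨a, l, ⟨g, P⟩, v⟩ hx ⟨a', l', ⟨g', P'⟩, v'⟩ hx' heq
      simp only [coe_filter, Set.mem_ofPred_eq] at hx hx' heq
      obtain ⟨rfl, rfl⟩ := Prod.mk.inj heq
      have ha := (haeq _ hx.1 hx.2).trans (haeq _ hx'.1 hx'.2).symm
      simp only at ha
      subst ha
      obtain ⟨h1, h2, h3, h4, h5, h6⟩ := hmem _ hx.1
      obtain ⟨-, -, h3', h4', -, -⟩ := hmem _ hx'.1
      have hb8 := (h𝒜 _ h1).2
      simp only at h1 h3 h4 h3' h4' hb8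
      obtain rfl : l = l' := by omega
      have hv := hx.2.trans hx'.2.symm
      simp only [hf] at hv
      have hne0 : (∏ P ∈ a, P) * (g * P) ≠ 0 :=
        ((Polynomial.monic_prod_of_monic _ _ fun P hP => (hpr _ h1 P hP).1).mul
          (h4.1.mul h4.2.1)).ne_zero
      rw [mul_left_cancel₀ hne0 hv]
  refine (card_le_mul_card_image Ω _ hfibre).trans (Nat.mul_le_mul_left _ ?_)
  rw [← Set.ncard_coe_finset]
  exact Set.ncard_le_ncard himage
    ((finite_monicOfDegree n).subset (H₂_subset_monicOfDegree (by omega) _ _ _ _))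

end LowerBound

end PolyTable

namespace PolyTable
open Finset

section LowerBound

set_option linter.unusedSectionVars false

variable {F : Type*} [Field F] [Fintype F]

/-- The cardinality of the field, as a real number. -/
local notation "𝐪" => (Fintype.card F : ℝ)

lemma exists_le_ncard_H₂ {M : F[X]} (hM : M.Monic) : ∃ c > 0, ∃ b₀ : ℕ,
    ∀ B₁ B₂ : F[X], IsCoprime B₁ M → IsCoprime B₂ M → ∀ b ≥ b₀, ∀ n, 2 * b ≤ n →
    c * order (Fintype.card F) n b ≤ ((H₂ n b B₁ B₂ M M).ncard : ℝ) := by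
  classical
  obtain ⟨κ₁, hκ₁, t₁, h₁⟩ := exists_le_card_primeMultiples hM
  obtain ⟨κ₂, hκ₂, t₂, h₂⟩ := exists_le_card_roughProgression hM
  obtain ⟨c₀, K, hc₀, hK, h₀⟩ := exists_le_sum_subsums_blockPrimes
  set D := M.natDegree with hD
  have hq := card_pos (F := F)
  -- `N` makes the block primes larger than `deg M`, hence coprime to `M`. Below, `L` makes the
  -- product of the primes of each `a` have degree at most `b / 8`.
  obtain ⟨N, hN14, hND⟩ : ∃ N, 14 ≤ N ∧ D + 2 ≤ N := ⟨max 14 (D + 2), le_max_left _ _,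
    le_max_right _ _⟩
  obtain ⟨L, hLN, hLK⟩ : ∃ L : ℕ, 8 * N ≤ L ∧ 8 * (K * N) ≤ L := by
    refine ⟨max (8 * N) ⌈8 * (K * N)⌉₊, le_max_left _ _, (Nat.le_ceil _).trans ?_⟩
    exact_mod_cast le_max_right _ _
  have hL1 : 1 ≤ L := by omega
  have hL0 : (0 : ℝ) < L := by exact_mod_cast hL1
  set S := #((range (D + 1)).biUnion fun s => monics F s) with hS
  have hS1 : 1 ≤ S := Finset.card_pos.2 ⟨1, mem_biUnion.2 ⟨0, by simp,
    mem_monics.2 ⟨Polynomial.monic_one, Polynomial.natDegree_one⟩⟩⟩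
  have hS0 : (0 : ℝ) < S := by exact_mod_cast hS1
  -- The threshold for `b`: `4 L` forces `J ≥ 2`, the terms in `t₁` and `t₂` make the prime
  -- multiples and `Y` large enough, and `16 (D + 1)` leaves room for the cofactors.
  refine ⟨κ₁ * κ₂ / 2 * c₀ / (2 * L) / (4 * (2 * L)) / (S * 12), by positivity,
    4 * L + 8 * t₁ + 8 * t₂ + 16 * (D + 1), fun B₁ B₂ hB₁ hB₂ b hb n hbn => ?_⟩
  have hb1 : 1 ≤ b := by omega
  have hb0 : (0 : ℝ) < b := by exact_mod_cast hb1
  set J := Nat.log 2 (b / L) with hJ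
  have hbL : 4 ≤ b / L := (Nat.le_div_iff_mul_le hL1).2 (by omega)
  have hJ2 : 2 ≤ J := by
    rw [hJ]
    exact Nat.le_log_of_pow_le (by norm_num) hbL
  have hJle : L * 2 ^ J ≤ b := by
    have h3 : 2 ^ J ≤ b / L := Nat.pow_log_le_self 2 (by omega)
    rw [Nat.le_div_iff_mul_le hL1] at h3
    rwa [mul_comm]
  have hJlt : b < 2 * L * 2 ^ J := by
    have h3 : b / L < 2 ^ (J + 1) := Nat.lt_pow_succ_log_self (by norm_num) _
    rw [Nat.div_lt_iff_lt_mul hL1, pow_succ] at h3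
    linarith
  have hJle' : (L : ℝ) * 2 ^ J ≤ b := by exact_mod_cast hJle
  have hJlt' : (b : ℝ) ≤ 2 * L * 2 ^ J := by exact_mod_cast hJlt.le
  -- `Y = b / 4` fits even when `n = 2 b`. For larger `n` the number of large primes dividing a
  -- product is not bounded by degree, and `Y = 2 b` makes the prime `P` unique instead.
  obtain ⟨Y, hY1, hY2, hY3, hY4, hY5⟩ : ∃ Y, t₂ ≤ Y ∧ b ≤ 8 * Y ∧ Y ≤ 2 * b ∧
      (n ≤ 6 * b ∨ b ≤ Y) ∧ b + b / 8 + Y + (D + 1) ≤ n := by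
    by_cases hn : n ≤ 6 * b
    · exact ⟨b / 4, by omega, by omega, by omega, Or.inl hn, by omega⟩
    · exact ⟨2 * b, by omega, by omega, by omega, Or.inr (by omega), by omega⟩
  set 𝒜 := (blockPrimes F N J).powerset.filter
    (fun a => ∑ P ∈ a, (P.natDegree : ℝ) ≤ K * N * 2 ^ J) with h𝒜
  have hA : ∀ a ∈ 𝒜, a ⊆ blockPrimes F N J ∧ 8 * ∑ P ∈ a, P.natDegree ≤ b := by
    intro a ha
    obtain ⟨h3, h4⟩ := mem_filter.1 ha
    refine ⟨mem_powerset.1 h3, ?_⟩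
    have h5 : 8 * ∑ P ∈ a, (P.natDegree : ℝ) ≤ b := by
      calc 8 * ∑ P ∈ a, (P.natDegree : ℝ) ≤ 8 * (K * N * 2 ^ J) := by gcongr
        _ = (8 * (K * N)) * 2 ^ J := by ring
        _ ≤ L * 2 ^ J := by gcongr
        _ ≤ b := hJle'
    exact_mod_cast h5
  have hNb : 8 * (N * 2 ^ J) ≤ b := by
    calc 8 * (N * 2 ^ J) = (8 * N) * 2 ^ J := by ring
      _ ≤ L * 2 ^ J := Nat.mul_le_mul_right _ hLN
      _ ≤ b := hJle
  obtain ⟨c₁, c₂, hcop, hcount⟩ := exists_card_tuples_le hB₁ hB₂ hM.ne_zero hND hbn hNb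
    (by omega) hY2 hY4 𝒜 hA
  have hlow : ∀ a ∈ 𝒜, ∀ l ∈ subsums Polynomial.natDegree a,
      κ₁ * κ₂ / (2 * b ^ 2) * 𝐪 ^ n * ∏ P ∈ a, normInv P ≤
      (#(primeMultiples M (c₁ a l) (b - l)) : ℝ) *
        #(roughProgression M Y (c₂ a l) (n - b - (∑ P ∈ a, P.natDegree - l))) := by
    intro a ha l hl
    obtain ⟨hc1, hc2⟩ := hcop a ha l hl
    have ha8 := (hA a ha).2
    have hla : l ≤ ∑ P ∈ a, P.natDegree := by
      obtain ⟨d, hd, rfl⟩ := mem_subsums.1 hl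
      exact sum_le_sum_of_subset hd
    rw [prod_normInv]
    set s := ∑ P ∈ a, P.natDegree with hs
    have e1 : κ₁ * 𝐪 ^ (b - l) / b ≤ (#(primeMultiples M (c₁ a l) (b - l)) : ℝ) := by
      rw [div_le_iff₀' hb0]
      refine ((h₁ (b - l) (by omega)).2 _ hc1).trans ?_
      have : ((b - l : ℕ) : ℝ) ≤ b := by exact_mod_cast Nat.sub_le _ _
      gcongr
    have e2 : κ₂ * 𝐪 ^ (n - b - (s - l)) / (2 * b) ≤
        (#(roughProgression M Y (c₂ a l) (n - b - (s - l))) : ℝ) := by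
      rw [div_le_iff₀' (by positivity)]
      refine (h₂ Y hY1 _ (by omega) _ hc2).trans ?_
      have : (Y : ℝ) ≤ 2 * b := by exact_mod_cast hY3
      gcongr
    have e3 : 𝐪 ^ n = 𝐪 ^ (b - l) * 𝐪 ^ (n - b - (s - l)) * 𝐪 ^ s := by
      rw [← pow_add, ← pow_add]; congr 1; omega
    calc κ₁ * κ₂ / (2 * b ^ 2) * 𝐪 ^ n * (𝐪 ^ s)⁻¹
        = (κ₁ * 𝐪 ^ (b - l) / b) * (κ₂ * 𝐪 ^ (n - b - (s - l)) / (2 * b)) := by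
          rw [e3]; field_simp
      _ ≤ _ := by gcongr
  have hsum : κ₁ * κ₂ / (2 * b ^ 2) * 𝐪 ^ n * (c₀ * (rate ^ J * decay J)) ≤
      (S : ℝ) * 12 * ((H₂ n b B₁ B₂ M M).ncard : ℝ) := by
    calc κ₁ * κ₂ / (2 * b ^ 2) * 𝐪 ^ n * (c₀ * (rate ^ J * decay J))
        ≤ κ₁ * κ₂ / (2 * b ^ 2) * 𝐪 ^ n * ∑ a ∈ 𝒜, (∏ P ∈ a, normInv P) *
          (#(subsums Polynomial.natDegree a) : ℝ) := by
          gcongr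
          exact h₀ F N J hN14 hJ2
      _ = ∑ a ∈ 𝒜, ∑ _l ∈ subsums Polynomial.natDegree a,
          κ₁ * κ₂ / (2 * b ^ 2) * 𝐪 ^ n * ∏ P ∈ a, normInv P := by
          rw [mul_sum]
          refine sum_congr rfl fun a _ => ?_
          rw [sum_const, nsmul_eq_mul]
          ring
      _ ≤ ∑ a ∈ 𝒜, ∑ l ∈ subsums Polynomial.natDegree a,
          (#(primeMultiples M (c₁ a l) (b - l)) : ℝ) *
          #(roughProgression M Y (c₂ a l) (n - b - (∑ P ∈ a, P.natDegree - l))) :=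
          sum_le_sum fun a ha => sum_le_sum fun l hl => hlow a ha l hl
      _ ≤ _ := by exact_mod_cast hcount
  have horder := order_le_mul (Fintype.card F) n (b := b) (J := J) (K := 2 * L)
    (by have : (1 : ℝ) ≤ L := by exact_mod_cast hL1
        linarith) (by omega) ((Nat.le_mul_of_pos_left _ hL1).trans hJle) hJlt'
  rw [div_mul_eq_mul_div, div_le_iff₀' (by positivity)]
  refine le_trans ?_ hsum
  have hrate := rate_pos
  have hdecay := decay_nonneg J
  calc κ₁ * κ₂ / 2 * c₀ / (2 * L) / (4 * (2 * L)) * order (Fintype.card F) n b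
      ≤ κ₁ * κ₂ / 2 * c₀ / (2 * L) / (4 * (2 * L)) *
        (4 * (2 * L) * (𝐪 ^ n * ((rate / 2) ^ J * decay J / b))) := by gcongr
    -- One factor `2 ^ J` of `rate ^ J` is exchanged for `b`, using `b ≤ 2 L * 2 ^ J`.
    _ = κ₁ * κ₂ / 2 * c₀ / b * 𝐪 ^ n * rate ^ J * decay J * (1 / (2 * L * 2 ^ J)) := by
        rw [div_pow]; field_simp
    _ ≤ κ₁ * κ₂ / 2 * c₀ / b * 𝐪 ^ n * rate ^ J * decay J * (1 / b) := by gcongr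
    _ = _ := by field_simp

/-! ### Small `b` and the three counting functions -/

lemma le_order_const (q n : ℕ) {b : ℕ} (hb : 1 ≤ b) : order q n b ≤ (q : ℝ) ^ n := by
  have h1 : (1 : ℝ) ≤ b := by exact_mod_cast hb
  have h2 := Real.log_natCast_nonneg b
  have h3 : (1 : ℝ) ≤ (b : ℝ) ^ delta := Real.one_le_rpow h1 delta_nonneg
  have h4 : (1 : ℝ) ≤ (1 + Real.log b) ^ (3 / 2 : ℝ) :=
    Real.one_le_rpow (by linarith) (by norm_num)
  unfold order
  exact div_le_self (by positivity) (one_le_mul_of_one_le_of_one_le h3 h4)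

/-- Fix one admissible `G₁` and let `G₂` vary. The loss `q ^ (b + deg M₂)` is harmless for bounded
`b`. -/
lemma le_ncard_H₂ {M₁ M₂ : F[X]} (hM₁ : M₁ ≠ 0) (hM₂ : M₂ ≠ 0) (A₁ A₂ : F[X]) {n b : ℕ}
    (h₁ : M₁.natDegree ≤ b) (h₂ : M₂.natDegree ≤ n - b) (hb : b ≤ n) :
    𝐪 ^ n / 𝐪 ^ (b + M₂.natDegree) ≤ ((H₂ n b A₁ A₂ M₁ M₂).ncard : ℝ) := by
  classical
  have hq := card_pos (F := F)
  have hdeg : ∀ M : F[X], M ≠ 0 → (normalize M).natDegree = M.natDegree := fun M _ =>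
    Polynomial.natDegree_eq_of_degree_eq
      (Polynomial.degree_eq_degree_of_associated (normalize_associated M))
  have c1 := card_progression (Polynomial.monic_normalize hM₁) A₁ (t := b) (by rwa [hdeg M₁ hM₁])
  have c2 := card_progression (Polynomial.monic_normalize hM₂) A₂ (t := n - b)
    (by rwa [hdeg M₂ hM₂])
  obtain ⟨G, hG⟩ := Finset.card_pos.1 (show 0 < #(progression (normalize M₁) A₁ b) by
    rw [c1]; exact pow_pos Fintype.card_pos _)
  obtain ⟨hG1, hG2⟩ := mem_progression.1 hG
  have hsub : (((progression (normalize M₂) A₂ (n - b)).image (G * ·) : Finset F[X]) : Set F[X]) ⊆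
      H₂ n b A₁ A₂ M₁ M₂ := by
    intro f hf
    obtain ⟨g, hg, rfl⟩ := mem_image.1 (mem_coe.1 hf)
    obtain ⟨hg1, hg2⟩ := mem_progression.1 hg
    exact ⟨G, hG1, g, hg1, normalize_dvd_iff.1 hG2, normalize_dvd_iff.1 hg2, rfl⟩
  have h3 := Set.ncard_le_ncard hsub
    ((finite_monicOfDegree n).subset (H₂_subset_monicOfDegree hb _ _ _ _))
  rw [Set.ncard_coe_finset, card_image_of_injective _ (mul_right_injective₀ hG1.1.ne_zero), c2,
    hdeg M₂ hM₂] at h3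
  have h4 : 𝐪 ^ (n - b - M₂.natDegree) ≤ ((H₂ n b A₁ A₂ M₁ M₂).ncard : ℝ) := by exact_mod_cast h3
  refine le_trans (le_of_eq ?_) h4
  rw [div_eq_iff (by positivity), ← pow_add]
  congr 1
  omega

lemma H₂_subset_of_dvd {M M₁ M₂ A₁ A₂ : F[X]} {n b : ℕ} (h₁ : M₁ ∣ M) (h₂ : M₂ ∣ M) :
    H₂ n b A₁ A₂ M M ⊆ H₂ n b A₁ A₂ M₁ M₂ := by
  rintro f ⟨G₁, hG₁, G₂, hG₂, c₁, c₂, rfl⟩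
  exact ⟨G₁, hG₁, G₂, hG₂, h₁.trans c₁, h₂.trans c₂, rfl⟩

/-- A congruence for the product follows from `G₁ ≡ 1` and `G₂ ≡ A`. -/
lemma H₂_subset_H {M A : F[X]} {n b : ℕ} (hb : b ≤ n) : H₂ n b 1 A M M ⊆ H n b A M := by
  intro f hf
  refine ⟨H₂_subset_monicOfDegree hb _ _ _ _ hf, ?_⟩
  obtain ⟨G₁, hG₁, G₂, hG₂, ⟨u, hu⟩, ⟨v, hv⟩, rfl⟩ := hf
  refine ⟨⟨G₁, hG₁.2, Dvd.intro _ rfl⟩, u * G₂ + v, ?_⟩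
  linear_combination G₂ * hu + hv

lemma H₂_subset_H' {M₁ M₂ A₁ A₂ : F[X]} {n b : ℕ} (hb : b ≤ n) :
    H₂ n b A₁ A₂ M₁ M₂ ⊆ H' n b A₁ M₁ := by
  intro f hf
  refine ⟨H₂_subset_monicOfDegree hb _ _ _ _ hf, ?_⟩
  obtain ⟨G₁, hG₁, G₂, hG₂, h1, h2, rfl⟩ := hf
  exact ⟨G₁, hG₁, Dvd.intro _ rfl, h1⟩

open Classical in
lemma exists_sizeBetween {M₁ M₂ : F[X]} (hM₁ : M₁ ≠ 0) (hM₂ : M₂ ≠ 0) {A₁ A₂ : F[X]}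
    (hA₁ : IsCoprime A₁ (M₁ * M₂)) (hA₂ : IsCoprime A₂ (M₁ * M₂)) :
    ∃ c C : ℝ, 0 < c ∧ 0 < C ∧ ∀ n b : ℕ, 1 ≤ b → 2 * b ≤ n → M₁.natDegree ≤ b →
      M₂.natDegree ≤ b →
      SizeBetween c C (order (Fintype.card F) n b) (H n b A₁ M₁) ∧
      SizeBetween c C (order (Fintype.card F) n b) (H' n b A₁ M₁) ∧
      SizeBetween c C (order (Fintype.card F) n b) (H₂ n b A₁ A₂ M₁ M₂) := by
  obtain ⟨C, hC, hup⟩ := exists_card_divisor_le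
  set M := normalize (M₁ * M₂) with hMdef
  have hMm : M.Monic := Polynomial.monic_normalize (mul_ne_zero hM₁ hM₂)
  have hd₁ : M₁ ∣ M := (Dvd.intro _ rfl : M₁ ∣ M₁ * M₂).trans (dvd_normalize_iff.2 dvd_rfl)
  have hd₂ : M₂ ∣ M := (Dvd.intro_left _ rfl : M₂ ∣ M₁ * M₂).trans (dvd_normalize_iff.2 dvd_rfl)
  have hB₁ : IsCoprime A₁ M := hA₁.of_isCoprime_of_dvd_right (normalize_dvd_iff.2 dvd_rfl)
  have hB₂ : IsCoprime A₂ M := hA₂.of_isCoprime_of_dvd_right (normalize_dvd_iff.2 dvd_rfl)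
  obtain ⟨c₁, hc₁, b₀, hlow⟩ := exists_le_ncard_H₂ hMm
  have hq := card_pos (F := F)
  have hq1 : (1 : ℝ) ≤ 𝐪 := by linarith [two_le_card (F := F)]
  -- The constant for `b < b₀`, where `order` is simply bounded by `q ^ n`.
  set c₂ := 1 / 𝐪 ^ (b₀ + M₁.natDegree + M₂.natDegree) with hc₂
  have hc₂pos : 0 < c₂ := by positivity
  refine ⟨min c₁ c₂, C, lt_min hc₁ hc₂pos, hC, fun n b hb hbn h₁ h₂ => ?_⟩
  have hord := order_nonneg (Fintype.card F) n b
  have hfin := finite_monicOfDegree (F := F) n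
  have hupper : ∀ S : Set F[X], S ⊆ MonicOfDegree F n →
      (∀ f ∈ S, ∃ G : F[X], G.natDegree = b ∧ G ∣ f) →
      (S.ncard : ℝ) ≤ C * order (Fintype.card F) n b := by
    intro S hS hS'
    refine le_trans ?_ (hup F n b hb hbn)
    have h3 : S ⊆ (((monics F n).filter fun f => ∃ G : F[X], G.natDegree = b ∧ G ∣ f :
        Finset F[X]) : Set F[X]) := fun f hf => by
      rw [mem_coe, mem_filter, mem_monics]
      exact ⟨hS hf, hS' f hf⟩
    have h4 := Set.ncard_le_ncard h3 (Finset.finite_toSet _)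
    rw [Set.ncard_coe_finset] at h4
    exact_mod_cast h4
  -- For `b ≥ b₀` the modulus `M` is used; for `b < b₀` its degree might exceed `b`, so the original
  -- moduli, called `N₁` and `N₂` here, take over.
  have hlower : ∀ S T : Set F[X], T ⊆ S → S ⊆ MonicOfDegree F n →
      (∃ B₁ B₂ N₁ N₂ : F[X], H₂ n b B₁ B₂ M M ⊆ T ∧ IsCoprime B₁ M ∧ IsCoprime B₂ M ∧
        H₂ n b B₁ B₂ N₁ N₂ ⊆ S ∧ N₁ ≠ 0 ∧ N₂ ≠ 0 ∧ N₁.natDegree ≤ b ∧ N₂.natDegree ≤ b ∧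
        N₂.natDegree ≤ M₁.natDegree + M₂.natDegree) →
      min c₁ c₂ * order (Fintype.card F) n b ≤ (S.ncard : ℝ) := by
    rintro S T hTS hS ⟨B₁, B₂, N₁, N₂, hsub, hcop₁, hcop₂, hsub', hN₁, hN₂, hd1, hd2, hd3⟩
    have hmono : ∀ U : Set F[X], U ⊆ S → (U.ncard : ℝ) ≤ (S.ncard : ℝ) := fun U hU => by
      exact_mod_cast Set.ncard_le_ncard hU (hfin.subset hS)
    by_cases hbb : b₀ ≤ b
    · refine le_trans ?_ (hmono _ (hsub.trans hTS))
      exact (mul_le_mul_of_nonneg_right (min_le_left _ _) hord).trans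
        (hlow B₁ B₂ hcop₁ hcop₂ b hbb n hbn)
    · refine le_trans ?_ (hmono _ hsub')
      refine le_trans ?_ (le_ncard_H₂ hN₁ hN₂ B₁ B₂ hd1 (by omega) (by omega))
      calc min c₁ c₂ * order (Fintype.card F) n b ≤ c₂ * 𝐪 ^ n := by
            gcongr
            · exact min_le_right _ _
            · exact le_order_const _ _ hb
        _ ≤ _ := by
            rw [hc₂, one_div_mul_eq_div]
            have : b + N₂.natDegree ≤ b₀ + M₁.natDegree + M₂.natDegree := by omega
            gcongr
  have hb' : b ≤ n := by omega
  have hHsub : H n b A₁ M₁ ⊆ MonicOfDegree F n := fun f hf => hf.1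
  have hH'sub : H' n b A₁ M₁ ⊆ MonicOfDegree F n := fun f hf => hf.1
  have hH₂sub := H₂_subset_monicOfDegree hb' A₁ A₂ M₁ M₂
  refine ⟨⟨hfin.subset hHsub, hlower _ _ subset_rfl hHsub ?_, hupper _ hHsub fun f hf => hf.2.1⟩,
    ⟨hfin.subset hH'sub, hlower _ _ subset_rfl hH'sub ?_, hupper _ hH'sub ?_⟩,
    ⟨hfin.subset hH₂sub, hlower _ _ subset_rfl hH₂sub ?_, hupper _ hH₂sub ?_⟩⟩
  · exact ⟨1, A₁, M₁, M₁, (H₂_subset_of_dvd hd₁ hd₁).trans (H₂_subset_H hb'), isCoprime_one_left,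
      hB₁, H₂_subset_H hb', hM₁, hM₁, h₁, h₁, by omega⟩
  · exact ⟨A₁, A₂, M₁, M₂, (H₂_subset_of_dvd hd₁ hd₂).trans (H₂_subset_H' hb'), hB₁, hB₂,
      H₂_subset_H' hb', hM₁, hM₂, h₁, h₂, by omega⟩
  · rintro f ⟨_, G, hG, hdvd, _⟩
    exact ⟨G, hG.2, hdvd⟩
  · exact ⟨A₁, A₂, M₁, M₂, H₂_subset_of_dvd hd₁ hd₂, hB₁, hB₂, subset_rfl, hM₁, hM₂, h₁, h₂,
      by omega⟩
  · rintro f ⟨G₁, hG₁, G₂, _, _, _, rfl⟩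
    exact ⟨G₁, hG₁.2, Dvd.intro _ rfl⟩

end LowerBound

end PolyTable

theorem corollary1p7 {F : Type*} [Field F] [Fintype F] [DecidableEq F]
    (M₁ M₂ A₁ A₂ : F[X]) (hM₁ : M₁ ≠ 0) (hM₂ : M₂ ≠ 0)
    (hA₁ : IsCoprime A₁ (EuclideanDomain.lcm M₁ M₂))
    (hA₂ : IsCoprime A₂ (EuclideanDomain.lcm M₁ M₂)) :
    ∃ c C : ℝ, 0 < c ∧ 0 < C ∧
      (∀ᶠ n : ℕ in atTop, ∀ b : ℕ, 1 ≤ b → (b : ℝ) ≤ (n : ℝ) / 2 →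
        ∀ ε : ℝ, 0 < ε →
          PolyTable.DegreeCondition ε b M₁ → PolyTable.DegreeCondition ε b M₂ →
            PolyTable.SizeBetween c C (PolyTable.order (Fintype.card F) n b)
              (PolyTable.H n b A₁ M₁) ∧
            PolyTable.SizeBetween c C (PolyTable.order (Fintype.card F) n b)
              (PolyTable.H' n b A₁ M₁) ∧
            PolyTable.SizeBetween c C (PolyTable.order (Fintype.card F) n b)
              (PolyTable.H₂ n b A₁ A₂ M₁ M₂)) ∧
      (∀ᶠ n : ℕ in atTop,
        PolyTable.SizeBetween c C (PolyTable.order (Fintype.card F) (2 * n) n)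
          (PolyTable.Table n A₁ M₁) ∧
        PolyTable.SizeBetween c C (PolyTable.order (Fintype.card F) (2 * n) n)
          (PolyTable.Table' n A₁ M₁) ∧
        PolyTable.SizeBetween c C (PolyTable.order (Fintype.card F) (2 * n) n)
          (PolyTable.Table₂ n A₁ A₂ M₁ M₂)) := by
  -- Coprimality to the least common multiple gives it for each modulus, hence for their product.
  have hco : ∀ A : F[X], IsCoprime A (EuclideanDomain.lcm M₁ M₂) → IsCoprime A (M₁ * M₂) :=
    fun A h => (h.of_isCoprime_of_dvd_right (EuclideanDomain.dvd_lcm_left M₁ M₂)).mul_right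
      (h.of_isCoprime_of_dvd_right (EuclideanDomain.dvd_lcm_right M₁ M₂))
  obtain ⟨c, C, hc, hC, h⟩ := PolyTable.exists_sizeBetween hM₁ hM₂ (hco A₁ hA₁) (hco A₂ hA₂)
  refine ⟨c, C, hc, hC, Eventually.of_forall fun n b hb hbn ε hε h₁ h₂ => ?_, ?_⟩
  · have hle : ∀ M : F[X], PolyTable.DegreeCondition ε b M → M.natDegree ≤ b := fun M hM => by
      unfold PolyTable.DegreeCondition at hM
      have hb0 : (0 : ℝ) ≤ b := by positivity
      have h3 : (M.natDegree : ℝ) ≤ b := by nlinarith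
      exact_mod_cast h3
    refine h n b hb ?_ (hle _ h₁) (hle _ h₂)
    have h3 : (2 : ℝ) * b ≤ n := by linarith
    exact_mod_cast h3
  · filter_upwards [eventually_ge_atTop (max 1 (max M₁.natDegree M₂.natDegree))] with n hn
    simp only [max_le_iff] at hn
    exact h (2 * n) n hn.1 le_rfl hn.2.1 hn.2.2
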